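/- Let $K(x)=\frac{1}{2\pi}\frac{x^\perp}{|x|^2}$ for $x\in\mathbb R^2\setminus\{0\}$, where $(x_1,x_2)^\perp=(-x_2,x_1)$. Let $\omega_0\in L^1\cap L^\infty(\mathbb R^2)$ and $z_0\in\mathbb R^2$. For $\omega\in L^\infty(\mathbb R^+,L^1\cap L^\infty(\mathbb R^2))$ put $v(t,\cdot)=K*\omega(t,\cdot)$. A pair $(\omega,z)$ is a global Eulerian solution of the vortex-wave system with datum $(\omega_0,z_0)$ if $\omega\in L^\infty(\mathbb R^+,L^1\cap L^\infty(\mathbb R^2))$, $z\in C(\mathbb R^+,\mathbb R^2)$, $$-\int_{\mathbb R^2}\omega_0(x)\psi(0,x)\,dx=\int_0^\infty\!\!\int_{\mathbb R^2}\omega\,\big(\partial_t\psi+(v+K(\cdot-z(t)))\cdot\nabla\psi\big)\,dx\,dt$$ for every test function $\psi\in C_c^\infty(\mathbb R^+\times\mathbb R^2)$ (not required to vanish at $t=0$; $\mathbb R^+=[0,\infty)$), and $z(t)=z_0+\int_0^t v(s,z(s))\,ds$ for all $t\ge 0$. A triple $(\omega,z,\phi)$ is a global Lagrangian solution with datum $(\omega_0,z_0)$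 if $\omega\in L^\infty(\mathbb R^+,L^1\cap L^\infty(\mathbb R^2))$, $v=K*\omega\in C(\mathbb R^+\times\mathbb R^2)$, $z\in C^1(\mathbb R^+,\mathbb R^2)$, $\phi_\cdot(x)\in C^1(\mathbb R^+,\mathbb R^2)$ for each $x\ne z_0$, and for all $t\ge0$ $$\dot z(t)=v(t,z(t)),\quad z(0)=z_0,\quad \dot\phi_t(x)=v(t,\phi_t(x))+K(\phi_t(x)-z(t)),\quad \phi_0(x)=x\quad(x\neq z_0),$$ $\omega(t,\phi_t(x))=\omega_0(x)$ for a.e. $x$, and $\phi_t$ is a homeomorphism of $\mathbb R^2\setminus\{z_0\}$ onto $\mathbb R^2\setminus\{z(t)\}$ preserving Lebesgue measure. Let $(\omega,z)$ be a global Eulerian solution with datum $(\omega_0,z_0)$. Then, after modifying $\omega$ on a null subset of $\mathbb R^+\times\mathbb R^2$: 1. $v=K*\omega$ is continuous and bounded on $\mathbb R^+\times\mathbb R^2$ and uniformly almost-Lipschitz: there is $C$ such that $|v(t,x)-v(t,y)|\le C\varphi(|x-y|)$ for all $t\ge0$ and $x,y\in\mathbb R^2$, where $\varphi(r)=r(1-\ln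 r)$ for $0\le r<1$ (with $\varphi(0)=0$) and $\varphi(r)=1$ for $r\ge1$. 2. $z\in C^1(\mathbb R^+,\mathbb R^2)$ and $\dot z(t)=v(t,z(t))$ for all $t\ge0$. 3. There is a unique global flow $\phi$, $C^1$ in time, such that $(\omega,z,\phi)$ is a global Lagrangian solution with datum $(\omega_0,z_0)$. Moreover, for each $x\ne z_0$ and $T>0$, every solution on $[0,T)$ of $\dot\gamma=v(t,\gamma)+K(\gamma-z(t))$, $\gamma(0)=x$ (with $\gamma(t)\neq z(t)$) coincides with $t\mapsto\phi_t(x)$ on $[0,T)$. Consequently the Eulerian and Lagrangian formulations are equivalent: $(\omega,z)$ is a global Eulerian solution with datum $(\omega_0,z_0)$ if and only if, after modifying $\omega$ on a null subset of $\mathbb R^+\times\mathbb R^2$, there is $\phi$ such that $(\omega,z,\phi)$ is a global Lagrangian solution with this datum. -/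

import Mathlib

open MeasureTheory Set
open scoped ENNReal NNReal

namespace VortexWave

/-- The Euclidean plane `ℝ²`. -/
abbrev Plane : Type := EuclideanSpace ℝ (Fin 2)

/-- Rotation by a right angle: `(x₁, x₂)^⊥ = (-x₂, x₁)`. -/
def perp (x : Plane) : Plane := !₂[-x 1, x 0]

/-- The Biot-Savart kernel `K(x) = x^⊥ / (2π |x|²)` for `x ≠ 0` (the value at `0` is `0`). -/
noncomputable def kernel (x : Plane) : Plane :=
  (1 / (2 * Real.pi * ‖x‖ ^ 2)) • perp x

/-- The convolution `K ∗ f` on the plane. -/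
noncomputable def biotSavart (f : Plane → ℝ) (x : Plane) : Plane :=
  ∫ y, f y • kernel (x - y)

/-- The velocity field `v(t, ·) = K ∗ ω(t, ·)`. -/
noncomputable def velocity (ω : ℝ → Plane → ℝ) (t : ℝ) (x : Plane) : Plane :=
  biotSavart (ω t) x

/-- Lebesgue measure on `[0, ∞) × ℝ²`. -/
noncomputable def spaceTime : Measure (ℝ × Plane) :=
  (volume.restrict (Ici (0 : ℝ))).prod volume

/-- `f ∈ L¹ ∩ L^∞(ℝ²)`. -/
def MemL1Linf (f : Plane → ℝ) : Prop :=
  MemLp f 1 volume ∧ MemLp f ∞ volume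

/-- `ω ∈ L^∞([0, ∞), L¹ ∩ L^∞(ℝ²))`. -/
def MemLinfL1Linf (ω : ℝ → Plane → ℝ) : Prop :=
  AEStronglyMeasurable (Function.uncurry ω) spaceTime ∧
    ∃ C : ℝ≥0, ∀ᵐ t ∂(volume.restrict (Ici (0 : ℝ))),
      eLpNorm (ω t) 1 volume ≤ C ∧ eLpNorm (ω t) ∞ volume ≤ C

/-- The almost-Lipschitz modulus: `r (1 - ln r)` for `0 ≤ r < 1` and `1` for `r ≥ 1`. -/
noncomputable def modulus (r : ℝ) : ℝ :=
  if r < 1 then r * (1 - Real.log r) else 1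

/-- Global Eulerian solutions `(ω, z)` of the vortex-wave system with datum `(ω₀, z₀)`.
Only times `t ≥ 0` matter, and the notion depends on `ω` only up to null sets of
`[0, ∞) × ℝ²`. Test functions on `[0, ∞) × ℝ²` are the restrictions of the smooth compactly
supported functions on `ℝ × ℝ²`; they need not vanish at `t = 0`. -/
structure IsEulerian (ω₀ : Plane → ℝ) (z₀ : Plane) (ω : ℝ → Plane → ℝ) (z : ℝ → Plane) :
    Prop where
  mem : MemLinfL1Linf ω
  continuousOn_z : ContinuousOn z (Ici 0)
  weak : ∀ ψ : ℝ → Plane → ℝ, ContDiff ℝ (⊤ : ℕ∞) (Function.uncurry ψ) →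
    HasCompactSupport (Function.uncurry ψ) →
    -∫ x, ω₀ x * ψ 0 x =
      ∫ t in Ici (0 : ℝ), ∫ x, ω t x *
        (deriv (fun s => ψ s x) t +
          fderiv ℝ (ψ t) x (velocity ω t x + kernel (x - z t)))
  point_vortex : ∀ t : ℝ, 0 ≤ t → z t = z₀ + ∫ s in (0 : ℝ)..t, velocity ω s (z s)

/-- Global Lagrangian solutions `(ω, z, φ)` of the vortex-wave system with datum `(ω₀, z₀)`.
Only times `t ≥ 0` and, for `φ`, points `x ≠ z₀` matter. Here `ω` is a representative for which
the equations hold at every time. -/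
structure IsLagrangian (ω₀ : Plane → ℝ) (z₀ : Plane) (ω : ℝ → Plane → ℝ) (z : ℝ → Plane)
    (φ : ℝ → Plane → Plane) : Prop where
  mem : MemLinfL1Linf ω
  continuousOn_velocity : ContinuousOn (Function.uncurry (velocity ω)) (Ici 0 ×ˢ univ)
  contDiffOn_z : ContDiffOn ℝ 1 z (Ici 0)
  deriv_z : ∀ t : ℝ, 0 ≤ t → HasDerivWithinAt z (velocity ω t (z t)) (Ici 0) t
  z_zero : z 0 = z₀
  contDiffOn_flow : ∀ x, x ≠ z₀ → ContDiffOn ℝ 1 (fun t => φ t x) (Ici 0)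
  deriv_flow : ∀ x, x ≠ z₀ → ∀ t : ℝ, 0 ≤ t →
    HasDerivWithinAt (fun s => φ s x) (velocity ω t (φ t x) + kernel (φ t x - z t)) (Ici 0) t
  flow_zero : ∀ x, x ≠ z₀ → φ 0 x = x
  transported : ∀ t : ℝ, 0 ≤ t → ∀ᵐ x, ω t (φ t x) = ω₀ x
  homeomorph : ∀ t : ℝ, 0 ≤ t →
    ∃ e : ({z₀}ᶜ : Set Plane) ≃ₜ ({z t}ᶜ : Set Plane),
      ∀ x : ({z₀}ᶜ : Set Plane), (e x : Plane) = φ t x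
  measurePreserving : ∀ t : ℝ, 0 ≤ t →
    MeasurePreserving (φ t) (volume.restrict {z₀}ᶜ) (volume.restrict {z t}ᶜ)

/-- `γ` is, on `[0, T)`, a trajectory issued from `x` of the field `v + K(· - z(t))`, staying
away from the point vortex. -/
structure IsTrajectory (v : ℝ → Plane → Plane) (z : ℝ → Plane) (x : Plane) (T : ℝ)
    (γ : ℝ → Plane) : Prop where
  start : γ 0 = x
  avoid : ∀ t ∈ Ico 0 T, γ t ≠ z t
  hasDeriv : ∀ t ∈ Ico 0 T,
    HasDerivWithinAt γ (v t (γ t) + kernel (γ t - z t)) (Ico 0 T) t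

end VortexWave

namespace VortexWave

/-! ### The regularised Biot-Savart kernels -/

/-! Two facts carry the proof. The velocity K∗ω of a bounded integrable vorticity is log-Lipschitz,
and the singular field K(x − z) is orthogonal to x − z. In the frame of the vortex a trajectory
solves y' = U(t, y) + K(y) with U(t, 0) = 0, so d/dt |y|² sees only U and is at most C|y|²(1 + |log
|y||). Gronwall for log |y|² bounds |y| above and below: no trajectory reaches the vortex in finite
time (`osgood`, `VortexField.exists_norm_bounds`). On bounded times K may thus be replaced by a
Lipschitz cut-off, and the Osgood argument gives existence, uniqueness and continuity of the flow
(`RegField.exists_close`). The log-Lipschitz property is used in a quantitative form, `RegField`: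
smoothing K at scale e costs O(e) in the velocity and yields a Lipschitz constant O(1 + log(1/e)).

From Euler to Lagrange, the velocity is first made continuous in time. Testing the equation against
truncations of the smoothed kernel shows that each smoothed velocity is Lipschitz in time, uniformly
in x, on a set of full measure; it extends to all times, and so does the uniform limit
(`exists_good_set`, `exists_velocity`).

Next, weak solutions are transported by duality. If Ψ vanishes near the vortex, Ψ∘flow is constant
along trajectories and should be an admissible test function, but it is not smooth. Over a time τ
the flow at scale e has Lipschitz constant of order e^(−O(τ)), while the field differs from its
regularisation by O(e); for τ small the product tends to 0, so Ψ∘flow is approximated by smooth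
functions whose transport derivative is uniformly small (`exists_smooth_approx_of_lipschitz`). Hence
∫ ρ Ψ∘flow is constant on short windows, and windows are chained (`ae_integral_transport`). For ρ =
1, a weak solution because the field is divergence free, this says that the flow preserves area
(`measurePreserving_vortexFlow_left`); for ρ = ω it says that ω(t) is the transported datum for a.e.
t (`ae_eq_transported`). The transported datum is the required representative, and its velocity is
continuous for all t ≥ 0 (`biotSavart_transported`).

From Lagrange to Euler, the change of variables (t, x) ↦ (t, φ_t(x)) turns the weak formulation into
the integral of d/dt ψ(t, φ_t(x)) (`IsLagrangian.integral_transport`). -/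

theorem norm_sq_plane (x : Plane) : ‖x‖ ^ 2 = x 0 ^ 2 + x 1 ^ 2 := by
  rw [EuclideanSpace.norm_sq_eq, Fin.sum_univ_two, Real.norm_eq_abs, Real.norm_eq_abs, sq_abs,
    sq_abs]

theorem inner_plane (x y : Plane) : inner ℝ x y = x 0 * y 0 + x 1 * y 1 := by
  simp [PiLp.inner_apply, Fin.sum_univ_two, mul_comm]

@[simp] theorem perp_apply_zero (x : Plane) : perp x 0 = -x 1 := by simp [perp]

@[simp] theorem perp_apply_one (x : Plane) : perp x 1 = x 0 := by simp [perp]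

theorem plane_ext {x y : Plane} (h0 : x 0 = y 0) (h1 : x 1 = y 1) : x = y := by
  ext i; fin_cases i
  · exact h0
  · exact h1

@[simp] theorem norm_perp (x : Plane) : ‖perp x‖ = ‖x‖ := by
  rw [← sq_eq_sq₀ (norm_nonneg _) (norm_nonneg _), norm_sq_plane, norm_sq_plane]
  simp; ring

theorem perp_sub (x y : Plane) : perp (x - y) = perp x - perp y := by
  apply plane_ext <;> simp; ring

theorem perp_smul (a : ℝ) (x : Plane) : perp (a • x) = a • perp x := by
  apply plane_ext <;> simp

theorem inner_perp_self (x : Plane) : inner ℝ x (perp x) = 0 := by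
  rw [inner_plane]; simp; ring

theorem perp_zero : perp 0 = 0 := by
  apply plane_ext <;> simp

theorem contDiff_perp {n : WithTop ℕ∞} : ContDiff ℝ n perp := by
  refine contDiff_piLp _ |>.2 fun i => ?_
  fin_cases i
  · simp only [Fin.zero_eta, perp_apply_zero]; fun_prop
  · simp only [Fin.mk_one, perp_apply_one]; fun_prop

theorem continuous_perp : Continuous perp := (contDiff_perp (n := 0)).continuous

/-- The smoothed Biot-Savart kernel `x^⊥ / (2π (|x|² + e²))`. -/
noncomputable def kern (e : ℝ) (x : Plane) : Plane :=
  (1 / (2 * Real.pi * (‖x‖ ^ 2 + e ^ 2))) • perp x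

theorem kern_zero_left : kern 0 = kernel := by
  ext1 x; simp [kern, kernel]

theorem kern_apply_zero (e : ℝ) : kern e 0 = 0 := by simp [kern, perp_zero]

theorem contDiff_kern {e : ℝ} (he : e ≠ 0) {n : WithTop ℕ∞} : ContDiff ℝ n (kern e) := by
  unfold kern
  refine ContDiff.smul (ContDiff.div contDiff_const ?_ fun x => ?_) contDiff_perp
  · exact contDiff_const.mul ((contDiff_norm_sq ℝ).add contDiff_const)
  · have := Real.pi_pos
    positivity

theorem continuous_kern {e : ℝ} (he : e ≠ 0) : Continuous (kern e) :=
  (contDiff_kern he (n := 0)).continuous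

theorem measurable_kern (e : ℝ) : Measurable (kern e) := by
  unfold kern
  have : Measurable perp := continuous_perp.measurable
  fun_prop

theorem measurable_kernel : Measurable kernel := by
  rw [← kern_zero_left]; exact measurable_kern 0

theorem norm_kern (e : ℝ) (x : Plane) :
    ‖kern e x‖ = 1 / (2 * Real.pi) * (‖x‖ / (‖x‖ ^ 2 + e ^ 2)) := by
  have := Real.pi_pos
  rw [kern, norm_smul, norm_perp, Real.norm_eq_abs, abs_of_nonneg (by positivity)]
  by_cases h : ‖x‖ ^ 2 + e ^ 2 = 0
  · simp [h]
  · field_simp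

theorem norm_kern_le (e : ℝ) (x : Plane) : ‖kern e x‖ ≤ ‖x‖⁻¹ := by
  have hpi := Real.pi_gt_three
  rw [norm_kern]
  have h1 : 1 / (2 * Real.pi) ≤ 1 := by
    rw [div_le_one (by positivity)]; linarith
  have h2 : ‖x‖ / (‖x‖ ^ 2 + e ^ 2) ≤ ‖x‖⁻¹ := by
    rcases eq_or_lt_of_le (norm_nonneg x) with h | h
    · simp [← h]
    · rw [div_le_iff₀ (by positivity), inv_mul_eq_div, le_div_iff₀ h]
      nlinarith [sq_nonneg e]
  calc _ ≤ 1 * ‖x‖⁻¹ := by gcongr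
    _ = _ := one_mul _

theorem norm_kern_le_inv {e : ℝ} (he : 0 < e) (x : Plane) : ‖kern e x‖ ≤ e⁻¹ := by
  have hpi := Real.pi_gt_three
  rw [norm_kern]
  have h1 : 1 / (2 * Real.pi) ≤ 1 := by
    rw [div_le_one (by positivity)]; linarith
  have h2 : ‖x‖ / (‖x‖ ^ 2 + e ^ 2) ≤ e⁻¹ := by
    rw [div_le_iff₀ (by positivity), inv_mul_eq_div, le_div_iff₀ he]
    nlinarith [sq_nonneg (‖x‖ - e), sq_nonneg e, sq_nonneg ‖x‖]
  calc _ ≤ 1 * e⁻¹ := by gcongr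
    _ = _ := one_mul _

/-- The map x ↦ a x is a smoothed inversion, and |ax − by|² = ab|x − y|² − e²(a − b)² holds exactly;
the inequality between geometric and arithmetic means of a and b concludes. -/
theorem norm_smul_sub_smul_le {a b e : ℝ} (x y : Plane) (ha : 0 < a) (hb : 0 < b)
    (hxa : a * (‖x‖ ^ 2 + e ^ 2) = 1) (hyb : b * (‖y‖ ^ 2 + e ^ 2) = 1) :
    ‖a • x - b • y‖ ≤ (a + b) / 2 * ‖x - y‖ := by
  rw [← sq_le_sq₀ (norm_nonneg _) (by positivity), mul_pow]
  have h1 : ‖a • x - b • y‖ ^ 2 = a * b * ‖x - y‖ ^ 2 - e ^ 2 * (a - b) ^ 2 := by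
    rw [norm_sub_sq_real, norm_sub_sq_real, norm_smul, norm_smul, inner_smul_left,
      inner_smul_right, mul_pow, mul_pow, Real.norm_eq_abs, Real.norm_eq_abs, sq_abs, sq_abs]
    simp only [conj_trivial]
    have e1 : a * ‖x‖ ^ 2 = 1 - a * e ^ 2 := by linarith
    have e2 : b * ‖y‖ ^ 2 = 1 - b * e ^ 2 := by linarith
    linear_combination (a - b) * e1 + (b - a) * e2
  rw [h1]
  nlinarith [mul_nonneg (sq_nonneg e) (sq_nonneg (a - b)),
    mul_nonneg (sq_nonneg (a - b)) (sq_nonneg ‖x - y‖)]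

theorem norm_kern_sub_kern_le {e : ℝ} {x y : Plane} (hx : 0 < ‖x‖ ^ 2 + e ^ 2)
    (hy : 0 < ‖y‖ ^ 2 + e ^ 2) :
    ‖kern e x - kern e y‖ ≤
      ((‖x‖ ^ 2 + e ^ 2)⁻¹ + (‖y‖ ^ 2 + e ^ 2)⁻¹) * ‖x - y‖ := by
  have hpi := Real.pi_gt_three
  have h : kern e x - kern e y = (1 / (2 * Real.pi)) •
      perp ((‖x‖ ^ 2 + e ^ 2)⁻¹ • x - (‖y‖ ^ 2 + e ^ 2)⁻¹ • y) := by
    rw [perp_sub, perp_smul, perp_smul, smul_sub, smul_smul, smul_smul, kern, kern]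
    congr 2 <;> field_simp
  rw [h, norm_smul, norm_perp, Real.norm_eq_abs, abs_of_nonneg (by positivity)]
  have h1 : 1 / (2 * Real.pi) ≤ 1 := by
    rw [div_le_one (by positivity)]; linarith
  have h2 := norm_smul_sub_smul_le x y (inv_pos.2 hx) (inv_pos.2 hy)
    (inv_mul_cancel₀ hx.ne') (inv_mul_cancel₀ hy.ne')
  have h3 : (0 : ℝ) ≤ ((‖x‖ ^ 2 + e ^ 2)⁻¹ + (‖y‖ ^ 2 + e ^ 2)⁻¹) * ‖x - y‖ := by positivity
  calc _ ≤ 1 * (((‖x‖ ^ 2 + e ^ 2)⁻¹ + (‖y‖ ^ 2 + e ^ 2)⁻¹) / 2 * ‖x - y‖) := by gcongr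
    _ ≤ _ := by linarith

/-- The remainder has the integrable singularity 1/|x| at the origin and decays like |x|⁻³ at
infinity, so it is integrable over the whole plane. -/
theorem norm_kern_zero_sub_kern_le (e : ℝ) (x : Plane) :
    ‖kern 0 x - kern e x‖ ≤ e ^ 2 / (‖x‖ * (‖x‖ ^ 2 + e ^ 2)) := by
  have hpi := Real.pi_gt_three
  by_cases hx0 : x = 0
  · simp [hx0, kern_apply_zero]
  have hx : 0 < ‖x‖ := norm_pos_iff.2 hx0
  have h : kern 0 x - kern e x =
      (1 / (2 * Real.pi) * (e ^ 2 / (‖x‖ ^ 2 * (‖x‖ ^ 2 + e ^ 2)))) • perp x := by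
    rw [kern, kern, ← sub_smul]
    congr 1
    field_simp
    ring
  rw [h, norm_smul, norm_perp, Real.norm_eq_abs, abs_of_nonneg (by positivity)]
  have h1 : 1 / (2 * Real.pi) ≤ 1 := by
    rw [div_le_one (by positivity)]; linarith
  calc _ ≤ 1 * (e ^ 2 / (‖x‖ ^ 2 * (‖x‖ ^ 2 + e ^ 2))) * ‖x‖ := by gcongr
    _ = _ := by field_simp

/-! ### Radial integrals -/

theorem integrable_radial_iff {f : ℝ → ℝ} :
    Integrable (fun x : Plane => f ‖x‖) ↔ IntegrableOn (fun r => r * f r) (Ioi 0) := by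
  rw [integrable_fun_norm_addHaar volume (f := f)]
  simp

theorem integral_radial (f : ℝ → ℝ) :
    ∫ x : Plane, f ‖x‖ =
      2 * volume.real (Metric.ball (0 : Plane) 1) * ∫ r in Ioi (0 : ℝ), r * f r := by
  rw [integral_fun_norm_addHaar volume f]
  simp [mul_assoc]

theorem integrable_ball_inv :
    Integrable (fun x : Plane => (Iio (1 : ℝ)).indicator (fun r => r⁻¹) ‖x‖) := by
  rw [integrable_radial_iff (f := (Iio (1 : ℝ)).indicator (fun r => r⁻¹))]
  have h : IntegrableOn ((Ioo (0 : ℝ) 1).indicator fun _ => (1 : ℝ)) (Ioi 0) := by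
    refine Integrable.integrableOn ?_
    rw [integrable_indicator_iff measurableSet_Ioo]
    exact integrableOn_const (by simp)
  refine h.congr_fun (fun r hr => ?_) measurableSet_Ioi
  have hr' : (0 : ℝ) < r := hr
  by_cases h1 : r < 1 <;> simp [indicator, h1, hr', hr'.ne']

theorem integrable_kern_tail :
    Integrable (fun x : Plane => 1 / (‖x‖ * (‖x‖ ^ 2 + 1))) := by
  rw [integrable_radial_iff (f := fun r => 1 / (r * (r ^ 2 + 1)))]
  refine (integrable_inv_one_add_sq.integrableOn (s := Ioi 0)).congr_fun
    (fun r hr => ?_) measurableSet_Ioi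
  have hr' : (0 : ℝ) < r := hr
  show (1 + r ^ 2)⁻¹ = r * (1 / (r * (r ^ 2 + 1)))
  field_simp
  ring

theorem kern_tail_scale {e : ℝ} (he : 0 < e) (x : Plane) :
    e ^ 2 / (‖x‖ * (‖x‖ ^ 2 + e ^ 2)) =
      e⁻¹ * (1 / (‖e⁻¹ • x‖ * (‖e⁻¹ • x‖ ^ 2 + 1))) := by
  rw [norm_smul, Real.norm_eq_abs, abs_of_pos (inv_pos.2 he)]
  by_cases h : ‖x‖ = 0
  · simp [h]
  · field_simp

theorem integrable_kern_tail' {e : ℝ} (he : 0 < e) :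
    Integrable (fun x : Plane => e ^ 2 / (‖x‖ * (‖x‖ ^ 2 + e ^ 2))) := by
  simp_rw [kern_tail_scale he]
  exact (integrable_kern_tail.comp_smul (inv_ne_zero he.ne')).const_mul _

/-- Under x = e y the integrand contributes e⁻¹ and the area element e², which makes the smoothing
error linear in e. -/
theorem integral_kern_tail {e : ℝ} (he : 0 < e) :
    ∫ x : Plane, e ^ 2 / (‖x‖ * (‖x‖ ^ 2 + e ^ 2)) =
      e * ∫ x : Plane, 1 / (‖x‖ * (‖x‖ ^ 2 + 1)) := by
  simp_rw [kern_tail_scale he]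
  rw [integral_const_mul, Measure.integral_comp_smul volume
    (fun x : Plane => 1 / (‖x‖ * (‖x‖ ^ 2 + 1)))]
  rw [smul_eq_mul, ← mul_assoc]
  congr 1
  simp only [finrank_euclideanSpace, Fintype.card_fin]
  rw [abs_of_pos (by positivity)]
  field_simp

/-- In polar coordinates the integrand becomes r/(r² + e²), with primitive log(r² + e²)/2. This is
the source of every logarithm below. -/
theorem integrableOn_log_weight {e : ℝ} (he : 0 < e) :
    Integrable (fun x : Plane => (Iio (1 : ℝ)).indicator (fun r => (r ^ 2 + e ^ 2)⁻¹) ‖x‖) ∧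
    ∫ x : Plane, (Iio (1 : ℝ)).indicator (fun r => (r ^ 2 + e ^ 2)⁻¹) ‖x‖ =
      volume.real (Metric.ball (0 : Plane) 1) * Real.log ((1 + e ^ 2) / e ^ 2) := by
  have hcont : ContinuousOn (fun r : ℝ => r * (r ^ 2 + e ^ 2)⁻¹) (uIcc 0 1) := by
    refine Continuous.continuousOn ?_
    refine continuous_id.mul (Continuous.inv₀ (by fun_prop) fun r => by positivity)
  have hfun : (fun r => r * (Iio (1 : ℝ)).indicator (fun r => (r ^ 2 + e ^ 2)⁻¹) r) =
      (Iio (1 : ℝ)).indicator (fun r => r * (r ^ 2 + e ^ 2)⁻¹) := by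
    ext r; by_cases h : r < 1 <;> simp [indicator, h]
  have hset : Iio (1 : ℝ) ∩ Ioi 0 = Ioo 0 1 := by ext; simp [and_comm]
  constructor
  · rw [integrable_radial_iff (f := (Iio (1 : ℝ)).indicator (fun r => (r ^ 2 + e ^ 2)⁻¹)), hfun,
      IntegrableOn, integrable_indicator_iff measurableSet_Iio, IntegrableOn,
      Measure.restrict_restrict measurableSet_Iio, hset]
    exact (hcont.intervalIntegrable.1).mono_set Ioo_subset_Ioc_self
  · rw [integral_radial, hfun, setIntegral_indicator measurableSet_Iio, inter_comm, hset,
      ← integral_Ioc_eq_integral_Ioo, ← intervalIntegral.integral_of_le zero_le_one]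
    have hd : ∀ r ∈ uIcc (0 : ℝ) 1,
        HasDerivAt (fun r : ℝ => Real.log (r ^ 2 + e ^ 2) / 2) (r * (r ^ 2 + e ^ 2)⁻¹) r := by
      intro r _
      have h0 : r ^ 2 + e ^ 2 ≠ 0 := by positivity
      refine ((((hasDerivAt_pow 2 r).add_const (e ^ 2)).log h0).div_const 2).congr_deriv ?_
      field_simp
      simp [mul_comm]
    rw [intervalIntegral.integral_eq_sub_of_hasDerivAt hd hcont.intervalIntegrable,
      Real.log_div (by positivity) (by positivity)]
    simp
    ring

/-! ### Convolution with a bounded integrable function -/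

/-- `f` is bounded by `C` everywhere and integrable with `∫ |f| ≤ C`. -/
structure BoundedL1 (C : ℝ) (f : Plane → ℝ) : Prop where
  integrable : Integrable f
  abs_le : ∀ x, |f x| ≤ C
  integral_le : ∫ x, |f x| ≤ C

theorem BoundedL1.nonneg {C : ℝ} {f : Plane → ℝ} (h : BoundedL1 C f) : 0 ≤ C :=
  (abs_nonneg _).trans (h.abs_le 0)

/-- The integrable part `w₁` of the weight is paired with the sup bound of `f`, the bounded part `B`
with its L¹ bound. -/
theorem BoundedL1.integrable_mul_comp_sub {C B : ℝ} {f w w₁ : Plane → ℝ} (h : BoundedL1 C f)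
    (hw : Measurable w) (hw0 : ∀ x, 0 ≤ w x) (hw₁ : Integrable w₁)
    (hle : ∀ x, w x ≤ w₁ x + B) (x : Plane) :
    Integrable (fun y => |f y| * w (x - y)) ∧
      ∫ y, |f y| * w (x - y) ≤ C * (∫ y, |w₁ y|) + C * |B| := by
  have hC := h.nonneg
  have hw₁' : Integrable (fun y => |w₁ (x - y)|) := (hw₁.comp_sub_left x).abs
  have hdom : Integrable (fun y => C * |w₁ (x - y)| + |f y| * |B|) :=
    (hw₁'.const_mul C).add (h.integrable.abs.mul_const _)
  have hpt : ∀ y, |f y| * w (x - y) ≤ C * |w₁ (x - y)| + |f y| * |B| := by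
    intro y
    calc |f y| * w (x - y) ≤ |f y| * (|w₁ (x - y)| + |B|) := by
          have := hle (x - y)
          have h1 := le_abs_self (w₁ (x - y))
          have h2 := le_abs_self B
          gcongr
          linarith
      _ = |f y| * |w₁ (x - y)| + |f y| * |B| := mul_add _ _ _
      _ ≤ _ := by gcongr; exact h.abs_le y
  have hint : Integrable (fun y => |f y| * w (x - y)) := by
    refine hdom.mono' (h.integrable.abs.aestronglyMeasurable.mul
      (hw.comp (measurable_const.sub measurable_id)).aestronglyMeasurable) (.of_forall fun y => ?_)
    rw [Real.norm_eq_abs, abs_of_nonneg (mul_nonneg (abs_nonneg _) (hw0 _))]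
    exact hpt y
  refine ⟨hint, (integral_mono hint hdom hpt).trans ?_⟩
  rw [integral_add (hw₁'.const_mul C) (h.integrable.abs.mul_const _), integral_const_mul,
    integral_mul_const, integral_sub_left_eq_self (fun y => |w₁ y|) volume x]
  have := h.integral_le
  gcongr

/-- The velocity induced through the smoothed kernel. -/
noncomputable def smoothVelocity (e : ℝ) (f : Plane → ℝ) (x : Plane) : Plane :=
  ∫ y, f y • kern e (x - y)

theorem smoothVelocity_zero (f : Plane → ℝ) : smoothVelocity 0 f = biotSavart f := by
  ext1 x; simp only [smoothVelocity, biotSavart, kern_zero_left]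

/-- A constant controlling every singular integral below. -/
noncomputable def kernConst : ℝ :=
  (∫ x : Plane, |(Iio (1 : ℝ)).indicator (fun r => r⁻¹) ‖x‖|) +
    |∫ x : Plane, 1 / (‖x‖ * (‖x‖ ^ 2 + 1))| + 4 * volume.real (Metric.ball (0 : Plane) 1) + 2

theorem inv_le_indicator_add_one {r : ℝ} : r⁻¹ ≤ (Iio (1 : ℝ)).indicator (fun r => r⁻¹) r + 1 := by
  by_cases h : r < 1
  · simp [indicator, h]
  · simp only [indicator, mem_Iio, h, if_false, zero_add]
    exact inv_le_one_of_one_le₀ (not_lt.1 h)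

theorem BoundedL1.integrable_inv {C : ℝ} {f : Plane → ℝ} (h : BoundedL1 C f) (x : Plane) :
    Integrable (fun y => |f y| * ‖x - y‖⁻¹) ∧ ∫ y, |f y| * ‖x - y‖⁻¹ ≤ C * kernConst := by
  have h0 := h.nonneg
  obtain ⟨h1, h2⟩ := h.integrable_mul_comp_sub (w := fun x => ‖x‖⁻¹) (B := 1) (by fun_prop)
    (fun x => by positivity) integrable_ball_inv (fun x => inv_le_indicator_add_one) x
  refine ⟨h1, h2.trans ?_⟩
  rw [← mul_add]
  have : 0 ≤ volume.real (Metric.ball (0 : Plane) 1) := measureReal_nonneg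
  have h3 := abs_nonneg (∫ x : Plane, 1 / (‖x‖ * (‖x‖ ^ 2 + 1)))
  gcongr
  rw [kernConst, abs_one]
  linarith

theorem BoundedL1.integrable_kern {C : ℝ} {f : Plane → ℝ} (h : BoundedL1 C f) (e : ℝ)
    (x : Plane) : Integrable (fun y => f y • kern e (x - y)) := by
  refine (h.integrable_inv x).1.mono' (h.integrable.aestronglyMeasurable.smul
    ((measurable_kern e).comp (measurable_const.sub measurable_id)).aestronglyMeasurable)
    (.of_forall fun y => ?_)
  rw [norm_smul, Real.norm_eq_abs]
  have := norm_kern_le e (x - y)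
  gcongr

theorem BoundedL1.norm_smoothVelocity_le {C : ℝ} {f : Plane → ℝ} (h : BoundedL1 C f) (e : ℝ)
    (x : Plane) : ‖smoothVelocity e f x‖ ≤ C * kernConst := by
  refine (norm_integral_le_of_norm_le (h.integrable_inv x).1 (.of_forall fun y => ?_)).trans
    (h.integrable_inv x).2
  rw [norm_smul, Real.norm_eq_abs]
  have := norm_kern_le e (x - y)
  gcongr

theorem BoundedL1.norm_smoothVelocity_sub_le {C : ℝ} {f : Plane → ℝ} (h : BoundedL1 C f) {e : ℝ}
    (he : 0 < e) (x : Plane) :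
    ‖smoothVelocity e f x - smoothVelocity 0 f x‖ ≤ C * kernConst * e := by
  have h0 := h.nonneg
  obtain ⟨h1, h2⟩ := h.integrable_mul_comp_sub (w := fun x => e ^ 2 / (‖x‖ * (‖x‖ ^ 2 + e ^ 2)))
    (B := 0) (by fun_prop) (fun x => by positivity) (integrable_kern_tail' he)
    (fun x => by simp) x
  rw [norm_sub_rev, smoothVelocity, smoothVelocity,
    ← integral_sub (h.integrable_kern 0 x) (h.integrable_kern e x)]
  refine (norm_integral_le_of_norm_le h1 (.of_forall fun y => ?_)).trans (h2.trans ?_)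
  · rw [← smul_sub, norm_smul, Real.norm_eq_abs]
    have := norm_kern_zero_sub_kern_le e (x - y)
    gcongr
  · have h5 : ∫ x : Plane, |e ^ 2 / (‖x‖ * (‖x‖ ^ 2 + e ^ 2))| =
        e * ∫ x : Plane, 1 / (‖x‖ * (‖x‖ ^ 2 + 1)) := by
      rw [← integral_kern_tail he]
      congr 1; ext x
      exact abs_of_nonneg (by positivity)
    rw [h5, abs_zero, mul_zero, add_zero, mul_assoc, mul_comm kernConst]
    have h3 := le_abs_self (∫ x : Plane, 1 / (‖x‖ * (‖x‖ ^ 2 + 1)))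
    have h4 : 0 ≤ ∫ x : Plane, |(Iio (1 : ℝ)).indicator (fun r => r⁻¹) ‖x‖| :=
      integral_nonneg fun x => abs_nonneg _
    have : 0 ≤ volume.real (Metric.ball (0 : Plane) 1) := measureReal_nonneg
    gcongr
    rw [kernConst]
    linarith

/-- The difference of two kernels is at most |x − x'| times the weights 1/(r² + e²) at the two
points. Against `f`, such a weight costs a logarithm near its centre and at most the L¹ norm away
from it. -/
theorem BoundedL1.lipschitz_smoothVelocity {C : ℝ} {f : Plane → ℝ} (h : BoundedL1 C f) {e : ℝ}
    (he : 0 < e) (he1 : e ≤ 1) (x x' : Plane) :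
    ‖smoothVelocity e f x - smoothVelocity e f x'‖ ≤
      2 * C * kernConst * (1 + Real.log (1 / e)) * ‖x - x'‖ := by
  have h0 := h.nonneg
  have key : ∀ x, Integrable (fun y => |f y| * (‖x - y‖ ^ 2 + e ^ 2)⁻¹) ∧
      ∫ y, |f y| * (‖x - y‖ ^ 2 + e ^ 2)⁻¹ ≤ C * (kernConst * (1 + Real.log (1 / e))) := by
    intro x
    obtain ⟨hi, hv⟩ := integrableOn_log_weight he
    have hle : ∀ x : Plane, (‖x‖ ^ 2 + e ^ 2)⁻¹ ≤
        (Iio (1 : ℝ)).indicator (fun r => (r ^ 2 + e ^ 2)⁻¹) ‖x‖ + 1 := by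
      intro x
      by_cases hx : ‖x‖ < 1
      · simp [indicator, hx]
      · simp only [indicator, mem_Iio, hx, if_false, zero_add]
        apply inv_le_one_of_one_le₀
        nlinarith [not_lt.1 hx, sq_nonneg e]
    obtain ⟨h1, h2⟩ := h.integrable_mul_comp_sub (w := fun x => (‖x‖ ^ 2 + e ^ 2)⁻¹)
      (B := 1) (by fun_prop) (fun x => by positivity) hi hle x
    · refine ⟨h1, h2.trans ?_⟩
      have h5 : ∫ x : Plane, |(Iio (1 : ℝ)).indicator (fun r => (r ^ 2 + e ^ 2)⁻¹) ‖x‖| =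
          volume.real (Metric.ball (0 : Plane) 1) * Real.log ((1 + e ^ 2) / e ^ 2) := by
        rw [← hv]
        congr 1; ext x
        exact abs_of_nonneg (indicator_nonneg (fun r _ => by positivity) _)
      rw [h5, ← mul_add, abs_one]
      -- Splitting off log(1 + e²) ≤ e² ≤ 1 leaves log(e⁻²) = 2 log(1/e).
      have hlog : Real.log ((1 + e ^ 2) / e ^ 2) ≤ 1 + 2 * Real.log (1 / e) := by
        rw [Real.log_div (by positivity) (by positivity), Real.log_pow, one_div, Real.log_inv]
        have : Real.log (1 + e ^ 2) ≤ 1 := by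
          have := Real.log_le_sub_one_of_pos (show 0 < 1 + e ^ 2 by positivity)
          nlinarith
        push_cast
        linarith
      have hl0 : 0 ≤ Real.log (1 / e) := Real.log_nonneg (by rw [le_div_iff₀ he]; linarith)
      have h3 := abs_nonneg (∫ x : Plane, 1 / (‖x‖ * (‖x‖ ^ 2 + 1)))
      have h4 : 0 ≤ ∫ x : Plane, |(Iio (1 : ℝ)).indicator (fun r => r⁻¹) ‖x‖| :=
        integral_nonneg fun x => abs_nonneg _
      have hv0 : 0 ≤ volume.real (Metric.ball (0 : Plane) 1) := measureReal_nonneg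
      gcongr
      have hk : 2 * volume.real (Metric.ball (0 : Plane) 1) + 1 ≤ kernConst := by
        rw [kernConst]; linarith
      have hk' := mul_le_mul_of_nonneg_right hk (show 0 ≤ 1 + Real.log (1 / e) by linarith)
      have hm := mul_le_mul_of_nonneg_left hlog hv0
      nlinarith [mul_nonneg hv0 hl0]
  rw [smoothVelocity, smoothVelocity,
    ← integral_sub (h.integrable_kern e x) (h.integrable_kern e x')]
  have hint := ((key x).1.add (key x').1).mul_const ‖x - x'‖
  refine (norm_integral_le_of_norm_le hint (.of_forall fun y => ?_)).trans ?_
  · rw [← smul_sub, norm_smul, Real.norm_eq_abs]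
    have := norm_kern_sub_kern_le (e := e) (x := x - y) (y := x' - y) (by positivity)
      (by positivity)
    rw [sub_sub_sub_cancel_right] at this
    refine (mul_le_mul_of_nonneg_left this (abs_nonneg _)).trans (le_of_eq ?_)
    simp only [Pi.add_apply]; ring
  · rw [integral_mul_const]
    simp only [Pi.add_apply]
    rw [integral_add (key x).1 (key x').1]
    gcongr
    linarith [(key x).2, (key x').2]

end VortexWave


namespace VortexWave

/-! ### An Osgood-type estimate -/

/-- Only points below 1 need care: there the function is x(1 − log x), and log u ≤ u − 1 is applied
to u = 1/x or u = q/x. -/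
theorem mul_one_add_abs_log_mono {x q : ℝ} (hx : 0 ≤ x) (hxq : x ≤ q) :
    x * (1 + |Real.log x|) ≤ q * (1 + |Real.log q|) := by
  rcases hx.eq_or_lt with rfl | hx0
  · simp only [zero_mul]; positivity
  have hq0 : 0 < q := hx0.trans_le hxq
  rcases le_or_gt 1 x with h1 | h1
  · have hl : Real.log x ≤ Real.log q := Real.log_le_log hx0 hxq
    have hl0 : 0 ≤ Real.log x := Real.log_nonneg h1
    rw [abs_of_nonneg hl0, abs_of_nonneg (hl0.trans hl)]
    gcongr
  · rw [abs_of_neg (Real.log_neg hx0 h1)]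
    rcases le_or_gt 1 q with h2 | h2
    · have h3 : Real.log x⁻¹ ≤ x⁻¹ - 1 := Real.log_le_sub_one_of_pos (by positivity)
      rw [Real.log_inv] at h3
      have h4 : x * -Real.log x ≤ x * (x⁻¹ - 1) := by gcongr
      rw [mul_sub, mul_inv_cancel₀ hx0.ne'] at h4
      nlinarith [abs_nonneg (Real.log q)]
    · rw [abs_of_neg (Real.log_neg hq0 h2)]
      have h3 : Real.log (q / x) ≤ q / x - 1 := Real.log_le_sub_one_of_pos (by positivity)
      rw [Real.log_div hq0.ne' hx0.ne'] at h3
      have h4 : x * (Real.log q - Real.log x) ≤ x * (q / x - 1) := by gcongr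
      have h5 : x * (q / x - 1) = q - x := by field_simp
      have h6 := Real.log_neg hq0 h2
      nlinarith

theorem one_add_abs_le_of_deriv {h h' : ℝ → ℝ} {a b K : ℝ} (hab : a ≤ b) (hK : 0 ≤ K)
    (hh : ∀ t ∈ Icc a b, HasDerivWithinAt h (h' t) (Icc a b) t)
    (hb : ∀ t ∈ Icc a b, |h' t| ≤ K * (1 + |h t|)) :
    1 + |h b| ≤ (1 + |h a|) * Real.exp (K * (b - a)) := by
  have := norm_le_gronwallBound_of_norm_deriv_right_le (f := h) (f' := h') (δ := |h a|) (K := K)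
    (ε := K) (a := a) (b := b) (fun t ht => (hh t ht).continuousWithinAt)
    (fun t ht => (hh t ⟨ht.1, ht.2.le⟩).mono_of_mem_nhdsWithin (Icc_mem_nhdsGE_of_mem ht)) le_rfl
    (fun t ht => by
      have := hb t ⟨ht.1, ht.2.le⟩
      rw [Real.norm_eq_abs, Real.norm_eq_abs]; linarith) b (right_mem_Icc.2 hab)
  rw [Real.norm_eq_abs] at this
  -- The Gronwall bound is defined by cases, with a separate formula for K = 0.
  rcases hK.eq_or_lt with rfl | hK0
  · rw [gronwallBound_K0] at this
    simpa using this
  · rw [gronwallBound_of_K_ne_0 hK0.ne', div_self hK0.ne'] at this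
    linarith

/-- For s > t this is the forward estimate; for s ≤ t time is reflected by r ↦ s + t − r. Working in
both directions is what gives lower bounds on norms and propagation from an intermediate time. -/
theorem one_add_abs_le_of_deriv' {h h' : ℝ → ℝ} {a b K : ℝ} (hK : 0 ≤ K)
    (hh : ∀ t ∈ Icc a b, HasDerivWithinAt h (h' t) (Icc a b) t)
    (hb : ∀ t ∈ Icc a b, |h' t| ≤ K * (1 + |h t|)) {s t : ℝ} (hs : s ∈ Icc a b)
    (ht : t ∈ Icc a b) :
    1 + |h s| ≤ (1 + |h t|) * Real.exp (K * |t - s|) := by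
  rcases le_total t s with hts | hts
  · have hsub : Icc t s ⊆ Icc a b := Icc_subset_Icc ht.1 hs.2
    have := one_add_abs_le_of_deriv hts hK (fun r hr => (hh r (hsub hr)).mono hsub)
      (fun r hr => hb r (hsub hr))
    rwa [abs_of_nonpos (show t - s ≤ 0 by linarith), neg_sub]
  · have hsub : Icc s t ⊆ Icc a b := Icc_subset_Icc hs.1 ht.2
    have hmaps : MapsTo (fun r => s + t - r) (Icc s t) (Icc s t) := by
      intro r hr; constructor <;> linarith [hr.1, hr.2]
    have := one_add_abs_le_of_deriv (h := fun r => h (s + t - r)) (h' := fun r => -h' (s + t - r))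
      hts hK (fun r hr => ?_) (fun r hr => ?_)
    · simpa [abs_of_nonneg (sub_nonneg.2 hts)] using this
    · have h1 := ((hh _ (hsub (hmaps hr))).mono hsub)
      have h2 : HasDerivWithinAt (fun r => s + t - r) (-1) (Icc s t) r := by
        simpa using (hasDerivWithinAt_id r (Icc s t)).const_sub (s + t)
      exact (h1.scomp r h2 hmaps).congr_deriv (by simp)
    · rw [abs_neg]; exact hb _ (hsub (hmaps hr))

/-- Osgood's lemma through Gronwall: h = log(|f|² + η²) satisfies |h'| ≤ 3B(1 + |h|). The parameter
η keeps h finite where f vanishes and absorbs an additive error of size η. Only the inner product of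
f and f' is constrained, so that a component of the field orthogonal to f plays no role. -/
theorem osgood {f f' : ℝ → Plane} {a b B η : ℝ} (hB : 0 ≤ B) (hη : 0 < η)
    (hf : ∀ t ∈ Icc a b, HasDerivWithinAt f (f' t) (Icc a b) t)
    (hb : ∀ t ∈ Icc a b, |inner ℝ (f t) (f' t)| ≤
      B * (‖f t‖ * (‖f t‖ * (1 + |Real.log ‖f t‖|)) + η * ‖f t‖)) {s t : ℝ}
    (hs : s ∈ Icc a b) (ht : t ∈ Icc a b) :
    1 + |Real.log (‖f s‖ ^ 2 + η ^ 2)| ≤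
      (1 + |Real.log (‖f t‖ ^ 2 + η ^ 2)|) * Real.exp (3 * B * |t - s|) := by
  have hq : ∀ t, 0 < ‖f t‖ ^ 2 + η ^ 2 := fun t => by positivity
  refine one_add_abs_le_of_deriv' (h := fun t => Real.log (‖f t‖ ^ 2 + η ^ 2))
    (h' := fun t => 2 * inner ℝ (f t) (f' t) / (‖f t‖ ^ 2 + η ^ 2)) (by positivity)
    (fun t ht => ((hf t ht).norm_sq.add_const _).log (hq t).ne') (fun t ht => ?_) hs ht
  rw [abs_div, abs_of_pos (hq t), div_le_iff₀ (hq t), abs_mul, abs_two]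
  have h1 := hb t ht
  set r := ‖f t‖
  have hr : 0 ≤ r := norm_nonneg _
  have h2 : r * (r * (1 + |Real.log r|)) ≤ r ^ 2 * (1 + |Real.log (r ^ 2)|) := by
    rw [Real.log_pow, abs_mul, ← mul_assoc, ← sq]
    have : |((2 : ℕ) : ℝ)| = 2 := by norm_num
    rw [this]
    gcongr
    linarith [abs_nonneg (Real.log r)]
  have h3 : r ^ 2 * (1 + |Real.log (r ^ 2)|) ≤
      (r ^ 2 + η ^ 2) * (1 + |Real.log (r ^ 2 + η ^ 2)|) :=
    mul_one_add_abs_log_mono (by positivity) (by nlinarith)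
  -- From 2ηr ≤ r² + η²; this half and the full term above add up to the factor 3.
  have h4 : η * r ≤ (r ^ 2 + η ^ 2) * (1 + |Real.log (r ^ 2 + η ^ 2)|) / 2 := by
    have := mul_nonneg (hq t).le (abs_nonneg (Real.log (r ^ 2 + η ^ 2)))
    nlinarith [sq_nonneg (r - η)]
  calc 2 * |inner ℝ (f t) (f' t)| ≤ 2 * (B * ((r ^ 2 + η ^ 2) * (1 + |Real.log (r ^ 2 + η ^ 2)|) +
        (r ^ 2 + η ^ 2) * (1 + |Real.log (r ^ 2 + η ^ 2)|) / 2)) := by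
        refine mul_le_mul_of_nonneg_left (h1.trans ?_) zero_le_two
        exact mul_le_mul_of_nonneg_left (add_le_add (h2.trans h3) h4) hB
    _ = _ := by ring

theorem abs_log_le_of_mem_Icc {x l u : ℝ} (hl : 0 < l) (h1 : l ≤ x) (h2 : x ≤ u) :
    |Real.log x| ≤ |Real.log l| + |Real.log u| := by
  have h3 := Real.log_le_log hl h1
  have h4 := Real.log_le_log (hl.trans_le h1) h2
  rw [abs_le]
  constructor
  · linarith [neg_abs_le (Real.log l), abs_nonneg (Real.log u)]
  · linarith [le_abs_self (Real.log u), abs_nonneg (Real.log l)]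

/-- If |f| exceeds θ at one time, then log(|f|² + κ²) is bounded there, hence by `osgood` bounded at
time s by a quantity `R` that does not depend on κ. This is impossible once |f(s)| ≤ κ and κ is
small compared with exp(−R). -/
theorem exists_osgood_small (B T Q θ : ℝ) (hB : 0 ≤ B) (hθ : 0 < θ) :
    ∃ κ : ℝ, 0 < κ ∧ κ ≤ 1 ∧ ∀ (f f' : ℝ → Plane) (a b : ℝ), b - a ≤ T →
      (∀ t ∈ Icc a b, HasDerivWithinAt f (f' t) (Icc a b) t) →
      (∀ t ∈ Icc a b, |inner ℝ (f t) (f' t)| ≤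
        B * (‖f t‖ * (‖f t‖ * (1 + |Real.log ‖f t‖|)) + κ * ‖f t‖)) →
      (∀ t ∈ Icc a b, ‖f t‖ ≤ Q) →
      ∀ s ∈ Icc a b, ‖f s‖ ≤ κ → ∀ t ∈ Icc a b, ‖f t‖ ≤ θ := by
  set R := (1 + (|Real.log (θ ^ 2)| + |Real.log (Q ^ 2 + 1)|)) * Real.exp (3 * B * T) with hR
  refine ⟨min 1 (Real.exp (-R) / 2), by positivity, min_le_left _ _, ?_⟩
  set κ := min 1 (Real.exp (-R) / 2)
  have hκ0 : 0 < κ := by positivity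
  have hκ1 : κ ≤ 1 := min_le_left _ _
  have hκ2 : κ ≤ Real.exp (-R) / 2 := min_le_right _ _
  intro f f' a b hab hf hb hQ s hs hfs t ht
  by_contra! hcon
  have h1 := osgood hB hκ0 hf hb hs ht
  have h2 : |Real.log (‖f t‖ ^ 2 + κ ^ 2)| ≤ |Real.log (θ ^ 2)| + |Real.log (Q ^ 2 + 1)| := by
    refine abs_log_le_of_mem_Icc (by positivity) (by nlinarith) ?_
    have := hQ t ht
    have h0 := norm_nonneg (f t)
    nlinarith
  have h3 : 1 + |Real.log (‖f s‖ ^ 2 + κ ^ 2)| ≤ R := by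
    refine h1.trans ?_
    have : |t - s| ≤ T := by
      rw [abs_le]; constructor <;> linarith [hs.1, hs.2, ht.1, ht.2]
    rw [hR]
    gcongr
  have h4 : Real.exp (-R) < ‖f s‖ ^ 2 + κ ^ 2 := by
    rw [← Real.lt_log_iff_exp_lt (by positivity)]
    linarith [neg_abs_le (Real.log (‖f s‖ ^ 2 + κ ^ 2))]
  -- Contradiction with |f(s)|² + κ² ≤ 2κ² ≤ 2κ ≤ exp(−R).
  nlinarith [norm_nonneg (f s)]

/-! ### Fields with a Lipschitz regularisation -/

/-- A bounded continuous field `c 0` approximated at rate `A e` by fields `c e` whose Lipschitz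
constant grows like `A (1 + log (1/e))`. -/
structure RegField (A : ℝ) (c : ℝ → ℝ → Plane → Plane) : Prop where
  cont : ∀ e ∈ Icc (0 : ℝ) 1, Continuous (Function.uncurry (c e))
  bdd : ∀ e ∈ Icc (0 : ℝ) 1, ∀ t y, ‖c e t y‖ ≤ A
  approx : ∀ e ∈ Ioc (0 : ℝ) 1, ∀ t y, ‖c e t y - c 0 t y‖ ≤ A * e
  lip : ∀ e ∈ Ioc (0 : ℝ) 1, ∀ t x y,
    ‖c e t x - c e t y‖ ≤ A * (1 + Real.log (1 / e)) * ‖x - y‖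

namespace RegField

variable {A : ℝ} {c : ℝ → ℝ → Plane → Plane}

theorem nonneg (h : RegField A c) : 0 ≤ A :=
  (norm_nonneg _).trans (h.bdd 0 (by simp) 0 0)

theorem approx' (h : RegField A c) {e : ℝ} (he : e ∈ Icc (0 : ℝ) 1) (t : ℝ) (y : Plane) :
    ‖c e t y - c 0 t y‖ ≤ A * e := by
  rcases he.1.eq_or_lt with rfl | h0
  · simp
  · exact h.approx e ⟨h0, he.2⟩ t y

/-- For |x − y| = r < 1 the regularisation is taken at scale r: replacing the field costs O(r) and
the Lipschitz bound costs r(1 + log(1/r)). If r ≤ e, the field is already smooth enough at scale r.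
-/
theorem logLip (h : RegField A c) {e : ℝ} (he : e ∈ Icc (0 : ℝ) 1) (t : ℝ) (x y : Plane) :
    ‖c e t x - c e t y‖ ≤ 5 * A * (‖x - y‖ * (1 + |Real.log ‖x - y‖|)) := by
  have hA := h.nonneg
  set r := ‖x - y‖
  have hr : 0 ≤ r := norm_nonneg _
  have hl := abs_nonneg (Real.log r)
  rcases hr.eq_or_lt with h0 | h0
  · have : x = y := by rw [← sub_eq_zero, ← norm_eq_zero]; exact h0.symm
    simp [this]
    positivity
  rcases le_or_gt 1 r with h1 | h1
  · have h2 : ‖c e t x - c e t y‖ ≤ 2 * A := by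
      refine (norm_sub_le _ _).trans ?_
      linarith [h.bdd e he t x, h.bdd e he t y]
    nlinarith [mul_nonneg hA (mul_nonneg hr hl), mul_le_mul_of_nonneg_left h1 hA]
  have hr1 : r ∈ Ioc (0 : ℝ) 1 := ⟨h0, h1.le⟩
  have hlog : |Real.log r| = Real.log (1 / r) := by
    rw [abs_of_neg (Real.log_neg h0 h1), one_div, Real.log_inv]
  rcases le_or_gt r e with h2 | h2
  · have h3 := h.lip e ⟨h0.trans_le h2, he.2⟩ t x y
    have h4 : Real.log (1 / e) ≤ |Real.log r| := by
      rw [hlog]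
      have := h0.trans_le h2
      exact Real.log_le_log (by positivity) (by gcongr)
    calc _ ≤ A * (1 + |Real.log r|) * r := h3.trans (by gcongr)
      _ ≤ _ := by nlinarith [mul_nonneg hA (mul_nonneg hr hl), mul_nonneg hA hr]
  · have h3 := h.lip r hr1 t x y
    rw [← hlog] at h3
    have e1 : c e t x - c e t y = (c e t x - c 0 t x) - (c r t x - c 0 t x) +
        (c r t x - c r t y) + (c r t y - c 0 t y) - (c e t y - c 0 t y) := by abel
    have hre : r ∈ Icc (0 : ℝ) 1 := ⟨hr1.1.le, hr1.2⟩
    have hn : ‖c e t x - c e t y‖ ≤ A * e + A * r + A * (1 + |Real.log r|) * r + A * r + A * e := by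
      rw [e1]
      refine (norm_sub_le _ _).trans (add_le_add ((norm_add_le _ _).trans (add_le_add
        ((norm_add_le _ _).trans (add_le_add ((norm_sub_le _ _).trans (add_le_add ?_ ?_)) h3)) ?_))
        ?_)
      · exact h.approx' he t x
      · exact h.approx' hre t x
      · exact h.approx' hre t y
      · exact h.approx' he t y
    nlinarith [mul_nonneg hA (mul_nonneg hr hl), mul_le_mul_of_nonneg_left h2.le hA]

/-- The case e = e' serves uniqueness and continuity of one flow; the case e + e' ≤ κ compares
different regularisations, in particular with the limit field. -/
theorem cross (h : RegField A c) {e e' κ : ℝ} (he : e ∈ Icc (0 : ℝ) 1) (he' : e' ∈ Icc (0 : ℝ) 1)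
    (hκ : 0 ≤ κ) (hee : e = e' ∨ e + e' ≤ κ) (t : ℝ) (x y : Plane) :
    ‖c e t x - c e' t y‖ ≤ 5 * A * (‖x - y‖ * (1 + |Real.log ‖x - y‖|) + κ) := by
  have hA := h.nonneg
  have h1 := h.logLip he t x y
  rcases hee with rfl | hee
  · have : 0 ≤ A * κ := by positivity
    linarith
  · have h2 : ‖c e t y - c e' t y‖ ≤ A * κ := by
      have : c e t y - c e' t y = (c e t y - c 0 t y) - (c e' t y - c 0 t y) := by abel
      rw [this]
      refine (norm_sub_le _ _).trans ?_
      have := mul_le_mul_of_nonneg_left hee hA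
      linarith [h.approx' he t y, h.approx' he' t y]
    have h3 : c e t x - c e' t y = (c e t x - c e t y) + (c e t y - c e' t y) := by abel
    rw [h3]
    have : 0 ≤ A * κ := by positivity
    refine (norm_add_le _ _).trans ?_
    linarith

/-- Stability by Osgood. The threshold κ depends on A, T and θ alone, so it is uniform over fields,
regularisation parameters and starting times. -/
theorem exists_close (A T θ : ℝ) (hθ : 0 < θ) :
    ∃ κ : ℝ, 0 < κ ∧ κ ≤ 1 ∧ ∀ (c : ℝ → ℝ → Plane → Plane), RegField A c → ∀ e ∈ Icc (0 : ℝ) 1,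
      ∀ e' ∈ Icc (0 : ℝ) 1, (e = e' ∨ e + e' ≤ κ) → ∀ (γ γ' : ℝ → Plane) (a b : ℝ), b - a ≤ T →
      (∀ t ∈ Icc a b, HasDerivWithinAt γ (c e t (γ t)) (Icc a b) t) →
      (∀ t ∈ Icc a b, HasDerivWithinAt γ' (c e' t (γ' t)) (Icc a b) t) →
      ∀ s ∈ Icc a b, ‖γ s - γ' s‖ ≤ κ → ∀ t ∈ Icc a b, ‖γ t - γ' t‖ ≤ θ := by
  by_cases hA : 0 ≤ A
  swap
  · exact ⟨1, one_pos, le_rfl, fun c h => absurd h.nonneg hA⟩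
  -- The a priori bound on the distance: at most κ ≤ 1 at time s, then a relative speed at most 2A
  -- during a time at most |T|.
  obtain ⟨κ, hκ0, hκ1, H⟩ := exists_osgood_small (5 * A) T (1 + 2 * A * |T|) θ (by positivity) hθ
  refine ⟨κ, hκ0, hκ1, fun c h e he e' he' hee γ γ' a b hab hγ hγ' s hs hss => ?_⟩
  have hd : ∀ t ∈ Icc a b, HasDerivWithinAt (fun t => γ t - γ' t)
      (c e t (γ t) - c e' t (γ' t)) (Icc a b) t := fun t ht => (hγ t ht).sub (hγ' t ht)
  refine H (fun t => γ t - γ' t) _ a b hab hd (fun t ht => ?_) (fun t ht => ?_) s hs hss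
  · refine (abs_real_inner_le_norm _ _).trans ?_
    calc _ ≤ ‖γ t - γ' t‖ *
        (5 * A * (‖γ t - γ' t‖ * (1 + |Real.log ‖γ t - γ' t‖|) + κ)) := by
          gcongr
          exact h.cross he he' hκ0.le hee t _ _
      _ = _ := by ring
  · have h1 : ‖(γ t - γ' t) - (γ s - γ' s)‖ ≤ 2 * A * ‖t - s‖ := by
      refine Convex.norm_image_sub_le_of_norm_hasDerivWithin_le hd (fun r _ => ?_)
        (convex_Icc a b) hs ht
      refine (norm_sub_le _ _).trans ?_
      linarith [h.bdd e he r (γ r), h.bdd e' he' r (γ' r)]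
    have h2 : ‖t - s‖ ≤ |T| := by
      rw [Real.norm_eq_abs]
      refine le_trans ?_ (le_abs_self T)
      rw [abs_le]; constructor <;> linarith [hs.1, hs.2, ht.1, ht.2]
    have h3 := norm_sub_norm_le (γ t - γ' t) (γ s - γ' s)
    have h4 : 2 * A * ‖t - s‖ ≤ 2 * A * |T| := by gcongr
    linarith

theorem unique (h : RegField A c) {e : ℝ} (he : e ∈ Icc (0 : ℝ) 1) {γ γ' : ℝ → Plane} {a b : ℝ}
    (hγ : ∀ t ∈ Icc a b, HasDerivWithinAt γ (c e t (γ t)) (Icc a b) t)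
    (hγ' : ∀ t ∈ Icc a b, HasDerivWithinAt γ' (c e t (γ' t)) (Icc a b) t) {s : ℝ}
    (hs : s ∈ Icc a b) (hss : γ s = γ' s) {t : ℝ} (ht : t ∈ Icc a b) : γ t = γ' t := by
  rw [← sub_eq_zero, ← norm_le_zero_iff]
  refine le_of_forall_pos_le_add fun θ hθ => ?_
  obtain ⟨κ, hκ0, -, H⟩ := exists_close A (b - a) θ hθ
  rw [zero_add]
  exact H c h e he e he (Or.inl rfl) γ γ' a b le_rfl hγ hγ' s hs (by simp [hss, hκ0.le]) t ht

end RegField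

end VortexWave


namespace VortexWave

/-! ### Flows -/

/-- `γ` is a trajectory of `b` in `D` on the time interval `I`. -/
def IsSolOn (D : Set Plane) (b : ℝ → Plane → Plane) (I : Set ℝ) (γ : ℝ → Plane) : Prop :=
  ∀ t ∈ I, γ t ∈ D ∧ HasDerivWithinAt γ (b t (γ t)) I t

/-- `γ` is a trajectory of `b` in `D` for all times. -/
def IsSol (D : Set Plane) (b : ℝ → Plane → Plane) (γ : ℝ → Plane) : Prop :=
  ∀ t, γ t ∈ D ∧ HasDerivAt γ (b t (γ t)) t

theorem IsSol.isSolOn {D : Set Plane} {b : ℝ → Plane → Plane} {γ : ℝ → Plane}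
    (h : IsSol D b γ) (I : Set ℝ) : IsSolOn D b I γ :=
  fun t _ => ⟨(h t).1, (h t).2.hasDerivWithinAt⟩

theorem IsSolOn.mono {D : Set Plane} {b : ℝ → Plane → Plane} {γ : ℝ → Plane} {I J : Set ℝ}
    (h : IsSolOn D b I γ) (hJ : J ⊆ I) : IsSolOn D b J γ :=
  fun t ht => ⟨(h t (hJ ht)).1, (h t (hJ ht)).2.mono hJ⟩

/-- The flow of `b` in `D`: the position at time `t` of the trajectory that is at `y` at time
`s`. -/
noncomputable def fieldFlow (D : Set Plane) (b : ℝ → Plane → Plane) (s t : ℝ) (y : Plane) :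
    Plane :=
  open Classical in
  if h : ∃ γ : ℝ → Plane, γ s = y ∧ IsSol D b γ then Classical.choose h t else y

/-- Uniqueness of trajectories of `b` in `D` on compact intervals. -/
def UniqueSol (D : Set Plane) (b : ℝ → Plane → Plane) : Prop :=
  ∀ (u v : ℝ) (γ γ' : ℝ → Plane), IsSolOn D b (Icc u v) γ → IsSolOn D b (Icc u v) γ' →
    ∀ s ∈ Icc u v, γ s = γ' s → ∀ t ∈ Icc u v, γ t = γ' t

section Glue

variable {D : Set Plane} {b : ℝ → Plane → Plane}

theorem fieldFlow_spec {s : ℝ} {y : Plane} (h : ∃ γ : ℝ → Plane, γ s = y ∧ IsSol D b γ) :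
    fieldFlow D b s s y = y ∧ IsSol D b (fun t => fieldFlow D b s t y) := by
  have h1 : (fun t => fieldFlow D b s t y) = Classical.choose h := by
    ext1 t; rw [fieldFlow, dif_pos h]
  have h2 := Classical.choose_spec h
  rw [h1]
  refine ⟨?_, h2.2⟩
  rw [fieldFlow, dif_pos h]
  exact h2.1

/-- Uniqueness makes the solutions on [s − n, s + n] agree on overlaps; the glued curve reads its
value at t from the interval of index ⌈|t − s|⌉. -/
theorem exists_isSol_of_local (huniq : UniqueSol D b) {s : ℝ} {y : Plane}
    (hex : ∀ n : ℕ, ∃ γ : ℝ → Plane, γ s = y ∧ IsSolOn D b (Icc (s - n) (s + n)) γ) :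
    ∃ γ : ℝ → Plane, γ s = y ∧ IsSol D b γ := by
  choose g hg0 hg using hex
  have hagree : ∀ (m n : ℕ), m ≤ n → ∀ t ∈ Icc (s - m) (s + m), g m t = g n t := by
    intro m n hmn t ht
    have hmn' : (m : ℝ) ≤ n := by exact_mod_cast hmn
    exact huniq _ _ _ _ (hg m) ((hg n).mono (Icc_subset_Icc (by linarith) (by linarith))) s
      ⟨by simp, by simp⟩ ((hg0 m).trans (hg0 n).symm) t ht
  have key : ∀ (n : ℕ) (t : ℝ), |t - s| ≤ n → g ⌈|t - s|⌉₊ t = g n t := by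
    intro n t ht
    refine hagree _ _ (Nat.ceil_le.2 ht) t ?_
    have := Nat.le_ceil |t - s|
    rw [abs_le] at this
    constructor <;> linarith [this.1, this.2]
  refine ⟨fun t => g ⌈|t - s|⌉₊ t, by simp [hg0], fun t => ?_⟩
  -- The extra 1 places t in the interior, where the one-sided derivative is a derivative.
  set n := ⌈|t - s|⌉₊ + 1
  have hn : |t - s| < n := by
    have := Nat.le_ceil |t - s|
    push_cast [n]; linarith
  have hev : (fun t => g ⌈|t - s|⌉₊ t) =ᶠ[nhds t] g n := by
    have : ∀ᶠ r in nhds t, |r - s| < n :=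
      (isOpen_lt (by fun_prop) continuous_const).mem_nhds hn
    filter_upwards [this] with r hr using key n r hr.le
  have hmem : Icc (s - n) (s + n) ∈ nhds t := by
    rw [abs_lt] at hn
    exact Icc_mem_nhds (by linarith [hn.1]) (by linarith [hn.2])
  obtain ⟨h1, h2⟩ := hg n t (mem_of_mem_nhds hmem)
  dsimp only
  rw [hev.eq_of_nhds]
  exact ⟨h1, (h2.hasDerivAt hmem).congr_of_eventuallyEq hev⟩

theorem fieldFlow_unique (huniq : UniqueSol D b)
    {s : ℝ} {y : Plane} (hex : ∃ γ : ℝ → Plane, γ s = y ∧ IsSol D b γ) {u v : ℝ} {γ : ℝ → Plane}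
    (hγ : IsSolOn D b (Icc u v) γ) (hs : s ∈ Icc u v) (hsy : γ s = y) {t : ℝ}
    (ht : t ∈ Icc u v) : γ t = fieldFlow D b s t y := by
  obtain ⟨h1, h2⟩ := fieldFlow_spec hex
  exact huniq u v _ _ hγ (h2.isSolOn _) s hs (hsy.trans h1.symm) t ht

theorem fieldFlow_comp (huniq : UniqueSol D b)
    {s : ℝ} {y : Plane} (hex : ∃ γ : ℝ → Plane, γ s = y ∧ IsSol D b γ) (t r : ℝ) :
    fieldFlow D b t r (fieldFlow D b s t y) = fieldFlow D b s r y := by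
  obtain ⟨h1, h2⟩ := fieldFlow_spec hex
  have h3 : ∃ γ : ℝ → Plane, γ t = fieldFlow D b s t y ∧ IsSol D b γ := ⟨_, rfl, h2⟩
  exact (fieldFlow_unique huniq h3 (u := min t r) (v := max t r) (h2.isSolOn _)
    ⟨min_le_left _ _, le_max_left _ _⟩ rfl ⟨min_le_right _ _, le_max_right _ _⟩).symm

end Glue

namespace RegField

variable {A : ℝ} {c : ℝ → ℝ → Plane → Plane}

theorem uniqueSol (h : RegField A c) {e : ℝ} (he : e ∈ Icc (0 : ℝ) 1) :
    UniqueSol univ (c e) :=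
  fun _ _ _ _ hγ hγ' _ hs hss _ ht =>
    h.unique he (fun r hr => (hγ r hr).2) (fun r hr => (hγ' r hr).2) hs hss ht

theorem exists_isSol_pos (h : RegField A c) {e : ℝ} (he : e ∈ Ioc (0 : ℝ) 1) (s : ℝ) (y : Plane) :
    ∃ γ : ℝ → Plane, γ s = y ∧ IsSol univ (c e) γ := by
  have he' : e ∈ Icc (0 : ℝ) 1 := ⟨he.1.le, he.2⟩
  refine exists_isSol_of_local (h.uniqueSol he') fun n => ?_
  have hA := h.nonneg
  have hL : 0 ≤ A * (1 + Real.log (1 / e)) := by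
    have : 0 ≤ Real.log (1 / e) := Real.log_nonneg (by rw [le_div_iff₀ he.1]; linarith [he.2])
    positivity
  -- The speed is at most A, so the ball of radius A n contains the trajectory during the whole
  -- interval, and one application suffices.
  have hpl : IsPicardLindelof (c e) (tmin := s - n) (tmax := s + n) ⟨s, by simp, by simp⟩ y
      (⟨A * n, by positivity⟩ : ℝ≥0) 0 ⟨A, hA⟩ ⟨_, hL⟩ :=
    { lipschitzOnWith := fun t _ => by
        refine LipschitzWith.lipschitzOnWith (LipschitzWith.of_dist_le_mul fun x x' => ?_)
        rw [dist_eq_norm, dist_eq_norm]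
        exact h.lip e he t x x'
      continuousOn := fun x _ =>
        ((h.cont e he').comp (continuous_id.prodMk continuous_const)).continuousOn
      norm_le := fun t _ x _ => h.bdd e he' t x
      mul_max_le := by simp; exact le_rfl }
  obtain ⟨γ, h1, h2⟩ := hpl.exists_eq_forall_mem_Icc_hasDerivWithinAt₀
  exact ⟨γ, h1, fun t ht => ⟨mem_univ _, h2 t ht⟩⟩

theorem norm_sub_le_of_isSol (h : RegField A c) {e : ℝ} (he : e ∈ Icc (0 : ℝ) 1) {γ : ℝ → Plane}
    (hγ : IsSol univ (c e) γ) (s t : ℝ) : ‖γ t - γ s‖ ≤ A * |t - s| :=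
  Convex.norm_image_sub_le_of_norm_hasDerivWithin_le
    (fun r _ => (hγ r).2.hasDerivWithinAt) (fun r _ => h.bdd e he r _) convex_univ
    (mem_univ s) (mem_univ t)

theorem isSol_sub_le (h : RegField A c) {T θ κ : ℝ}
    (H : ∀ (c : ℝ → ℝ → Plane → Plane), RegField A c → ∀ e ∈ Icc (0 : ℝ) 1,
      ∀ e' ∈ Icc (0 : ℝ) 1, (e = e' ∨ e + e' ≤ κ) → ∀ (γ γ' : ℝ → Plane) (a b : ℝ), b - a ≤ T →
      (∀ t ∈ Icc a b, HasDerivWithinAt γ (c e t (γ t)) (Icc a b) t) →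
      (∀ t ∈ Icc a b, HasDerivWithinAt γ' (c e' t (γ' t)) (Icc a b) t) →
      ∀ s ∈ Icc a b, ‖γ s - γ' s‖ ≤ κ → ∀ t ∈ Icc a b, ‖γ t - γ' t‖ ≤ θ)
    {e e' : ℝ} (he : e ∈ Icc (0 : ℝ) 1) (he' : e' ∈ Icc (0 : ℝ) 1) (hee : e = e' ∨ e + e' ≤ κ)
    {γ γ' : ℝ → Plane} (hγ : IsSol univ (c e) γ) (hγ' : IsSol univ (c e') γ') {s t : ℝ}
    (hst : |t - s| ≤ T) (hs : ‖γ s - γ' s‖ ≤ κ) : ‖γ t - γ' t‖ ≤ θ := by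
  refine H c h e he e' he' hee γ γ' (min s t) (max s t) ?_
    (fun r _ => (hγ r).2.hasDerivWithinAt) (fun r _ => (hγ' r).2.hasDerivWithinAt) s
    ⟨min_le_left _ _, le_max_left _ _⟩ hs t ⟨min_le_right _ _, le_max_right _ _⟩
  rwa [max_sub_min_eq_abs]

/-- For e = 0 the field is not Lipschitz. The trajectories of the regularisations at scales 1/(k +
1) form a Cauchy sequence by `exists_close`, and the limit passes into the integral equation by
dominated convergence. -/
theorem exists_isSol (h : RegField A c) {e : ℝ} (he : e ∈ Icc (0 : ℝ) 1) (s : ℝ) (y : Plane) :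
    ∃ γ : ℝ → Plane, γ s = y ∧ IsSol univ (c e) γ := by
  rcases he.1.eq_or_lt with rfl | he0
  swap
  · exact h.exists_isSol_pos ⟨he0, he.2⟩ s y
  have hA := h.nonneg
  have hek : ∀ k : ℕ, 1 / ((k : ℝ) + 1) ∈ Ioc (0 : ℝ) 1 := fun k =>
    ⟨by positivity, by rw [div_le_one (by positivity)]; linarith [(Nat.cast_nonneg k : (0:ℝ) ≤ k)]⟩
  have hek' : ∀ k : ℕ, 1 / ((k : ℝ) + 1) ∈ Icc (0 : ℝ) 1 := fun k => ⟨(hek k).1.le, (hek k).2⟩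
  choose g hg0 hg using fun k => h.exists_isSol_pos (hek k) s y
  have hlim : ∀ t, ∃ p, Filter.Tendsto (fun k => g k t) Filter.atTop (nhds p) := by
    intro t
    refine cauchySeq_tendsto_of_complete (Metric.cauchySeq_iff'.2 fun θ hθ => ?_)
    obtain ⟨κ, hκ0, -, H⟩ := exists_close A |t - s| (θ / 2) (half_pos hθ)
    obtain ⟨N, hN⟩ := exists_nat_one_div_lt (half_pos hκ0)
    refine ⟨N, fun k hk => ?_⟩
    rw [dist_eq_norm]
    refine (h.isSol_sub_le H (hek' k) (hek' N) (Or.inr ?_) (hg k) (hg N) (s := s) le_rfl ?_).trans_lt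
      (half_lt_self hθ)
    · have := Nat.one_div_le_one_div (α := ℝ) hk
      linarith
    · simp [hg0, hκ0.le]
  choose γ hγ using hlim
  have hγc : Continuous γ := by
    refine LipschitzWith.continuous (K := ⟨A, hA⟩) (LipschitzWith.of_dist_le_mul fun t r => ?_)
    rw [dist_eq_norm, Real.dist_eq]
    exact le_of_tendsto ((hγ t).sub (hγ r)).norm
      (.of_forall fun k => h.norm_sub_le_of_isSol (hek' k) (hg k) r t)
  have hc0 : Continuous fun r => c 0 r (γ r) :=
    (h.cont 0 (by simp)).comp (continuous_id.prodMk hγc)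
  have hint : ∀ t, γ t = y + ∫ r in s..t, c 0 r (γ r) := by
    intro t
    have h1 : ∀ k, g k t = y + ∫ r in s..t, c (1 / ((k : ℝ) + 1)) r (g k r) := by
      intro k
      have hcont : Continuous fun r => c (1 / ((k : ℝ) + 1)) r (g k r) :=
        (h.cont _ (hek' k)).comp (continuous_id.prodMk
          (continuous_iff_continuousAt.2 fun r => (hg k r).2.continuousAt))
      rw [intervalIntegral.integral_eq_sub_of_hasDerivAt (fun r _ => (hg k r).2)
        (hcont.intervalIntegrable _ _), hg0]
      abel
    refine tendsto_nhds_unique (hγ t) ?_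
    simp_rw [h1]
    refine tendsto_const_nhds.add ?_
    refine intervalIntegral.tendsto_integral_filter_of_dominated_convergence (fun _ => A) ?_ ?_ ?_ ?_
    · refine .of_forall fun k => Continuous.aestronglyMeasurable ?_
      exact (h.cont _ (hek' k)).comp (continuous_id.prodMk
          (continuous_iff_continuousAt.2 fun r => (hg k r).2.continuousAt))
    · exact .of_forall fun k => .of_forall fun r _ => h.bdd _ (hek' k) _ _
    · simp
    · refine .of_forall fun r _ => ?_
      have h2 : Filter.Tendsto (fun k : ℕ => c 0 r (g k r)) Filter.atTop (nhds (c 0 r (γ r))) :=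
        (((h.cont 0 (by simp)).comp (Continuous.prodMk_right r)).tendsto (γ r)).comp (hγ r)
      have h3 : Filter.Tendsto
          (fun k : ℕ => c (1 / ((k : ℝ) + 1)) r (g k r) - c 0 r (g k r)) Filter.atTop (nhds 0) := by
        refine squeeze_zero_norm (fun k => h.approx _ (hek k) _ _) ?_
        simpa using (tendsto_one_div_add_atTop_nhds_zero_nat (𝕜 := ℝ)).const_mul A
      simpa using h3.add h2
  refine ⟨γ, by rw [hint s]; simp, fun t => ⟨mem_univ _, ?_⟩⟩
  have h1 : HasDerivAt (fun t => y + ∫ r in s..t, c 0 r (γ r)) (c 0 t (γ t)) t :=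
    (intervalIntegral.integral_hasDerivAt_right (hc0.intervalIntegrable _ _)
      hc0.aestronglyMeasurable.stronglyMeasurableAtFilter hc0.continuousAt).const_add y
  exact h1.congr_of_eventuallyEq (.of_forall hint)

theorem flow_self (h : RegField A c) {e : ℝ} (he : e ∈ Icc (0 : ℝ) 1) (s : ℝ) (y : Plane) :
    fieldFlow univ (c e) s s y = y :=
  (fieldFlow_spec (h.exists_isSol he s y)).1

theorem flow_isSol (h : RegField A c) {e : ℝ} (he : e ∈ Icc (0 : ℝ) 1) (s : ℝ) (y : Plane) :
    IsSol univ (c e) fun t => fieldFlow univ (c e) s t y :=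
  (fieldFlow_spec (h.exists_isSol he s y)).2

theorem flow_comp (h : RegField A c) {e : ℝ} (he : e ∈ Icc (0 : ℝ) 1) (s t r : ℝ) (y : Plane) :
    fieldFlow univ (c e) t r (fieldFlow univ (c e) s t y) = fieldFlow univ (c e) s r y :=
  fieldFlow_comp (h.uniqueSol he) (h.exists_isSol he s _) t r

theorem norm_flow_sub_le (h : RegField A c) {e : ℝ} (he : e ∈ Icc (0 : ℝ) 1) (s t t' : ℝ)
    (y : Plane) : ‖fieldFlow univ (c e) s t y - fieldFlow univ (c e) s t' y‖ ≤ A * |t - t'| :=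
  h.norm_sub_le_of_isSol he (h.flow_isSol he s y) t' t

theorem exists_flow_close (h : RegField A c) (T θ : ℝ) (hθ : 0 < θ) :
    ∃ κ : ℝ, 0 < κ ∧ κ ≤ 1 ∧ ∀ e ∈ Icc (0 : ℝ) 1, ∀ e' ∈ Icc (0 : ℝ) 1, (e = e' ∨ e + e' ≤ κ) →
      ∀ s t, |t - s| ≤ T → ∀ y y', ‖y - y'‖ ≤ κ →
        ‖fieldFlow univ (c e) s t y - fieldFlow univ (c e') s t y'‖ ≤ θ := by
  obtain ⟨κ, hκ0, hκ1, H⟩ := exists_close A T θ hθ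
  refine ⟨κ, hκ0, hκ1, fun e he e' he' hee s t hst y y' hyy => ?_⟩
  refine h.isSol_sub_le H he he' hee (h.flow_isSol he s y) (h.flow_isSol he' s y') hst ?_
  simpa [h.flow_self he, h.flow_self he'] using hyy

/-- By the composition law, moving the starting time from s to s₀ amounts to moving the starting
point by at most A|s − s₀|, which is handled by stability. -/
theorem continuous_flow (h : RegField A c) {e : ℝ} (he : e ∈ Icc (0 : ℝ) 1) :
    Continuous fun p : ℝ × ℝ × Plane => fieldFlow univ (c e) p.1 p.2.1 p.2.2 := by
  have hA := h.nonneg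
  rw [continuous_iff_continuousAt]
  rintro ⟨s₀, t₀, y₀⟩
  rw [Metric.continuousAt_iff']
  intro θ hθ
  obtain ⟨κ, hκ0, -, H⟩ := h.exists_flow_close |t₀ - s₀| (θ / 2) (half_pos hθ)
  have h1 : ∀ᶠ p : ℝ × ℝ × Plane in nhds (s₀, t₀, y₀), A * |p.2.1 - t₀| < θ / 2 :=
    (isOpen_lt (by fun_prop) continuous_const).mem_nhds (by simp [hθ])
  have h2 : ∀ᶠ p : ℝ × ℝ × Plane in nhds (s₀, t₀, y₀), A * |s₀ - p.1| + ‖p.2.2 - y₀‖ < κ :=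
    (isOpen_lt (by fun_prop) continuous_const).mem_nhds (by simp [hκ0])
  filter_upwards [h1, h2]
  rintro ⟨s, t, y⟩ h1 h2
  dsimp only at h1 h2 ⊢
  rw [dist_eq_norm, ← sub_add_sub_cancel _ (fieldFlow univ (c e) s t₀ y)]
  have h3 := h.norm_flow_sub_le he s t t₀ y
  have h4 : ‖fieldFlow univ (c e) s t₀ y - fieldFlow univ (c e) s₀ t₀ y₀‖ ≤ θ / 2 := by
    rw [← h.flow_comp he s s₀ t₀ y]
    refine H e he e he (Or.inl rfl) s₀ t₀ le_rfl _ _ ?_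
    have h5 := h.norm_flow_sub_le he s s₀ s y
    rw [h.flow_self he] at h5
    have h6 := norm_add_le (fieldFlow univ (c e) s s₀ y - y) (y - y₀)
    rw [sub_add_sub_cancel] at h6
    linarith
  exact (norm_add_le _ _).trans_lt (by linarith)

/-- The constant `L` is independent of `A`: in the application the cut-off kernel adds 1/δ² to it
without the factor log(1/e), and this distinction keeps the growth rate in 1/e independent of δ.
Negative times are reached by reversing the field. -/
theorem lipschitz_flow (h : RegField A c) {e L : ℝ} (he' : e ∈ Icc (0 : ℝ) 1) (hL : 0 ≤ L)
    (hlip : ∀ t x y, ‖c e t x - c e t y‖ ≤ L * ‖x - y‖) (s t : ℝ)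
    (x y : Plane) : ‖fieldFlow univ (c e) s t x - fieldFlow univ (c e) s t y‖ ≤
      Real.exp (L * |t - s|) * ‖x - y‖ := by
  have key : ∀ (b : ℝ → Plane → Plane), (∀ r x y, ‖b r x - b r y‖ ≤
      L * ‖x - y‖) → ∀ γ γ' : ℝ → Plane, IsSol univ b γ → IsSol univ b γ' →
      ∀ s t, s ≤ t → ‖γ t - γ' t‖ ≤
        ‖γ s - γ' s‖ * Real.exp (L * (t - s)) := by
    intro b hb γ γ' hγ hγ' s t hst
    have := dist_le_of_trajectories_ODE (v := b) (K := ⟨_, hL⟩) (f := γ) (g := γ') (a := s) (b := t)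
      (δ := ‖γ s - γ' s‖)
      (fun r => LipschitzWith.of_dist_le_mul fun x y => by
        rw [dist_eq_norm, dist_eq_norm]; exact hb r x y)
      (fun r _ => (hγ r).2.continuousAt.continuousWithinAt)
      (fun r _ => (hγ r).2.hasDerivWithinAt)
      (fun r _ => (hγ' r).2.continuousAt.continuousWithinAt)
      (fun r _ => (hγ' r).2.hasDerivWithinAt) (by rw [dist_eq_norm]) t (right_mem_Icc.2 hst)
    rwa [dist_eq_norm] at this
  have h1 := h.flow_isSol he' s x
  have h2 := h.flow_isSol he' s y
  rcases le_total s t with hst | hst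
  · have := key (c e) (hlip) _ _ h1 h2 s t hst
    rw [h.flow_self he', h.flow_self he'] at this
    rwa [abs_of_nonneg (sub_nonneg.2 hst), mul_comm]
  · have hneg : ∀ γ : ℝ → Plane, IsSol univ (c e) γ →
        IsSol univ (fun r y => -c e (-r) y) fun r => γ (-r) := by
      intro γ hγ r
      refine ⟨mem_univ _, ?_⟩
      have := (hγ (-r)).2.scomp r (hasDerivAt_neg r)
      exact this.congr_deriv (by simp)
    have := key (fun r y => -c e (-r) y) (fun r x y => by
      rw [neg_sub_neg, norm_sub_rev]; exact hlip (-r) x y) _ _ (hneg _ h1) (hneg _ h2)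
      (-s) (-t) (by linarith)
    simp only [neg_neg] at this
    rw [h.flow_self he', h.flow_self he'] at this
    rw [abs_of_nonpos (sub_nonpos.2 hst), mul_comm]
    convert this using 3
    ring

end RegField

end VortexWave


namespace VortexWave

/-! ### The flow around a point vortex at the origin -/

/-- The Biot-Savart kernel made Lipschitz inside the ball of radius `δ`. -/
noncomputable def kernMax (δ : ℝ) (x : Plane) : Plane :=
  (1 / (2 * Real.pi * (max ‖x‖ δ) ^ 2)) • perp x

theorem kernMax_eq {δ : ℝ} {x : Plane} (h : δ ≤ ‖x‖) : kernMax δ x = kernel x := by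
  rw [kernMax, kernel, max_eq_left h]

theorem inner_kernMax (δ : ℝ) (x : Plane) : inner ℝ x (kernMax δ x) = 0 := by
  rw [kernMax, inner_smul_right, inner_perp_self, mul_zero]

theorem continuous_kernMax {δ : ℝ} (hδ : 0 < δ) : Continuous (kernMax δ) := by
  unfold kernMax
  have hpi := Real.pi_pos
  have hm : Continuous fun x : Plane => 2 * Real.pi * max ‖x‖ δ ^ 2 := by fun_prop
  refine Continuous.smul (Continuous.div continuous_const hm fun x => ?_) continuous_perp
  have : 0 < max ‖x‖ δ := lt_max_of_lt_right hδ
  positivity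

theorem norm_kernMax_le {δ : ℝ} (hδ : 0 < δ) (x : Plane) : ‖kernMax δ x‖ ≤ 1 / δ := by
  have hpi := Real.pi_gt_three
  have h1 : ‖x‖ ≤ max ‖x‖ δ := le_max_left _ _
  have h2 : δ ≤ max ‖x‖ δ := le_max_right _ _
  have h0 : 0 < max ‖x‖ δ := hδ.trans_le h2
  rw [kernMax, norm_smul, norm_perp, Real.norm_eq_abs, abs_of_nonneg (by positivity)]
  calc 1 / (2 * Real.pi * max ‖x‖ δ ^ 2) * ‖x‖ ≤ 1 / (1 * max ‖x‖ δ ^ 2) * max ‖x‖ δ := by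
        gcongr; linarith
    _ = 1 / max ‖x‖ δ := by field_simp
    _ ≤ 1 / δ := by gcongr

theorem norm_kernMax_sub_le {δ : ℝ} (hδ : 0 < δ) (x y : Plane) :
    ‖kernMax δ x - kernMax δ y‖ ≤ 1 / δ ^ 2 * ‖x - y‖ := by
  have hpi := Real.pi_gt_three
  have hx1 : δ ≤ max ‖x‖ δ := le_max_right _ _
  have hy1 : δ ≤ max ‖y‖ δ := le_max_right _ _
  have hy2 : ‖y‖ ≤ max ‖y‖ δ := le_max_left _ _
  have hmm : |max ‖y‖ δ - max ‖x‖ δ| ≤ ‖x - y‖ := by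
    refine (abs_max_sub_max_le_abs _ _ _).trans ?_
    rw [norm_sub_rev]; exact abs_norm_sub_norm_le _ _
  set a := max ‖x‖ δ
  set b := max ‖y‖ δ
  have ha : 0 < a := hδ.trans_le hx1
  have hb : 0 < b := hδ.trans_le hy1
  have h : kernMax δ x - kernMax δ y = (1 / (2 * Real.pi)) •
      perp ((a ^ 2)⁻¹ • (x - y) + ((a ^ 2)⁻¹ - (b ^ 2)⁻¹) • y) := by
    have : (a ^ 2)⁻¹ • (x - y) + ((a ^ 2)⁻¹ - (b ^ 2)⁻¹) • y =
        (a ^ 2)⁻¹ • x - (b ^ 2)⁻¹ • y := by module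
    rw [this, perp_sub, perp_smul, perp_smul, smul_sub, smul_smul, smul_smul, kernMax, kernMax]
    congr 2 <;> field_simp <;> rfl
  rw [h, norm_smul, norm_perp, Real.norm_eq_abs, abs_of_nonneg (by positivity)]
  have h1 : 1 / (2 * Real.pi) ≤ 1 / 3 := by gcongr; linarith
  have h2 : |(a ^ 2)⁻¹ - (b ^ 2)⁻¹| * ‖y‖ ≤ 2 / δ ^ 2 * ‖x - y‖ := by
    have e1 : (a ^ 2)⁻¹ - (b ^ 2)⁻¹ = (b - a) * ((a * b)⁻¹ * (a⁻¹ + b⁻¹)) := by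
      field_simp; ring
    rw [e1, abs_mul, abs_of_pos (show 0 < (a * b)⁻¹ * (a⁻¹ + b⁻¹) by positivity)]
    calc _ ≤ ‖x - y‖ * ((a * b)⁻¹ * (a⁻¹ + b⁻¹)) * b := by gcongr
      _ = (a⁻¹ * (a⁻¹ + b⁻¹)) * ‖x - y‖ := by field_simp
      _ ≤ (δ⁻¹ * (δ⁻¹ + δ⁻¹)) * ‖x - y‖ := by gcongr
      _ = _ := by field_simp; ring
  have h3 : ‖(a ^ 2)⁻¹ • (x - y) + ((a ^ 2)⁻¹ - (b ^ 2)⁻¹) • y‖ ≤ 3 / δ ^ 2 * ‖x - y‖ := by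
    refine (norm_add_le _ _).trans ?_
    rw [norm_smul, norm_smul, Real.norm_eq_abs, Real.norm_eq_abs,
      abs_of_pos (show 0 < (a ^ 2)⁻¹ by positivity)]
    have : (a ^ 2)⁻¹ * ‖x - y‖ ≤ (δ ^ 2)⁻¹ * ‖x - y‖ := by gcongr
    calc _ ≤ (δ ^ 2)⁻¹ * ‖x - y‖ + 2 / δ ^ 2 * ‖x - y‖ := add_le_add this h2
      _ = _ := by field_simp; ring
  calc _ ≤ 1 / 3 * (3 / δ ^ 2 * ‖x - y‖) := by gcongr
    _ = _ := by field_simp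

/-- A regularisable field that vanishes at the origin. -/
structure VortexField (A : ℝ) (U : ℝ → ℝ → Plane → Plane) : Prop where
  reg : RegField A U
  zero : ∀ e ∈ Icc (0 : ℝ) 1, ∀ t, U e t 0 = 0

/-- The field `U 0 + K`. -/
noncomputable def vortexDrift (U : ℝ → ℝ → Plane → Plane) (t : ℝ) (y : Plane) : Plane :=
  U 0 t y + kernel y

/-- The flow of `U 0 + K` away from the origin. -/
noncomputable def vortexFlow (U : ℝ → ℝ → Plane → Plane) (s t : ℝ) (y : Plane) : Plane :=
  fieldFlow {0}ᶜ (vortexDrift U) s t y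

/-- The field `U + K` with the kernel cut off at scale `δ`. -/
noncomputable def cutField (U : ℝ → ℝ → Plane → Plane) (δ e t : ℝ) (y : Plane) : Plane :=
  U e t y + kernMax δ y

namespace VortexField

variable {A : ℝ} {U : ℝ → ℝ → Plane → Plane}

theorem cutField_reg (h : VortexField A U) {δ : ℝ} (hδ : 0 < δ) :
    RegField (A + 1 / δ + 1 / δ ^ 2) (cutField U δ) where
  cont e he := (h.reg.cont e he).add ((continuous_kernMax hδ).comp continuous_snd)
  bdd e he t y := by
    have := norm_add_le (U e t y) (kernMax δ y)
    have h1 := h.reg.bdd e he t y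
    have h2 := norm_kernMax_le hδ y
    have h3 : 0 ≤ 1 / δ ^ 2 := by positivity
    rw [cutField]; linarith
  approx e he t y := by
    rw [cutField, cutField, add_sub_add_right_eq_sub]
    refine (h.reg.approx e he t y).trans ?_
    have := he.1.le
    have h3 : 0 ≤ 1 / δ + 1 / δ ^ 2 := by positivity
    gcongr
    linarith
  lip e he t x y := by
    have hA := h.reg.nonneg
    have hl : 0 ≤ Real.log (1 / e) := Real.log_nonneg (by rw [le_div_iff₀ he.1]; linarith [he.2])
    rw [cutField, cutField, add_sub_add_comm]
    refine (norm_add_le _ _).trans ((add_le_add (h.reg.lip e he t x y)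
      (norm_kernMax_sub_le hδ x y)).trans ?_)
    rw [← add_mul]
    gcongr
    have h3 : 0 ≤ 1 / δ := by positivity
    have h4 : 0 ≤ 1 / δ ^ 2 := by positivity
    nlinarith [mul_nonneg h3 hl, mul_nonneg h4 hl]

/-- `osgood` is applied to the trajectory itself: k(γ) is orthogonal to γ, and U vanishes at 0, so
that |U(γ)| is controlled by |γ|(1 + |log |γ||). The bounds depend neither on k nor on U beyond A;
hence they hold for every cut-off and allow its removal. -/
theorem exists_norm_bounds (A T ρ P : ℝ) (hρ : 0 < ρ) :
    ∃ r R : ℝ, 0 < r ∧ ∀ U, VortexField A U → ∀ k : Plane → Plane,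
      (∀ y, inner ℝ y (k y) = 0) → ∀ e ∈ Icc (0 : ℝ) 1, ∀ (γ : ℝ → Plane) (a b : ℝ), b - a ≤ T →
      (∀ t ∈ Icc a b, HasDerivWithinAt γ (U e t (γ t) + k (γ t)) (Icc a b) t) →
      ∀ s ∈ Icc a b, ρ ≤ ‖γ s‖ → ‖γ s‖ ≤ P → ∀ t ∈ Icc a b, r ≤ ‖γ t‖ ∧ ‖γ t‖ ≤ R := by
  by_cases hA : 0 ≤ A
  swap
  · exact ⟨1, 1, one_pos, fun U h => absurd h.reg.nonneg hA⟩
  set M := |Real.log (ρ ^ 2)| + |Real.log (P ^ 2 + 1)|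
  set N := (1 + M) * Real.exp (3 * (5 * A) * T) with hN
  refine ⟨Real.exp (-N / 2), Real.exp (N / 2), by positivity, ?_⟩
  intro U h k hk e he γ a b hab hγ s hs hρs hPs t ht
  have key : ∀ η ∈ Ioc (0 : ℝ) 1, |Real.log (‖γ t‖ ^ 2 + η ^ 2)| ≤ N := by
    intro η hη
    have h1 := osgood (B := 5 * A) (by positivity) hη.1 hγ (fun r hr => ?_) ht hs
    · have h2 : |Real.log (‖γ s‖ ^ 2 + η ^ 2)| ≤ M := by
        refine abs_log_le_of_mem_Icc (by positivity) (by nlinarith) ?_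
        nlinarith [norm_nonneg (γ s), hη.1, hη.2]
      have h3 : |s - t| ≤ T := by
        rw [abs_le]; constructor <;> linarith [hs.1, hs.2, ht.1, ht.2]
      have h4 : (1 + |Real.log (‖γ s‖ ^ 2 + η ^ 2)|) * Real.exp (3 * (5 * A) * |s - t|) ≤ N := by
        rw [hN]; gcongr
      linarith
    · rw [inner_add_right, hk, add_zero]
      refine (abs_real_inner_le_norm _ _).trans ?_
      have h2 := h.reg.logLip he r (γ r) 0
      rw [h.zero e he, sub_zero, sub_zero] at h2
      have h3 : 0 ≤ η * ‖γ r‖ := mul_nonneg hη.1.le (norm_nonneg _)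
      calc _ ≤ ‖γ r‖ * (5 * A * (‖γ r‖ * (1 + |Real.log ‖γ r‖|))) := by gcongr
        _ ≤ _ := by nlinarith [mul_nonneg hA h3]
  -- The bound on the logarithm is uniform in η, and η → 0 removes η from the lower bound. For the
  -- upper bound η = 1 suffices.
  have hlow : Real.exp (-N) ≤ ‖γ t‖ ^ 2 := by
    have hlim : Filter.Tendsto (fun η : ℝ => ‖γ t‖ ^ 2 + η ^ 2) (nhdsWithin 0 (Ioi 0))
        (nhds (‖γ t‖ ^ 2 + 0 ^ 2)) := by
      refine tendsto_nhdsWithin_of_tendsto_nhds ?_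
      exact Continuous.tendsto (by fun_prop) 0
    rw [zero_pow two_ne_zero, add_zero] at hlim
    refine ge_of_tendsto hlim ?_
    filter_upwards [Ioc_mem_nhdsGT (zero_lt_one' ℝ)] with η hη
    have h0 : 0 < ‖γ t‖ ^ 2 + η ^ 2 := by have := hη.1; positivity
    rw [← Real.le_log_iff_exp_le h0]
    linarith [neg_abs_le (Real.log (‖γ t‖ ^ 2 + η ^ 2)), key η hη]
  have hup : ‖γ t‖ ^ 2 ≤ Real.exp N := by
    have h1 := key 1 ⟨zero_lt_one, le_rfl⟩
    have h0 : 0 < ‖γ t‖ ^ 2 + 1 ^ 2 := by positivity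
    have h2 := (le_abs_self _).trans h1
    rw [Real.log_le_iff_le_exp h0] at h2
    linarith
  constructor
  · rw [← sq_le_sq₀ (by positivity) (norm_nonneg _), sq, ← Real.exp_add]
    rwa [show -N / 2 + -N / 2 = -N by ring]
  · rw [← sq_le_sq₀ (norm_nonneg _) (by positivity), sq (Real.exp _), ← Real.exp_add]
    rwa [show N / 2 + N / 2 = N by ring]

theorem exists_flow_bounds (h : VortexField A U) (T ρ P : ℝ) (hρ : 0 < ρ) :
    ∃ r R : ℝ, 0 < r ∧ ∀ δ, 0 < δ → ∀ e ∈ Icc (0 : ℝ) 1, ∀ s t, |t - s| ≤ T → ∀ y, ρ ≤ ‖y‖ →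
      ‖y‖ ≤ P → r ≤ ‖fieldFlow univ (cutField U δ e) s t y‖ ∧
        ‖fieldFlow univ (cutField U δ e) s t y‖ ≤ R := by
  obtain ⟨r, R, hr, H⟩ := exists_norm_bounds A T ρ P hρ
  refine ⟨r, R, hr, fun δ hδ e he s t hst y hy hyP => ?_⟩
  have hc := h.cutField_reg hδ
  have h1 := hc.flow_isSol he s y
  have h0 := hc.flow_self he s y
  exact H U h (kernMax δ) (inner_kernMax δ) e he _ (min s t) (max s t)
    (by rwa [max_sub_min_eq_abs]) (fun r _ => (h1 r).2.hasDerivWithinAt) s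
    ⟨min_le_left _ _, le_max_left _ _⟩ (by rw [h0]; exact hy) (by rw [h0]; exact hyP) t
    ⟨min_le_right _ _, le_max_right _ _⟩

/-- On a compact interval both trajectories stay at positive distance from the origin, hence solve
the same cut-off equation, whose solutions are unique. -/
theorem uniqueSol (h : VortexField A U) : UniqueSol {0}ᶜ (vortexDrift U) := by
  intro u v γ γ' hγ hγ' s hs hss t ht
  have low : ∀ γ : ℝ → Plane, IsSolOn {0}ᶜ (vortexDrift U) (Icc u v) γ →
      ∃ δ, 0 < δ ∧ ∀ r ∈ Icc u v, δ ≤ ‖γ r‖ := by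
    intro γ hγ
    have hcont : ContinuousOn (fun r => ‖γ r‖) (Icc u v) :=
      ContinuousOn.norm fun r hr => (hγ r hr).2.continuousWithinAt
    obtain ⟨r₀, hr₀, hmin⟩ := isCompact_Icc.exists_isMinOn ⟨s, hs⟩ hcont
    exact ⟨‖γ r₀‖, norm_pos_iff.2 (hγ r₀ hr₀).1, fun r hr => hmin hr⟩
  obtain ⟨δ, hδ, h1⟩ := low γ hγ
  obtain ⟨δ', hδ', h2⟩ := low γ' hγ'
  have hm : 0 < min δ δ' := lt_min hδ hδ'
  refine (h.cutField_reg hm).unique (e := 0) (by simp) (fun r hr => ?_) (fun r hr => ?_) hs hss ht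
  · rw [cutField, kernMax_eq ((min_le_left _ _).trans (h1 r hr))]
    exact (hγ r hr).2
  · rw [cutField, kernMax_eq ((min_le_right _ _).trans (h2 r hr))]
    exact (hγ' r hr).2

/-- The cut-off radius is the lower bound `r` that holds for all cut-offs, so the cut-off trajectory
never meets the region where the kernel was changed. -/
theorem exists_isSol (h : VortexField A U) (s : ℝ) {y : Plane} (hy : y ≠ 0) :
    ∃ γ : ℝ → Plane, γ s = y ∧ IsSol {0}ᶜ (vortexDrift U) γ := by
  refine exists_isSol_of_local h.uniqueSol fun n => ?_
  obtain ⟨r, R, hr, H⟩ := h.exists_flow_bounds n ‖y‖ ‖y‖ (norm_pos_iff.2 hy)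
  have hc := h.cutField_reg hr
  refine ⟨fun t => fieldFlow univ (cutField U r 0) s t y, hc.flow_self (by simp) s y,
    fun t ht => ?_⟩
  have h1 := (H r hr 0 (by simp) s t (by
    rw [abs_le]; constructor <;> linarith [ht.1, ht.2]) y le_rfl le_rfl).1
  refine ⟨norm_pos_iff.1 (hr.trans_le h1), ?_⟩
  have h2 := (hc.flow_isSol (e := 0) (by simp) s y t).2
  rw [cutField, kernMax_eq h1] at h2
  exact h2.hasDerivWithinAt

theorem flow_self (h : VortexField A U) (s : ℝ) {y : Plane} (hy : y ≠ 0) :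
    vortexFlow U s s y = y :=
  (fieldFlow_spec (h.exists_isSol s hy)).1

theorem flow_isSol (h : VortexField A U) (s : ℝ) {y : Plane} (hy : y ≠ 0) :
    IsSol {0}ᶜ (vortexDrift U) fun t => vortexFlow U s t y :=
  (fieldFlow_spec (h.exists_isSol s hy)).2

theorem flow_ne_zero (h : VortexField A U) (s t : ℝ) {y : Plane} (hy : y ≠ 0) :
    vortexFlow U s t y ≠ 0 :=
  (h.flow_isSol s hy t).1

theorem flow_comp (h : VortexField A U) (s t r : ℝ) {y : Plane} (hy : y ≠ 0) :
    vortexFlow U t r (vortexFlow U s t y) = vortexFlow U s r y :=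
  fieldFlow_comp h.uniqueSol (h.exists_isSol s hy) t r

theorem flow_unique (h : VortexField A U) {s u v : ℝ} {γ : ℝ → Plane}
    (hγ : IsSolOn {0}ᶜ (vortexDrift U) (Icc u v) γ) (hs : s ∈ Icc u v) {t : ℝ}
    (ht : t ∈ Icc u v) : γ t = vortexFlow U s t (γ s) :=
  fieldFlow_unique h.uniqueSol (h.exists_isSol s (hγ s hs).1) hγ hs rfl ht

theorem flow_eq_cut (h : VortexField A U) {δ s t : ℝ} (hδ : 0 < δ) {y : Plane}
    (hlow : ∀ r ∈ Icc (min s t) (max s t), δ ≤ ‖fieldFlow univ (cutField U δ 0) s r y‖) :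
    vortexFlow U s t y = fieldFlow univ (cutField U δ 0) s t y := by
  have hc := h.cutField_reg hδ
  have h1 : IsSolOn {0}ᶜ (vortexDrift U) (Icc (min s t) (max s t))
      fun t => fieldFlow univ (cutField U δ 0) s t y := by
    intro r hr
    refine ⟨norm_pos_iff.1 (hδ.trans_le (hlow r hr)), ?_⟩
    have h2 := (hc.flow_isSol (e := 0) (by simp) s y r).2
    rw [cutField, kernMax_eq (hlow r hr)] at h2
    exact h2.hasDerivWithinAt
  have := h.flow_unique h1 (s := s) ⟨min_le_left _ _, le_max_left _ _⟩ (t := t)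
    ⟨min_le_right _ _, le_max_right _ _⟩
  rw [hc.flow_self (by simp)] at this
  exact this.symm

theorem exists_cut_radius (h : VortexField A U) (T ρ P : ℝ) (hρ : 0 < ρ) :
    ∃ r R : ℝ, 0 < r ∧ ∀ s t, |t - s| ≤ T → ∀ y, ρ ≤ ‖y‖ → ‖y‖ ≤ P →
      (r ≤ ‖vortexFlow U s t y‖ ∧ ‖vortexFlow U s t y‖ ≤ R) ∧
      (∀ δ, 0 < δ → δ ≤ r → vortexFlow U s t y = fieldFlow univ (cutField U δ 0) s t y) ∧
      ∀ δ, 0 < δ → ∀ e ∈ Icc (0 : ℝ) 1, r ≤ ‖fieldFlow univ (cutField U δ e) s t y‖ ∧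
        ‖fieldFlow univ (cutField U δ e) s t y‖ ≤ R := by
  obtain ⟨r, R, hr, H⟩ := h.exists_flow_bounds T ρ P hρ
  refine ⟨r, R, hr, fun s t hst y hy hyP => ?_⟩
  have h1 : ∀ δ, 0 < δ → δ ≤ r →
      vortexFlow U s t y = fieldFlow univ (cutField U δ 0) s t y := by
    intro δ hδ hδr
    refine h.flow_eq_cut hδ fun q hq => hδr.trans ?_
    refine (H δ hδ 0 (by simp) s q (le_trans ?_ hst) y hy hyP).1
    rw [← max_sub_min_eq_abs s t, abs_le]
    have h1 : min s t ≤ s := min_le_left _ _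
    have h2 : s ≤ max s t := le_max_left _ _
    constructor <;> linarith [hq.1, hq.2]
  refine ⟨?_, h1, fun δ hδ e he => H δ hδ e he s t hst y hy hyP⟩
  rw [h1 r hr le_rfl]
  exact H r hr 0 (by simp) s t hst y hy hyP

/-- Near a given point with y ≠ 0 the flow coincides with that of a single cut-off field, which is
continuous. -/
theorem continuousOn_flow (h : VortexField A U) :
    ContinuousOn (fun p : ℝ × ℝ × Plane => vortexFlow U p.1 p.2.1 p.2.2) {p | p.2.2 ≠ 0} := by
  rintro ⟨s₀, t₀, y₀⟩ hy₀
  have hy₀' : 0 < ‖y₀‖ := norm_pos_iff.2 hy₀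
  obtain ⟨r, R, hr, H⟩ := h.exists_cut_radius (|t₀ - s₀| + 1) (‖y₀‖ / 2) (‖y₀‖ + 1) (half_pos hy₀')
  have hc := (h.cutField_reg hr).continuous_flow (e := 0) (by simp)
  refine ContinuousAt.continuousWithinAt (hc.continuousAt.congr ?_)
  have h1 : ∀ᶠ p : ℝ × ℝ × Plane in nhds (s₀, t₀, y₀), |p.2.1 - p.1| < |t₀ - s₀| + 1 :=
    (isOpen_lt (by fun_prop) continuous_const).mem_nhds (by simp)
  have h2 : ∀ᶠ p : ℝ × ℝ × Plane in nhds (s₀, t₀, y₀), ‖p.2.2‖ < ‖y₀‖ + 1 :=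
    (isOpen_lt (by fun_prop) continuous_const).mem_nhds (by simp)
  have h3 : ∀ᶠ p : ℝ × ℝ × Plane in nhds (s₀, t₀, y₀), ‖y₀‖ / 2 < ‖p.2.2‖ :=
    (isOpen_lt continuous_const (by fun_prop)).mem_nhds (by simpa using hy₀)
  filter_upwards [h1, h2, h3] with p h1 h2 h3
  exact ((H p.1 p.2.1 h1.le p.2.2 h3.le h2.le).2.1 r hr le_rfl).symm

end VortexField

end VortexWave


namespace VortexWave

/-! ### Mollification of functions transported by a Lipschitz flow -/

open scoped Convolution in
/-- The mollification of `f` by a normalised bump function. -/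
noncomputable def mollify {E : Type*} [NormedAddCommGroup E] [NormedSpace ℝ E]
    [HasContDiffBump E] [MeasureSpace E] (φ : ContDiffBump (0 : E)) (f : E → ℝ) : E → ℝ :=
  φ.normed volume ⋆[ContinuousLinearMap.lsmul ℝ ℝ, volume] f

theorem mollify_apply {E : Type*} [NormedAddCommGroup E] [NormedSpace ℝ E]
    [HasContDiffBump E] [MeasureSpace E] (φ : ContDiffBump (0 : E)) (f : E → ℝ) (p : E) :
    mollify φ f p = ∫ u, φ.normed volume u * f (p - u) := rfl

instance : (volume : Measure (ℝ × Plane)).IsAddHaarMeasure :=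
  inferInstanceAs ((volume : Measure ℝ).prod (volume : Measure Plane)).IsAddHaarMeasure

section Mollify

variable {E : Type*} [NormedAddCommGroup E] [NormedSpace ℝ E] [FiniteDimensional ℝ E]
  [HasContDiffBump E] [MeasureSpace E] [BorelSpace E] [(volume : Measure E).IsAddHaarMeasure]

theorem contDiff_mollify (φ : ContDiffBump (0 : E)) {f : E → ℝ} (hf : Continuous f) :
    ContDiff ℝ (⊤ : ℕ∞) (mollify φ f) :=
  φ.hasCompactSupport_normed.contDiff_convolution_left _ φ.contDiff_normed hf.locallyIntegrable

theorem normed_eq_zero (φ : ContDiffBump (0 : E)) {u : E} (hu : ¬‖u‖ < φ.rOut) :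
    φ.normed volume u = 0 := by
  have h : u ∉ Function.support (φ.normed (volume : Measure E)) := by
    rw [φ.support_normed_eq]
    simpa using hu
  exact Function.notMem_support.1 h

theorem integrable_mollify (φ : ContDiffBump (0 : E)) {f : E → ℝ} (hf : Continuous f) (p : E) :
    Integrable fun u => φ.normed volume u * f (p - u) :=
  (φ.continuous_normed.mul (hf.comp (continuous_const.sub continuous_id))).integrable_of_hasCompactSupport
    φ.hasCompactSupport_normed.mul_right

theorem abs_mollify_sub_le (φ : ContDiffBump (0 : E)) {f g : E → ℝ} (hf : Continuous f)
    (hg : Continuous g) {p q : E} {B : ℝ}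
    (h : ∀ u, ‖u‖ < φ.rOut → |f (p - u) - g (q - u)| ≤ B) :
    |mollify φ f p - mollify φ g q| ≤ B := by
  rw [mollify_apply, mollify_apply, ← integral_sub (integrable_mollify φ hf p)
    (integrable_mollify φ hg q), ← Real.norm_eq_abs]
  have h1 : Integrable fun u : E => φ.normed volume u * B := φ.integrable_normed.mul_const B
  refine (norm_integral_le_of_norm_le h1 (.of_forall fun u => ?_)).trans ?_
  · rw [← mul_sub, norm_mul, Real.norm_eq_abs, Real.norm_eq_abs, abs_of_nonneg (φ.nonneg_normed u)]
    by_cases hu : ‖u‖ < φ.rOut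
    · exact mul_le_mul_of_nonneg_left (h u hu) (φ.nonneg_normed u)
    · simp [normed_eq_zero φ hu]
  · rw [integral_mul_const, φ.integral_normed, one_mul]

theorem mollify_const (φ : ContDiffBump (0 : E)) (c : ℝ) (p : E) :
    mollify φ (fun _ => c) p = c := by
  rw [mollify_apply, integral_mul_const, φ.integral_normed, one_mul]

theorem abs_mollify_sub_self_le (φ : ContDiffBump (0 : E)) {f : E → ℝ} (hf : Continuous f)
    {p : E} {B : ℝ} (h : ∀ q, dist q p < φ.rOut → |f q - f p| ≤ B) :
    |mollify φ f p - f p| ≤ B := by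
  rw [← mollify_const φ (f p) p]
  refine abs_mollify_sub_le φ hf continuous_const fun u hu => h _ ?_
  simpa [dist_eq_norm] using hu

theorem mollify_eq_zero (φ : ContDiffBump (0 : E)) {f : E → ℝ} {p : E}
    (h : ∀ q, dist q p < φ.rOut → f q = 0) : mollify φ f p = 0 := by
  rw [mollify_apply]
  refine integral_eq_zero_of_ae (.of_forall fun u => ?_)
  by_cases hu : ‖u‖ < φ.rOut
  · simp [h (p - u) (by simpa [dist_eq_norm] using hu)]
  · simp [normed_eq_zero φ hu]

end Mollify

/-- This replaces a commutator estimate. Since ψ is constant along trajectories of b, a shift by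
s(1, w) changes ψ only through the gap between the trajectory and the straight segment, at most
m|s|; the Lipschitz constant then gives Lm|s|. No derivative of ψ is needed. -/
theorem abs_fderiv_mollify_le {ψ : ℝ × Plane → ℝ} (hψ : Continuous ψ) {b : ℝ → Plane → Plane}
    {M L m : ℝ} (hb : ∀ t x, ‖b t x‖ ≤ M) (hL : 0 ≤ L)
    (hflow : ∀ t x, ∃ γ : ℝ → Plane, γ t = x ∧ (∀ s, HasDerivAt γ (b s (γ s)) s) ∧
      ∀ s, ψ (s, γ s) = ψ (t, x))
    (φ : ContDiffBump (0 : ℝ × Plane)) {t : ℝ} {x w : Plane}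
    (hlip : ∀ t', |t' - t| ≤ 2 * φ.rOut → ∀ x y, |ψ (t', x) - ψ (t', y)| ≤ L * ‖x - y‖)
    (hw : ∀ t' x', |t' - t| ≤ 2 * φ.rOut → ‖x' - x‖ ≤ 2 * φ.rOut → ‖b t' x' - w‖ ≤ m) :
    |fderiv ℝ (mollify φ ψ) (t, x) (1, w)| ≤ L * m := by
  have hη := φ.rOut_pos
  have hM : 0 ≤ M := (norm_nonneg _).trans (hb 0 0)
  have hm : 0 ≤ m := (norm_nonneg _).trans (hw t x (by simp [hη.le]) (by simp [hη.le]))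
  have hd : HasDerivAt (fun s : ℝ => mollify φ ψ ((t, x) + s • ((1 : ℝ), w)))
      (fderiv ℝ (mollify φ ψ) (t, x) (1, w)) 0 := by
    have h1 : HasFDerivAt (mollify φ ψ) (fderiv ℝ (mollify φ ψ) (t, x))
        ((t, x) + (0 : ℝ) • ((1 : ℝ), w)) := by
      rw [zero_smul, add_zero]
      exact ((contDiff_mollify φ hψ).differentiable (by simp) _).hasFDerivAt
    have h2 : HasDerivAt (fun s : ℝ => (t, x) + s • ((1 : ℝ), w)) ((1 : ℝ), w) 0 := by
      simpa using ((hasDerivAt_id (0 : ℝ)).smul_const ((1 : ℝ), w)).const_add (t, x)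
    exact h1.comp_hasDerivAt 0 h2
  rw [← Real.norm_eq_abs]
  refine hd.le_of_lip' (mul_nonneg hL hm) ?_
  have hev : ∀ᶠ s : ℝ in nhds 0, |s| * (1 + M) < φ.rOut :=
    (isOpen_lt (by fun_prop) continuous_const).mem_nhds (by simpa using hη)
  filter_upwards [hev] with s hs
  rw [zero_smul, add_zero, sub_zero, Real.norm_eq_abs, Real.norm_eq_abs]
  refine abs_mollify_sub_le φ hψ hψ fun u hu => ?_
  obtain ⟨t₀, x₀⟩ := u
  have hu1 : |t₀| < φ.rOut := (norm_fst_le (t₀, x₀)).trans_lt hu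
  have hu2 : ‖x₀‖ < φ.rOut := (norm_snd_le (t₀, x₀)).trans_lt hu
  have e1 : (t, x) + s • ((1 : ℝ), w) - (t₀, x₀) = (t - t₀ + s, x - x₀ + s • w) := by
    ext1 <;> simp <;> abel
  have e2 : (t, x) - (t₀, x₀) = (t - t₀, x - x₀) := rfl
  rw [e1, e2]
  -- The value of ψ at the unshifted point is moved along its trajectory to the time of the shifted
  -- point, so that two points at the same time are compared.
  obtain ⟨γ, hγ0, hγ, hγψ⟩ := hflow (t - t₀) (x - x₀)
  rw [← hγψ (t - t₀ + s)]
  have hs' : |s| < φ.rOut := by nlinarith [abs_nonneg s]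
  have hsM : M * |s| < φ.rOut := by nlinarith [abs_nonneg s]
  refine (hlip _ ?_ _ _).trans ?_
  · calc |t - t₀ + s - t| = |s - t₀| := by congr 1; ring
      _ ≤ |s| + |t₀| := abs_sub _ _
      _ ≤ _ := by linarith
  rw [mul_assoc]
  refine mul_le_mul_of_nonneg_left ?_ hL
  have hbd : ∀ r, |r - (t - t₀)| ≤ |s| → ‖γ r - (x - x₀)‖ ≤ M * |s| := by
    intro r hr
    have := Convex.norm_image_sub_le_of_norm_hasDerivWithin_le
      (fun q _ => (hγ q).hasDerivWithinAt) (fun q _ => hb q (γ q)) convex_univ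
      (mem_univ (t - t₀)) (mem_univ r)
    rw [hγ0] at this
    exact this.trans (by rw [Real.norm_eq_abs]; gcongr)
  -- The mean value inequality for γ(r) − r w, whose derivative b − w is at most m near (t, x).
  have hmv := Convex.norm_image_sub_le_of_norm_hasDerivWithin_le (C := m)
    (s := uIcc (t - t₀) (t - t₀ + s)) (f := fun r => γ r - r • w)
    (f' := fun r => b r (γ r) - (1 : ℝ) • w) (x := t - t₀) (y := t - t₀ + s)
    (fun r _ => ((hγ r).sub ((hasDerivAt_id r).smul_const w)).hasDerivWithinAt)
    (fun r hr => ?_) (convex_uIcc _ _) left_mem_uIcc right_mem_uIcc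
  · rw [hγ0] at hmv
    have e3 : γ (t - t₀ + s) - (t - t₀ + s) • w - (x - x₀ - (t - t₀) • w) =
        -(x - x₀ + s • w - γ (t - t₀ + s)) := by module
    rw [e3, norm_neg] at hmv
    simpa using hmv
  · have hr' : |r - (t - t₀)| ≤ |s| := by
      have := abs_sub_left_of_mem_uIcc hr
      simpa using this
    rw [one_smul]
    refine hw _ _ ?_ ?_
    · calc |r - t| = |r - (t - t₀) - t₀| := by congr 1; ring
        _ ≤ |r - (t - t₀)| + |t₀| := abs_sub _ _
        _ ≤ _ := by linarith
    · calc ‖γ r - x‖ = ‖(γ r - (x - x₀)) - x₀‖ := by congr 1; abel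
        _ ≤ ‖γ r - (x - x₀)‖ + ‖x₀‖ := norm_sub_le _ _
        _ ≤ _ := by linarith [hbd r hr']

end VortexWave


namespace VortexWave

/-! ### Smooth approximation of transported functions -/

theorem exists_contDiffBump {E : Type*} [NormedAddCommGroup E] [NormedSpace ℝ E]
    [HasContDiffBump E] {η : ℝ} (hη : 0 < η) : ∃ φ : ContDiffBump (0 : E), φ.rOut = η :=
  ⟨⟨η / 2, η, half_pos hη, half_lt_self hη⟩, rfl⟩

theorem exists_lipschitz_approx {Ψ : Plane → ℝ} (hΨ : Continuous Ψ) {c : Plane} {ρ P θ : ℝ}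
    (hρ : 0 < ρ) (hθ : 0 < θ) (hsupp : ∀ x, Ψ x ≠ 0 → ρ ≤ ‖x - c‖ ∧ ‖x - c‖ ≤ P) :
    ∃ (Ψ' : Plane → ℝ) (L : ℝ), 0 ≤ L ∧ (∀ x y, |Ψ' x - Ψ' y| ≤ L * ‖x - y‖) ∧
      (∀ x, |Ψ' x - Ψ x| ≤ θ) ∧ ∀ x, Ψ' x ≠ 0 → ρ / 2 ≤ ‖x - c‖ ∧ ‖x - c‖ ≤ P + 1 := by
  have hcs : HasCompactSupport Ψ := by
    refine HasCompactSupport.intro (isCompact_closedBall c P) fun x hx => ?_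
    by_contra hne
    exact hx (by simpa [dist_eq_norm] using (hsupp x hne).2)
  have huc := hcs.uniformContinuous_of_continuous hΨ
  obtain ⟨η, hη, hη'⟩ := Metric.uniformContinuous_iff.1 huc θ hθ
  obtain ⟨φ, hφ⟩ := exists_contDiffBump (E := Plane) (η := min η (min (ρ / 2) 1)) (by positivity)
  have h1 : φ.rOut ≤ η := hφ ▸ min_le_left _ _
  have h2 : φ.rOut ≤ ρ / 2 := hφ ▸ (min_le_right _ _).trans (min_le_left _ _)
  have h3 : φ.rOut ≤ 1 := hφ ▸ (min_le_right _ _).trans (min_le_right _ _)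
  have hs : ∀ x, mollify φ Ψ x ≠ 0 → ρ / 2 ≤ ‖x - c‖ ∧ ‖x - c‖ ≤ P + 1 := by
    intro x hx
    by_contra hcon
    refine hx (mollify_eq_zero φ fun q hq => ?_)
    by_contra hne
    obtain ⟨h4, h5⟩ := hsupp q hne
    rw [dist_eq_norm] at hq
    refine hcon ⟨?_, ?_⟩
    · have := norm_add_le (q - x) (x - c)
      rw [sub_add_sub_cancel] at this
      linarith
    · have := norm_sub_le (q - c) (q - x)
      rw [sub_sub_sub_cancel_left] at this
      linarith
  have hcs' : HasCompactSupport (mollify φ Ψ) := by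
    refine HasCompactSupport.intro (isCompact_closedBall c (P + 1)) fun x hx => ?_
    by_contra hne
    exact hx (by simpa [dist_eq_norm] using (hs x hne).2)
  obtain ⟨L, hL⟩ := ContDiff.lipschitzWith_of_hasCompactSupport hcs'
    (contDiff_mollify φ hΨ) (by simp)
  refine ⟨mollify φ Ψ, L, L.2, fun x y => ?_, fun x => ?_, hs⟩
  · simpa [dist_eq_norm] using hL.dist_le_mul x y
  · refine abs_mollify_sub_self_le φ hΨ fun q hq => ?_
    have := hη' (hq.trans_le h1)
    rw [Real.dist_eq] at this
    exact this.le

/-- A vortex field together with the `C¹` motion `ζ` of the vortex. -/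
structure Frame (A : ℝ) (U : ℝ → ℝ → Plane → Plane) (ζ ζ' : ℝ → Plane) : Prop where
  field : VortexField A U
  continuous_deriv : Continuous ζ'
  norm_deriv_le : ∀ t, ‖ζ' t‖ ≤ A
  hasDerivAt : ∀ t, HasDerivAt ζ (ζ' t) t

/-- The drift in the frame at rest. -/
noncomputable def fullDrift (U : ℝ → ℝ → Plane → Plane) (ζ ζ' : ℝ → Plane) (t : ℝ) (x : Plane) :
    Plane :=
  ζ' t + vortexDrift U t (x - ζ t)

/-- The flow in the frame at rest. -/
noncomputable def fullFlow (U : ℝ → ℝ → Plane → Plane) (ζ : ℝ → Plane) (s t : ℝ) (x : Plane) :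
    Plane :=
  ζ t + vortexFlow U s t (x - ζ s)

/-- No trajectory in the punctured plane passes through 0, so the default value of `fieldFlow`
applies. This convention makes the flow a bijection of the whole plane. -/
theorem vortexFlow_zero (U : ℝ → ℝ → Plane → Plane) (s t : ℝ) : vortexFlow U s t 0 = 0 := by
  rw [vortexFlow, fieldFlow, dif_neg]
  rintro ⟨γ, h1, h2⟩
  exact (h2 s).1 h1

namespace Frame

variable {A : ℝ} {U : ℝ → ℝ → Plane → Plane} {ζ ζ' : ℝ → Plane}

theorem norm_sub_le (h : Frame A U ζ ζ') (s t : ℝ) : ‖ζ t - ζ s‖ ≤ A * |t - s| :=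
  Convex.norm_image_sub_le_of_norm_hasDerivWithin_le
    (fun q _ => (h.hasDerivAt q).hasDerivWithinAt) (fun q _ => h.norm_deriv_le q) convex_univ
    (mem_univ s) (mem_univ t)

theorem continuous (h : Frame A U ζ ζ') : Continuous ζ :=
  continuous_iff_continuousAt.2 fun t => (h.hasDerivAt t).continuousAt

/-- The length of the time steps. -/
noncomputable def step (A : ℝ) : ℝ := 1 / (4 * (A + 1))

theorem step_pos (h : Frame A U ζ ζ') : 0 < step A := by
  have := h.field.reg.nonneg
  unfold step; positivity

/-- If either side is nonzero, one of the two endpoints lies in the annulus supporting Ψ; running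
both flows back from there stays outside the cut-off ball, so they coincide. -/
theorem apply_flow_eq_cut (h : Frame A U ζ ζ') {T t ρ P r δ : ℝ} (hρ : 0 < ρ) (hδ : 0 < δ)
    (hδr : δ ≤ r) {Ψ : Plane → ℝ} (hsupp : ∀ y, Ψ y ≠ 0 → ρ ≤ ‖y‖ ∧ ‖y‖ ≤ P)
    (hr : ∀ y, ρ ≤ ‖y‖ → ‖y‖ ≤ P → ∀ δ, 0 < δ → δ ≤ r →
      vortexFlow U T t y = fieldFlow univ (cutField U δ 0) T t y) (y : Plane) :
    Ψ (vortexFlow U t T y) = Ψ (fieldFlow univ (cutField U δ 0) t T y) := by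
  have hc := h.field.cutField_reg hδ
  by_cases h1 : Ψ (fieldFlow univ (cutField U δ 0) t T y) = 0
  · rw [h1]
    by_contra h2
    obtain ⟨h3, h4⟩ := hsupp _ h2
    have hy : y ≠ 0 := by
      rintro rfl
      rw [vortexFlow_zero, norm_zero] at h3
      exact absurd h3 (not_le.2 hρ)
    have h5 := hr _ h3 h4 δ hδ hδr
    rw [h.field.flow_comp t T t hy, h.field.flow_self t hy] at h5
    rw [h5, hc.flow_comp (by simp), hc.flow_self (by simp)] at h1
    exact h2 h1
  · obtain ⟨h3, h4⟩ := hsupp _ h1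
    have h5 := hr _ h3 h4 δ hδ hδr
    rw [hc.flow_comp (by simp), hc.flow_self (by simp)] at h5
    set p := fieldFlow univ (cutField U δ 0) t T y
    have hp : p ≠ 0 := norm_pos_iff.1 (hρ.trans_le h3)
    rw [← h5, h.field.flow_comp T t T hp, h.field.flow_self T hp]

/-- Take Ψ composed with the cut-off flow at scale e, then mollify. Its Lipschitz constant is at
most a constant times e^(−1/2) on short windows, while the field is known up to (A + 1)e, so the
transport derivative is O(e^(1/2)). The radius `R` is fixed before Ψ, which later lets Ψ be
approximated without losing control of supports. -/
theorem exists_smooth_approx_of_lipschitz (h : Frame A U ζ ζ') {T ρ P : ℝ} (hρ : 0 < ρ) :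
    ∃ R : ℝ, ∀ (Ψ : Plane → ℝ) (L₀ : ℝ), 0 ≤ L₀ → (∀ x y, |Ψ x - Ψ y| ≤ L₀ * ‖x - y‖) →
      (∀ y, Ψ y ≠ 0 → ρ ≤ ‖y‖ ∧ ‖y‖ ≤ P) → ∀ θ : ℝ, 0 < θ →
      ∃ ψ : ℝ × Plane → ℝ, ContDiff ℝ (⊤ : ℕ∞) ψ ∧ ∀ t, |t - T| ≤ step A → ∀ x,
        (R < ‖x‖ → ψ (t, x) = 0 ∧ fderiv ℝ ψ (t, x) = 0) ∧
        |ψ (t, x) - Ψ (vortexFlow U t T (x - ζ t))| ≤ θ ∧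
        |fderiv ℝ ψ (t, x) (1, fullDrift U ζ ζ' t x)| ≤ θ := by
  have hA := h.field.reg.nonneg
  set τ := step A with hτ
  have hτ0 : 0 < τ := h.step_pos
  -- This choice of τ turns exp(2τA log(1/e)) into at most e^(−1/2).
  have hτA : 4 * τ * A ≤ 1 := by
    rw [hτ, step]
    have : 4 * (1 / (4 * (A + 1))) * A = A / (A + 1) := by field_simp
    rw [this, div_le_one (by positivity)]
    linarith
  obtain ⟨r, R₀, hr, H⟩ := h.field.exists_cut_radius (3 * τ) ρ P hρ
  set δ := r / 2 with hδ
  have hδ0 : 0 < δ := half_pos hr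
  have hδr : δ ≤ r := by linarith
  have hc := h.field.cutField_reg hδ0
  set R := ‖ζ T‖ + R₀ + A * (3 * τ) + 1 with hR
  refine ⟨R, fun Ψ L₀ hL₀ hLip hsupp θ hθ => ?_⟩
  -- choice of the regularisation parameter
  set K := A + 1 / δ ^ 2 with hK
  have hK0 : 0 ≤ K := by positivity
  set C := L₀ * Real.exp (K * (2 * τ)) * (A + 1) with hC
  have hC0 : 0 ≤ C := by positivity
  obtain ⟨κ, hκ0, hκ1, hκ⟩ := hc.exists_flow_close (3 * τ) (θ / (2 * (L₀ + 1))) (by positivity)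
  -- `q` is the square root of e. The bound q ≤ κ makes the flows at scales e and 0 close; C q ≤ θ
  -- bounds the transport error.
  obtain ⟨q, hq0, hq1, hqκ, hqC⟩ : ∃ q : ℝ, 0 < q ∧ q ≤ 1 ∧ q ≤ κ ∧ C * q ≤ θ := by
    refine ⟨min 1 (min κ (θ / (C + 1))), by positivity, min_le_left _ _,
      (min_le_right _ _).trans (min_le_left _ _), ?_⟩
    calc C * min 1 (min κ (θ / (C + 1))) ≤ (C + 1) * (θ / (C + 1)) := by
          gcongr
          · linarith
          · exact (min_le_right _ _).trans (min_le_right _ _)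
      _ = θ := by field_simp
  set e := q ^ 2 with he
  have he0 : 0 < e := by positivity
  have he1 : e ≤ 1 := pow_le_one₀ hq0.le hq1
  have heI : e ∈ Icc (0 : ℝ) 1 := ⟨he0.le, he1⟩
  have heq : e ≤ q := by rw [he, sq]; nlinarith
  have hlog : 0 ≤ Real.log (1 / e) := Real.log_nonneg (by rw [le_div_iff₀ he0]; linarith)
  set Λ := A * (1 + Real.log (1 / e)) + 1 / δ ^ 2 with hΛ
  have hΛ0 : 0 ≤ Λ := by positivity
  have hlipc : ∀ t x y, ‖cutField U δ e t x - cutField U δ e t y‖ ≤ Λ * ‖x - y‖ := by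
    intro t x y
    rw [cutField, cutField, add_sub_add_comm, hΛ, add_mul]
    exact (norm_add_le _ _).trans (add_le_add (h.field.reg.lip e ⟨he0, he1⟩ t x y)
      (norm_kernMax_sub_le hδ0 x y))
  set L := L₀ * Real.exp (Λ * (2 * τ)) with hL
  have hL0 : 0 ≤ L := by positivity
  -- The exponent splits into a part free of e and 2τA log(1/e); the latter costs at most 1/q,
  -- against e = q².
  have hLe : L * ((A + 1) * e) ≤ θ := by
    have h1 : Λ * (2 * τ) = K * (2 * τ) + 2 * τ * A * Real.log (1 / e) := by rw [hΛ, hK]; ring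
    have h2 : Real.log (1 / e) = 2 * Real.log q⁻¹ := by
      rw [one_div, he, ← inv_pow, Real.log_pow]; norm_num
    have h3 : 0 ≤ Real.log q⁻¹ := Real.log_nonneg (one_le_inv_iff₀.2 ⟨hq0, hq1⟩)
    have h4 : Real.exp (2 * τ * A * Real.log (1 / e)) ≤ q⁻¹ := by
      rw [← Real.le_log_iff_exp_le (by positivity), h2]
      nlinarith
    calc L * ((A + 1) * e) = L₀ * Real.exp (K * (2 * τ)) * (A + 1) *
          (Real.exp (2 * τ * A * Real.log (1 / e)) * e) := by
            rw [hL, h1, Real.exp_add]; ring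
      _ ≤ C * (q⁻¹ * e) := by rw [hC]; gcongr
      _ = C * q := by rw [he]; field_simp
      _ ≤ θ := hqC
  -- the transported function
  set f : ℝ × Plane → ℝ := fun p => Ψ (fieldFlow univ (cutField U δ e) p.1 T (p.2 - ζ p.1)) with hf
  have hΨc : Continuous Ψ := by
    refine (LipschitzWith.of_dist_le_mul (K := L₀.toNNReal) fun x y => ?_).continuous
    rw [Real.dist_eq, dist_eq_norm, Real.coe_toNNReal _ hL₀]; exact hLip x y
  have hζ := h.continuous
  have hfc : Continuous f := by
    refine hΨc.comp ((hc.continuous_flow heI).comp (continuous_fst.prodMk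
      (continuous_const.prodMk (continuous_snd.sub (hζ.comp continuous_fst)))))
  set b : ℝ → Plane → Plane := fun t x => ζ' t + cutField U δ e t (x - ζ t) with hb
  have hbc : Continuous (Function.uncurry b) :=
    (h.continuous_deriv.comp continuous_fst).add ((hc.cont e heI).comp
      (continuous_fst.prodMk (continuous_snd.sub (hζ.comp continuous_fst))))
  have hbb : ∀ t x, ‖b t x‖ ≤ A + (A + 1 / δ + 1 / δ ^ 2) := fun t x =>
    (norm_add_le _ _).trans (add_le_add (h.norm_deriv_le t) (hc.bdd e heI _ _))
  have hbflow : ∀ t x, ∃ γ : ℝ → Plane, γ t = x ∧ (∀ s, HasDerivAt γ (b s (γ s)) s) ∧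
      ∀ s, f (s, γ s) = f (t, x) := by
    intro t x
    refine ⟨fun s => ζ s + fieldFlow univ (cutField U δ e) t s (x - ζ t), ?_, fun s => ?_,
      fun s => ?_⟩
    · simp [hc.flow_self heI]
    · have := (h.hasDerivAt s).add (hc.flow_isSol heI t (x - ζ t) s).2
      exact this.congr_deriv (by simp [hb])
    · simp only [hf, add_sub_cancel_left, hc.flow_comp heI]
  have hfsupp : ∀ t x, |t - T| ≤ 3 * τ → f (t, x) ≠ 0 → r ≤ ‖x - ζ t‖ ∧ ‖x‖ ≤ R - 1 := by
    intro t x ht hne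
    obtain ⟨h1, h2⟩ := hsupp _ hne
    have h3 := (H T t ht _ h1 h2).2.2 δ hδ0 e heI
    dsimp only at h3
    rw [hc.flow_comp heI, hc.flow_self heI] at h3
    refine ⟨h3.1, ?_⟩
    have h4 := h.norm_sub_le T t
    have h5 : A * |t - T| ≤ A * (3 * τ) := by gcongr
    calc ‖x‖ = ‖(x - ζ t) + (ζ t - ζ T) + ζ T‖ := by congr 1; abel
      _ ≤ ‖x - ζ t‖ + ‖ζ t - ζ T‖ + ‖ζ T‖ := norm_add₃_le
      _ ≤ _ := by rw [hR]; linarith [h3.2]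
  have hflip : ∀ t, |t - T| ≤ 2 * τ → ∀ x y, |f (t, x) - f (t, y)| ≤ L * ‖x - y‖ := by
    intro t ht x y
    refine (hLip _ _).trans ?_
    rw [hL, mul_assoc]
    refine mul_le_mul_of_nonneg_left ?_ hL₀
    refine (hc.lipschitz_flow heI hΛ0 hlipc t T _ _).trans ?_
    rw [sub_sub_sub_cancel_right, abs_sub_comm]
    gcongr
  -- choice of the mollification parameter
  set S : Set (ℝ × Plane) := Icc (T - τ) (T + τ) ×ˢ Metric.closedBall 0 R
  have hS : IsCompact S := isCompact_Icc.prod (isCompact_closedBall _ _)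
  obtain ⟨η₁, hη₁, H₁⟩ := Metric.mem_uniformity_dist.1
    (hS.uniformContinuousAt_of_continuousAt _ (fun p _ => hbc.continuousAt)
      (Metric.dist_mem_uniformity he0))
  obtain ⟨η₂, hη₂, H₂⟩ := Metric.mem_uniformity_dist.1
    (hS.uniformContinuousAt_of_continuousAt _ (fun p _ => hfc.continuousAt)
      (Metric.dist_mem_uniformity (half_pos hθ)))
  obtain ⟨φ, hφ⟩ := exists_contDiffBump (E := ℝ × Plane)
    (η := min (min (η₁ / 3) η₂) (min (min (τ / 2) (1 / 2)) (δ / (2 + 2 * A)))) (by positivity)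
  have hφ0 := φ.rOut_pos
  have g1 : φ.rOut ≤ η₁ / 3 := hφ ▸ (min_le_left _ _).trans (min_le_left _ _)
  have g2 : φ.rOut ≤ η₂ := hφ ▸ (min_le_left _ _).trans (min_le_right _ _)
  have g3 : φ.rOut ≤ τ / 2 :=
    hφ ▸ (min_le_right _ _).trans ((min_le_left _ _).trans (min_le_left _ _))
  have g4 : φ.rOut ≤ 1 / 2 :=
    hφ ▸ (min_le_right _ _).trans ((min_le_left _ _).trans (min_le_right _ _))
  have g5 : φ.rOut * (2 + 2 * A) ≤ δ := by
    rw [← le_div_iff₀ (by positivity)]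
    exact hφ ▸ (min_le_right _ _).trans (min_le_right _ _)
  refine ⟨mollify φ f, contDiff_mollify φ hfc, fun t ht x => ?_⟩
  have hclose : |f (t, x) - Ψ (vortexFlow U t T (x - ζ t))| ≤ θ / 2 := by
    rw [h.apply_flow_eq_cut (t := t) hρ hδ0 hδr hsupp
      (fun y hy hyP => (H T t (by linarith) y hy hyP).2.1)]
    refine (hLip _ _).trans ?_
    have h1 := hκ e heI 0 (by simp) (Or.inr (by linarith)) t T
      (by rw [abs_sub_comm]; linarith) (x - ζ t) (x - ζ t) (by simp [hκ0.le])
    calc _ ≤ (L₀ + 1) * (θ / (2 * (L₀ + 1))) := by gcongr; linarith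
      _ = θ / 2 := by field_simp
  -- Either (t, x) is within 2 rOut of the support of f, where the estimates apply, or the
  -- mollification vanishes near (t, x).
  by_cases hcase : ∃ t' x', |t' - t| ≤ 2 * φ.rOut ∧ ‖x' - x‖ ≤ 2 * φ.rOut ∧ f (t', x') ≠ 0
  · obtain ⟨t', x', ht', hx', hne⟩ := hcase
    have ht'T : |t' - T| ≤ 3 * τ := by
      have := abs_sub_le t' t T
      linarith
    obtain ⟨h1, h2⟩ := hfsupp t' x' ht'T hne
    have hxR : ‖x‖ ≤ R := by
      have := norm_sub_norm_le x x'
      rw [norm_sub_rev] at this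
      linarith
    have hmem : (t, x) ∈ S := by
      rw [abs_le] at ht
      exact ⟨⟨by linarith [ht.1], by linarith [ht.2]⟩, by simpa using hxR⟩
    -- The support of f stays at distance at least r = 2δ from the vortex, and the displacements of
    -- the point and of the vortex total at most (2 + 2A) rOut ≤ δ; here the cut-off kernel equals
    -- K.
    have hfar : δ ≤ ‖x - ζ t‖ := by
      have h3 := h.norm_sub_le t' t
      rw [abs_sub_comm] at h3
      have h4 : A * |t' - t| ≤ A * (2 * φ.rOut) := by gcongr
      have h5 : ‖x' - ζ t'‖ ≤ ‖x - ζ t‖ + ‖ζ t - ζ t'‖ + ‖x' - x‖ := by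
        calc ‖x' - ζ t'‖ = ‖(x - ζ t) + (ζ t - ζ t') + (x' - x)‖ := by congr 1; abel
          _ ≤ _ := norm_add₃_le
      linarith
    refine ⟨fun hlt => absurd hxR (not_le.2 hlt), ?_, ?_⟩
    · have h3 : |mollify φ f (t, x) - f (t, x)| ≤ θ / 2 := by
        refine abs_mollify_sub_self_le φ hfc fun p hp => ?_
        have := H₂ (a := (t, x)) (b := p) (by rw [dist_comm]; linarith) hmem
        rw [← Real.dist_eq, dist_comm]
        exact (show dist (f (t, x)) (f p) < θ / 2 from this).le
      have := abs_sub_le (mollify φ f (t, x)) (f (t, x)) (Ψ (vortexFlow U t T (x - ζ t)))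
      linarith
    · refine (abs_fderiv_mollify_le hfc hbb hL0 hbflow φ (m := (A + 1) * e) (fun t'' ht'' => ?_)
        (fun t'' x'' ht'' hx'' => ?_)).trans hLe
      · refine hflip t'' ?_
        have := abs_sub_le t'' t T
        linarith
      · have h3 : dist (b t x) (b t'' x'') < e := by
          refine H₁ (a := (t, x)) (b := (t'', x'')) ?_ hmem
          rw [dist_comm, Prod.dist_eq, Real.dist_eq, dist_eq_norm]
          exact (max_le ht'' hx'').trans_lt (by linarith)
        have h4 : ‖b t x - fullDrift U ζ ζ' t x‖ ≤ A * e := by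
          have : b t x - fullDrift U ζ ζ' t x = U e t (x - ζ t) - U 0 t (x - ζ t) := by
            simp only [hb, fullDrift, vortexDrift, cutField, kernMax_eq hfar]
            abel
          rw [this]
          exact h.field.reg.approx e ⟨he0, he1⟩ _ _
        rw [dist_comm, dist_eq_norm] at h3
        calc ‖b t'' x'' - fullDrift U ζ ζ' t x‖
            = ‖(b t'' x'' - b t x) + (b t x - fullDrift U ζ ζ' t x)‖ := by congr 1; abel
          _ ≤ _ := norm_add_le _ _
          _ ≤ (A + 1) * e := by linarith
  · push Not at hcase
    have hz : ∀ p : ℝ × Plane, dist p (t, x) < φ.rOut → mollify φ f p = 0 := by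
      intro p hp
      refine mollify_eq_zero φ fun p' hp' => ?_
      have hd : dist p' (t, x) ≤ 2 * φ.rOut := by
        linarith [dist_triangle p' p (t, x)]
      rw [Prod.dist_eq, max_le_iff, Real.dist_eq, dist_eq_norm] at hd
      exact hcase p'.1 p'.2 hd.1 hd.2
    have hev : mollify φ f =ᶠ[nhds (t, x)] fun _ => 0 := by
      filter_upwards [Metric.ball_mem_nhds (t, x) hφ0] with p hp using hz p hp
    have hd0 : fderiv ℝ (mollify φ f) (t, x) = 0 := by
      rw [hev.fderiv_eq]; simp
    have hf0 : f (t, x) = 0 := hcase t x (by simp [hφ0.le]) (by simp [hφ0.le])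
    rw [hev.eq_of_nhds, hd0]
    rw [hf0] at hclose
    exact ⟨fun _ => ⟨rfl, rfl⟩, hclose.trans (by linarith), by simp [hθ.le]⟩

end Frame

end VortexWave


namespace VortexWave

/-! ### Du Bois-Reymond lemmas on the half-line -/

/-- The primitive of g that vanishes to the right of its support is constant to the left of T, so it
is cut off there; only for t ≥ T does the derivative have to equal g. -/
theorem exists_primitive_cutoff {T τ : ℝ} (hτ : 0 < τ) {g : ℝ → ℝ} (hg : ContDiff ℝ (⊤ : ℕ∞) g)
    (hgs : tsupport g ⊆ Ioo T (T + τ / 2)) :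
    ∃ χ : ℝ → ℝ, ContDiff ℝ (⊤ : ℕ∞) χ ∧ HasCompactSupport χ ∧
      tsupport χ ⊆ Ioo (T - τ) (T + τ) ∧ ∀ t, T ≤ t → deriv χ t = g t := by
  have hgc : Continuous g := hg.continuous
  have hg0 : ∀ t, t ∉ Ioo T (T + τ / 2) → g t = 0 := fun t ht =>
    image_eq_zero_of_notMem_tsupport fun h => ht (hgs h)
  set G : ℝ → ℝ := fun t => ∫ s in (T + τ / 2)..t, g s with hG
  have hGd : ∀ t, HasDerivAt G (g t) t := fun t =>
    intervalIntegral.integral_hasDerivAt_right (hgc.intervalIntegrable _ _)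
      hgc.aestronglyMeasurable.stronglyMeasurableAtFilter hgc.continuousAt
  have hGs : ContDiff ℝ (⊤ : ℕ∞) G := by
    rw [contDiff_infty_iff_deriv]
    refine ⟨fun t => (hGd t).differentiableAt, ?_⟩
    rwa [show deriv G = g from funext fun t => (hGd t).deriv]
  set θ : ℝ → ℝ := fun t => Real.smoothTransition ((t - (T - τ / 2)) / (τ / 4)) with hθ
  have hθs : ContDiff ℝ (⊤ : ℕ∞) θ := by
    refine Real.smoothTransition.contDiff.comp ?_
    fun_prop
  have hθ1 : ∀ t, T - τ / 4 ≤ t → θ t = 1 := fun t ht =>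
    Real.smoothTransition.one_of_one_le (by rw [le_div_iff₀ (by positivity)]; linarith)
  have hθ0 : ∀ t, t ≤ T - τ / 2 → θ t = 0 := fun t ht =>
    Real.smoothTransition.zero_of_nonpos (div_nonpos_of_nonpos_of_nonneg (by linarith)
      (by positivity))
  have hGz : ∀ t, T + τ / 2 ≤ t → G t = 0 := by
    intro t ht
    refine intervalIntegral.integral_zero_ae (.of_forall fun s hs => hg0 s fun h => ?_)
    rw [uIoc_of_le ht] at hs
    linarith [hs.1, h.2]
  have hsub : tsupport (fun t => θ t * G t) ⊆ Icc (T - τ / 2) (T + τ / 2) := by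
    refine closure_minimal (fun t ht => ?_) isClosed_Icc
    by_contra hcon
    rw [mem_Icc, not_and_or, not_le, not_le] at hcon
    refine ht ?_
    rcases hcon with h | h
    · simp [hθ0 t h.le]
    · simp [hGz t h.le]
  refine ⟨fun t => θ t * G t, hθs.mul hGs, isCompact_Icc.of_isClosed_subset (isClosed_tsupport _)
    hsub, hsub.trans fun t ht => ⟨by linarith [ht.1], by linarith [ht.2]⟩, fun t ht => ?_⟩
  have hev : (fun t => θ t * G t) =ᶠ[nhds t] G := by
    filter_upwards [Ioi_mem_nhds (show T - τ / 4 < t by linarith)] with s hs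
    rw [hθ1 s (le_of_lt hs), one_mul]
  rw [hev.deriv_eq, (hGd t).deriv]

theorem locallyIntegrable_of_bounded {F : ℝ → ℝ} (hF : Measurable F)
    (hC : ∀ M : ℝ, ∃ B, ∀ t, |t| ≤ M → |F t| ≤ B) : LocallyIntegrable F := by
  intro t
  obtain ⟨B, hB⟩ := hC (|t| + 1)
  refine ⟨Metric.ball t 1, Metric.ball_mem_nhds t one_pos, ?_⟩
  refine Measure.integrableOn_of_bounded (M := B) measure_ball_lt_top.ne hF.aestronglyMeasurable
    ((ae_restrict_iff' measurableSet_ball).2 (.of_forall fun s hs => hB s ?_))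
  rw [Metric.mem_ball, Real.dist_eq] at hs
  have := abs_sub_abs_le_abs_sub s t
  linarith

/-- The identity is available only for test functions supported in short windows. One advances by
τ/2: F is already known to equal F₀ before T, so the derivative of the cut-off left of T is
harmless. The value χ(0) carries the initial condition. -/
theorem ae_eq_const_of_integral_deriv {F : ℝ → ℝ} {F₀ τ : ℝ} (hτ : 0 < τ) (hF : Measurable F)
    (hC : ∀ M : ℝ, ∃ B, ∀ t, |t| ≤ M → |F t| ≤ B)
    (h : ∀ T : ℝ, 0 ≤ T → ∀ χ : ℝ → ℝ, ContDiff ℝ (⊤ : ℕ∞) χ → HasCompactSupport χ →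
      tsupport χ ⊆ Ioo (T - τ) (T + τ) → -(χ 0 * F₀) = ∫ t in Ici (0 : ℝ), deriv χ t * F t) :
    ∀ᵐ t ∂(volume.restrict (Ici (0 : ℝ))), F t = F₀ := by
  have hFl := locallyIntegrable_of_bounded hF hC
  have hint : ∀ χ : ℝ → ℝ, ContDiff ℝ (⊤ : ℕ∞) χ → HasCompactSupport χ →
      Integrable (fun t => deriv χ t * F t) := by
    intro χ hχ hχc
    have hd := hχ.continuous_deriv (by simp)
    exact hFl.integrable_smul_left_of_hasCompactSupport hd hχc.deriv
  have hint' : ∀ χ : ℝ → ℝ, ContDiff ℝ (⊤ : ℕ∞) χ → HasCompactSupport χ →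
      Integrable (fun t => deriv χ t * F₀) := fun χ hχ hχc =>
    ((hχ.continuous_deriv (by simp)).integrable_of_hasCompactSupport hχc.deriv).mul_const _
  have h0 : ∀ T : ℝ, 0 ≤ T → ∀ χ : ℝ → ℝ, ContDiff ℝ (⊤ : ℕ∞) χ → HasCompactSupport χ →
      tsupport χ ⊆ Ioo (T - τ) (T + τ) → ∫ t in Ioi (0 : ℝ), deriv χ t * (F t - F₀) = 0 := by
    intro T hT χ hχ hχc hs
    simp_rw [mul_sub]
    rw [integral_sub (hint χ hχ hχc).integrableOn (hint' χ hχ hχc).integrableOn,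
      ← integral_Ici_eq_integral_Ioi, ← h T hT χ hχ hχc hs, integral_mul_const,
      HasCompactSupport.integral_Ioi_deriv_eq (hχ.of_le (by simp)) hχc]
    ring
  have key : ∀ k : ℕ, ∀ᵐ t : ℝ, t ∈ Ioo 0 (k * (τ / 2)) → F t = F₀ := by
    intro k
    induction k with
    | zero => simp
    | succ k ih =>
      set T := (k : ℝ) * (τ / 2) with hT
      have hT0 : 0 ≤ T := by positivity
      have hloc : LocallyIntegrable (fun t => F t - F₀) := by
        exact hFl.sub (locallyIntegrable_const _)
      have h1 := IsOpen.ae_eq_zero_of_integral_contDiff_smul_eq_zero (μ := volume)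
        (isOpen_Ioo (a := T) (b := T + τ / 2)) (hloc.locallyIntegrableOn _) (fun g hg _ hgs => ?_)
      · have hne : ∀ᵐ t : ℝ, t ≠ T := by simp [ae_iff]
        filter_upwards [ih, h1, hne] with t h2 h3 h4 h5
        rcases lt_or_gt_of_ne h4 with h6 | h6
        · exact h2 ⟨h5.1, h6⟩
        · refine sub_eq_zero.1 (h3 ⟨h6, ?_⟩)
          have := h5.2
          push_cast at this
          rw [hT]
          linarith
      · obtain ⟨χ, hχ, hχc, hχs, hχd⟩ := exists_primitive_cutoff hτ hg hgs
        have h2 := h0 T hT0 χ hχ hχc hχs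
        have h3 : ∫ t, g t • (F t - F₀) = ∫ t in Ioi (0 : ℝ), g t • (F t - F₀) := by
          refine (setIntegral_eq_integral_of_forall_compl_eq_zero fun t ht => ?_).symm
          have : g t = 0 := image_eq_zero_of_notMem_tsupport fun hmem =>
            ht (hT0.trans_lt (hgs hmem).1)
          simp [this]
        rw [h3]
        refine Eq.trans ?_ h2
        refine integral_congr_ae ((ae_restrict_iff' measurableSet_Ioi).2 ?_)
        -- For t < T both sides vanish because F = F₀; for t ≥ T the derivative of χ is g.
        filter_upwards [ih] with t h4 h5
        rcases lt_or_ge t T with h6 | h6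
        · rw [h4 ⟨h5, h6⟩]; simp
        · rw [hχd t h6, smul_eq_mul]
  have hall : ∀ᵐ t : ℝ, ∀ k : ℕ, t ∈ Ioo 0 (k * (τ / 2)) → F t = F₀ := ae_all_iff.2 key
  have hne : ∀ᵐ t : ℝ, t ≠ 0 := by simp [ae_iff]
  rw [ae_restrict_iff' measurableSet_Ici]
  filter_upwards [hall, hne] with t h1 h2 h3
  obtain ⟨k, hk⟩ := exists_nat_gt (t / (τ / 2))
  rw [div_lt_iff₀ (by positivity)] at hk
  exact h1 k ⟨lt_of_le_of_ne h3 h2.symm, hk⟩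

/-- Integration by parts by Fubini on s < t, since G is merely bounded and measurable. -/
theorem integral_deriv_mul_primitive {χ G : ℝ → ℝ} {C : ℝ} (hχ : ContDiff ℝ (⊤ : ℕ∞) χ)
    (hχc : HasCompactSupport χ) (hG : Measurable G) (hC : ∀ t, |G t| ≤ C) :
    ∫ t in Ici (0 : ℝ), deriv χ t * ∫ s in (0 : ℝ)..t, G s = -∫ t in Ici (0 : ℝ), χ t * G t := by
  have hχd : Continuous (deriv χ) := hχ.continuous_deriv (by simp)
  obtain ⟨M, hM⟩ : ∃ M : ℝ, ∀ t, M < t → deriv χ t = 0 ∧ χ t = 0 := by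
    obtain ⟨M, hM⟩ := hχc.isCompact.bddAbove
    refine ⟨M, fun t ht => ?_⟩
    have h1 : t ∉ tsupport χ := fun h => absurd (hM h) (not_le.2 ht)
    exact ⟨image_eq_zero_of_notMem_tsupport fun h => h1 (tsupport_deriv_subset h),
      image_eq_zero_of_notMem_tsupport h1⟩
  set μ := (volume : Measure ℝ).restrict (Ioc 0 M) with hμ
  have e1 : ∀ f : ℝ → ℝ, (∀ t, M < t → f t = 0) → ∫ t in Ici (0 : ℝ), f t = ∫ t, f t ∂μ := by
    intro f hf
    rw [integral_Ici_eq_integral_Ioi, hμ]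
    refine setIntegral_eq_of_subset_of_forall_sdiff_eq_zero measurableSet_Ioi
      Ioc_subset_Ioi_self fun t ht => hf t ?_
    by_contra hcon
    exact ht.2 ⟨ht.1, not_lt.1 hcon⟩
  rw [e1 _ (fun t ht => by rw [(hM t ht).1, zero_mul]), e1 _ (fun t ht => by rw [(hM t ht).2, zero_mul])]
  have e2 : ∫ t, (deriv χ t * ∫ s in (0 : ℝ)..t, G s) ∂μ =
      ∫ t, ∫ s, deriv χ t * (Iio t).indicator G s ∂μ ∂μ := by
    refine setIntegral_congr_fun measurableSet_Ioc fun t ht => ?_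
    rw [integral_const_mul, intervalIntegral.integral_of_le ht.1.le,
      integral_indicator measurableSet_Iio, hμ, Measure.restrict_restrict measurableSet_Iio]
    congr 1
    rw [integral_Ioc_eq_integral_Ioo]
    congr 2
    ext s
    simp only [mem_Ioo, mem_inter_iff, mem_Iio, mem_Ioc]
    exact ⟨fun h => ⟨h.2, h.1, h.2.le.trans ht.2⟩, fun h => ⟨h.2.1, h.1⟩⟩
  have e3 : ∫ s, ∫ t, deriv χ t * (Iio t).indicator G s ∂μ ∂μ = ∫ s, -(χ s * G s) ∂μ := by
    refine setIntegral_congr_fun measurableSet_Ioc fun s hs => ?_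
    have h1 : ∀ t, deriv χ t * (Iio t).indicator G s = (Ioi s).indicator (deriv χ) t * G s := by
      intro t
      by_cases h : s < t <;> simp [indicator, h]
    simp_rw [h1]
    rw [integral_mul_const, integral_indicator measurableSet_Ioi, hμ,
      Measure.restrict_restrict measurableSet_Ioi]
    have h2 : ∫ t in Ioi s ∩ Ioc 0 M, deriv χ t = ∫ t in Ioi s, deriv χ t := by
      refine (setIntegral_eq_of_subset_of_forall_sdiff_eq_zero measurableSet_Ioi
        inter_subset_left fun t ht => (hM t ?_).1).symm
      by_contra hcon
      exact ht.2 ⟨ht.1, hs.1.trans ht.1, not_lt.1 hcon⟩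
    rw [h2, HasCompactSupport.integral_Ioi_deriv_eq (hχ.of_le (by simp)) hχc]
    ring
  rw [e2, integral_integral_swap, e3, integral_neg]
  obtain ⟨D, hD⟩ := hχd.bounded_above_of_compact_support hχc.deriv
  have hC0 : 0 ≤ C := (abs_nonneg _).trans (hC 0)
  refine Integrable.of_bound (C := D * C) ?_ (.of_forall fun p => ?_)
  · refine Measurable.aestronglyMeasurable ?_
    have : (Function.uncurry fun t s => deriv χ t * (Iio t).indicator G s) =
        fun p : ℝ × ℝ => deriv χ p.1 * {p : ℝ × ℝ | p.2 < p.1}.indicator (fun p => G p.2) p := by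
      ext ⟨t, s⟩
      by_cases h : s < t <;> simp [indicator, h]
    rw [this]
    exact (hχd.measurable.comp measurable_fst).mul ((hG.comp measurable_snd).indicator
      (measurableSet_lt measurable_snd measurable_fst))
  · obtain ⟨t, s⟩ := p
    simp only [Function.uncurry_apply_pair, norm_mul]
    have h1 : ‖(Iio t).indicator G s‖ ≤ C :=
      (norm_indicator_le_norm_self _ _).trans (hC s)
    have := norm_nonneg (deriv χ t)
    exact mul_le_mul (hD t) h1 (norm_nonneg _) (this.trans (hD t))

theorem ae_eq_primitive_of_integral_deriv {F G : ℝ → ℝ} {F₀ C : ℝ} (hF : Measurable F)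
    (hG : Measurable G) (hFC : ∀ t, |F t| ≤ C) (hGC : ∀ t, |G t| ≤ C)
    (h : ∀ χ : ℝ → ℝ, ContDiff ℝ (⊤ : ℕ∞) χ → HasCompactSupport χ →
      -(χ 0 * F₀) = ∫ t in Ici (0 : ℝ), (deriv χ t * F t + χ t * G t)) :
    ∀ᵐ t ∂(volume.restrict (Ici (0 : ℝ))), F t = F₀ + ∫ s in (0 : ℝ)..t, G s := by
  have hC0 : 0 ≤ C := (abs_nonneg _).trans (hFC 0)
  have hGi : ∀ a b, IntervalIntegrable G volume a b := fun a b =>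
    (intervalIntegrable_const (c := C)).mono_fun hG.aestronglyMeasurable (.of_forall fun t => by
      exact (hGC t).trans (le_abs_self _))
  have hPc : Continuous fun t => ∫ s in (0 : ℝ)..t, G s :=
    intervalIntegral.continuous_primitive hGi 0
  have hPb : ∀ t, |∫ s in (0 : ℝ)..t, G s| ≤ C * |t| := fun t => by
    simpa using intervalIntegral.norm_integral_le_of_norm_le_const (f := G) (a := 0) (b := t)
      (fun s _ => hGC s)
  have key := ae_eq_const_of_integral_deriv (F := fun t => F t - ∫ s in (0 : ℝ)..t, G s)
    (F₀ := F₀) one_pos (hF.sub hPc.measurable) (fun M => ⟨C + C * M, fun t ht => ?_⟩) (fun T _ χ hχ hχc _ => ?_)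
  · filter_upwards [key] with t ht
    rw [← ht]; ring
  · have := abs_sub (F t) (∫ s in (0 : ℝ)..t, G s)
    have := mul_le_mul_of_nonneg_left ht hC0
    linarith [hFC t, hPb t]
  · have hd := hχ.continuous_deriv (by simp)
    have i1 : Integrable fun t => deriv χ t * F t :=
      (hd.integrable_of_hasCompactSupport hχc.deriv).mul_bdd hF.aestronglyMeasurable
        (.of_forall hFC)
    have i2 : Integrable fun t => χ t * G t :=
      (hχ.continuous.integrable_of_hasCompactSupport hχc).mul_bdd hG.aestronglyMeasurable
        (.of_forall hGC)
    have i3 : Integrable fun t => deriv χ t * ∫ s in (0 : ℝ)..t, G s :=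
      (hd.mul hPc).integrable_of_hasCompactSupport hχc.deriv.mul_right
    rw [h χ hχ hχc, integral_add i1.integrableOn i2.integrableOn]
    simp_rw [mul_sub]
    rw [integral_sub i1.integrableOn i3.integrableOn, integral_deriv_mul_primitive hχ hχc hG hGC]
    ring

end VortexWave


namespace VortexWave

/-! ### Transport of bounded weak solutions along the flow -/

theorem integrable_of_bounded_of_support {k : Plane → ℝ} (hk : Measurable k) {B R : ℝ}
    (hB : ∀ x, |k x| ≤ B) (hR : ∀ x, R < ‖x‖ → k x = 0) :
    Integrable k ∧ |∫ x, k x| ≤ B * volume.real (Metric.closedBall (0 : Plane) R) := by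
  have hz : ∀ x, x ∉ Metric.closedBall (0 : Plane) R → k x = 0 := fun x hx =>
    hR x (by simpa using hx)
  constructor
  · rw [← integrableOn_iff_integrable_of_support_subset (s := Metric.closedBall (0 : Plane) R)
      (fun x hx => by by_contra h; exact hx (hz x h))]
    exact Measure.integrableOn_of_bounded (M := B) (isCompact_closedBall _ _).measure_lt_top.ne
      hk.aestronglyMeasurable (.of_forall hB)
  · rw [← setIntegral_eq_integral_of_forall_compl_eq_zero hz]
    exact norm_setIntegral_le_of_norm_le_const (isCompact_closedBall _ _).measure_lt_top
      (f := k) (fun x _ => hB x)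

theorem measurable_fderiv_apply {ψ : ℝ × Plane → ℝ} (hψ : ContDiff ℝ (⊤ : ℕ∞) ψ)
    {α : Type*} [MeasurableSpace α] {p v : α → ℝ × Plane} (hp : Measurable p)
    (hv : Measurable v) : Measurable fun a => fderiv ℝ ψ (p a) (v a) := by
  have h1 : Continuous fun q : (ℝ × Plane →L[ℝ] ℝ) × (ℝ × Plane) => q.1 q.2 :=
    isBoundedBilinearMap_apply.continuous
  exact h1.measurable.comp
    (((hψ.continuous_fderiv (by simp)).measurable.comp hp).prodMk hv)

/-- `ρ` is a bounded weak solution of `∂ₜρ + div (u ρ) = 0` with datum `ρ₀`. -/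
structure WeakTransport (C : ℝ) (u : ℝ → Plane → Plane) (ρ₀ : Plane → ℝ) (ρ : ℝ → Plane → ℝ) :
    Prop where
  meas : Measurable (Function.uncurry ρ)
  meas₀ : Measurable ρ₀
  bdd : ∀ t x, |ρ t x| ≤ C
  bdd₀ : ∀ x, |ρ₀ x| ≤ C
  weak : ∀ ψ : ℝ × Plane → ℝ, ContDiff ℝ (⊤ : ℕ∞) ψ → HasCompactSupport ψ →
    -∫ x, ρ₀ x * ψ (0, x) = ∫ t in Ici (0 : ℝ), ∫ x, ρ t x * fderiv ℝ ψ (t, x) (1, u t x)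

namespace Frame

variable {A : ℝ} {U : ℝ → ℝ → Plane → Plane} {ζ ζ' : ℝ → Plane}

/-- Ψ is replaced by a uniformly close Lipschitz function with support in a slightly larger annulus;
`R` depends only on that annulus. -/
theorem exists_smooth_approx (h : Frame A U ζ ζ') {T a P : ℝ} (ha : 0 < a) {Ψ : Plane → ℝ}
    (hΨ : Continuous Ψ) (hsupp : ∀ y, Ψ y ≠ 0 → a ≤ ‖y‖ ∧ ‖y‖ ≤ P) :
    ∃ R : ℝ, (∀ t, |t - T| ≤ step A → ∀ x, R < ‖x‖ → Ψ (vortexFlow U t T (x - ζ t)) = 0) ∧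
      ∀ θ : ℝ, 0 < θ → ∃ ψ : ℝ × Plane → ℝ, ContDiff ℝ (⊤ : ℕ∞) ψ ∧
        ∀ t, |t - T| ≤ step A → ∀ x,
        (R < ‖x‖ → ψ (t, x) = 0 ∧ fderiv ℝ ψ (t, x) = 0) ∧
        |ψ (t, x) - Ψ (vortexFlow U t T (x - ζ t))| ≤ θ ∧
        |fderiv ℝ ψ (t, x) (1, fullDrift U ζ ζ' t x)| ≤ θ := by
  obtain ⟨R, hR⟩ := h.exists_smooth_approx_of_lipschitz (T := T) (P := P + 1) (half_pos ha)
  have key : ∀ θ : ℝ, 0 < θ → ∃ ψ : ℝ × Plane → ℝ, ContDiff ℝ (⊤ : ℕ∞) ψ ∧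
        ∀ t, |t - T| ≤ step A → ∀ x,
        (R < ‖x‖ → ψ (t, x) = 0 ∧ fderiv ℝ ψ (t, x) = 0) ∧
        |ψ (t, x) - Ψ (vortexFlow U t T (x - ζ t))| ≤ θ ∧
        |fderiv ℝ ψ (t, x) (1, fullDrift U ζ ζ' t x)| ≤ θ := by
    intro θ hθ
    obtain ⟨Ψ', L, hL, hlip, hclose, hsupp'⟩ := exists_lipschitz_approx hΨ (c := 0) (P := P) ha
      (half_pos hθ) (by simpa using hsupp)
    obtain ⟨ψ, hψ, H⟩ := hR Ψ' L hL hlip (by simpa using hsupp') (θ / 2) (half_pos hθ)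
    refine ⟨ψ, hψ, fun t ht x => ⟨(H t ht x).1, ?_, (H t ht x).2.2.trans (by linarith)⟩⟩
    have h1 := (H t ht x).2.1
    have h2 := hclose (vortexFlow U t T (x - ζ t))
    have := abs_sub_le (ψ (t, x)) (Ψ' (vortexFlow U t T (x - ζ t)))
      (Ψ (vortexFlow U t T (x - ζ t)))
    linarith
  -- Beyond `R` every approximation vanishes, and the approximations converge to Ψ∘flow.
  refine ⟨R, fun t ht x hx => ?_, key⟩
  rw [← abs_nonpos_iff]
  refine le_of_forall_pos_le_add fun θ hθ => ?_
  obtain ⟨ψ, -, H⟩ := key θ hθ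
  obtain ⟨h1, h2, -⟩ := H t ht x
  rw [(h1 hx).1, zero_sub, abs_neg] at h2
  linarith

theorem measurable_vortexFlow (h : Frame A U ζ ζ') :
    Measurable fun p : ℝ × ℝ × Plane => vortexFlow U p.1 p.2.1 p.2.2 := by
  classical
  have hopen : IsOpen {p : ℝ × ℝ × Plane | p.2.2 ≠ 0} :=
    isOpen_ne.preimage (by fun_prop : Continuous fun p : ℝ × ℝ × Plane => p.2.2)
  have h1 := h.field.continuousOn_flow.measurable_piecewise
    (continuousOn_const (c := (0 : Plane))) hopen.measurableSet
  convert h1 using 1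
  ext1 p
  by_cases hp : p ∈ {p : ℝ × ℝ × Plane | p.2.2 ≠ 0}
  · rw [piecewise_eq_of_mem _ _ _ hp]
  · rw [piecewise_eq_of_notMem _ _ _ hp]
    rw [mem_ofPred_eq, not_not] at hp
    rw [hp, vortexFlow_zero]

theorem measurable_vortexFlow_comp (h : Frame A U ζ ζ') (T : ℝ) :
    Measurable fun p : ℝ × Plane => vortexFlow U p.1 T (p.2 - ζ p.1) :=
  h.measurable_vortexFlow.comp (measurable_fst.prodMk (measurable_const.prodMk
    (measurable_snd.sub (h.continuous.measurable.comp measurable_fst))))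

theorem measurable_fullDrift (h : Frame A U ζ ζ') :
    Measurable (Function.uncurry (fullDrift U ζ ζ')) := by
  have h1 : Measurable fun p : ℝ × Plane => p.2 - ζ p.1 :=
    measurable_snd.sub (h.continuous.measurable.comp measurable_fst)
  exact (h.continuous_deriv.measurable.comp measurable_fst).add
    ((((h.field.reg.cont 0 (by simp)).measurable.comp (measurable_fst.prodMk h1))).add
      (measurable_kernel.comp h1))

/-- With χ f as test function, f a smooth approximation of Ψ∘flow, the terms in which the derivative
falls on f are O(θ), and replacing f by Ψ∘flow elsewhere also costs O(θ). The support of χ is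
confined to the window where the approximation is available. -/
theorem integral_deriv_mul_transport (h : Frame A U ζ ζ') {C : ℝ} {ρ₀ : Plane → ℝ}
    {ρ : ℝ → Plane → ℝ} (w : WeakTransport C (fullDrift U ζ ζ') ρ₀ ρ) {T a P : ℝ} (ha : 0 < a)
    {Ψ : Plane → ℝ} (hΨ : Continuous Ψ) (hsupp : ∀ y, Ψ y ≠ 0 → a ≤ ‖y‖ ∧ ‖y‖ ≤ P)
    {χ : ℝ → ℝ} (hχ : ContDiff ℝ (⊤ : ℕ∞) χ) (hχc : HasCompactSupport χ)
    (hχs : tsupport χ ⊆ Ioo (T - step A) (T + step A)) :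
    -(χ 0 * ∫ x, ρ₀ x * Ψ (vortexFlow U 0 T (x - ζ 0))) =
      ∫ t in Ici (0 : ℝ), deriv χ t * ∫ x, ρ t x * Ψ (vortexFlow U t T (x - ζ t)) := by
  set τ := step A with hτ
  have hτ0 : 0 < τ := h.step_pos
  have hC : 0 ≤ C := (abs_nonneg _).trans (w.bdd₀ 0)
  obtain ⟨R, hR0, hR⟩ := h.exists_smooth_approx (T := T) ha hΨ hsupp
  set V := volume.real (Metric.closedBall (0 : Plane) R)
  have hV : 0 ≤ V := measureReal_nonneg
  have hχd : Continuous (deriv χ) := hχ.continuous_deriv (by simp)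
  obtain ⟨M, hM⟩ := hχ.continuous.bounded_above_of_compact_support hχc
  obtain ⟨M', hM'⟩ := hχd.bounded_above_of_compact_support hχc.deriv
  have hM0 : 0 ≤ M := (norm_nonneg _).trans (hM 0)
  have hM'0 : 0 ≤ M' := (norm_nonneg _).trans (hM' 0)
  set q : ℝ × Plane → ℝ := fun p => Ψ (vortexFlow U p.1 T (p.2 - ζ p.1)) with hq
  have hqm : Measurable q := hΨ.measurable.comp (h.measurable_vortexFlow_comp T)
  obtain ⟨Q, hQ⟩ : ∃ Q, ∀ y, |Ψ y| ≤ Q := by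
    refine hΨ.bounded_above_of_compact_support
      (HasCompactSupport.intro (isCompact_closedBall 0 P) fun x hx => ?_)
    by_contra hne
    exact hx (by simpa using (hsupp x hne).2)
  have hQ0 : 0 ≤ Q := (abs_nonneg _).trans (hQ 0)
  have hχz : ∀ t, ¬|t - T| ≤ τ → t ∉ tsupport χ := fun t ht hmem => ht (by
    have := hχs hmem
    rw [abs_le]; constructor <;> linarith [this.1, this.2])
  have hρm : ∀ t, Measurable (ρ t) := fun t => w.meas.comp measurable_prodMk_left
  set F : ℝ → ℝ := fun t => deriv χ t * ∫ x, ρ t x * q (t, x) with hF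
  have hFm : Measurable F := by
    refine hχd.measurable.mul ?_
    have h1 : StronglyMeasurable fun p : ℝ × Plane => ρ p.1 p.2 * q p :=
      (w.meas.mul hqm).stronglyMeasurable
    exact h1.integral_prod_right.measurable
  have hint_q : ∀ t, |t - T| ≤ τ → Integrable (fun x => ρ t x * q (t, x)) ∧
      |∫ x, ρ t x * q (t, x)| ≤ C * Q * V := by
    intro t ht
    refine integrable_of_bounded_of_support (k := fun x => ρ t x * q (t, x))
      ((hρm t).mul (hqm.comp measurable_prodMk_left)) (fun x => ?_) (fun x hx => by simp only [hq, hR0 t ht x hx, mul_zero])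
    rw [abs_mul]
    exact mul_le_mul (w.bdd t x) (hQ _) (abs_nonneg _) hC
  have hsuppT : ∀ f : ℝ → ℝ, Measurable f → (∀ t, ¬|t - T| ≤ τ → f t = 0) → ∀ B,
      (∀ t, |t - T| ≤ τ → |f t| ≤ B) → Integrable f ∧ ∀ S : Set ℝ, MeasurableSet S →
        |∫ t in S, f t| ≤ B * (2 * τ) := by
    intro f hf hf0 B hB
    have hz : ∀ t, t ∉ Icc (T - τ) (T + τ) → f t = 0 := fun t ht => hf0 t fun h => ht (by
      rw [abs_le] at h; constructor <;> linarith [h.1, h.2])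
    have hB' : ∀ t ∈ Icc (T - τ) (T + τ), |f t| ≤ B := fun t ht => hB t (by
      rw [abs_le]; constructor <;> linarith [ht.1, ht.2])
    have hB0 : 0 ≤ B := (abs_nonneg _).trans (hB T (by simp [hτ0.le]))
    have hint : Integrable f := by
      rw [← integrableOn_iff_integrable_of_support_subset (s := Icc (T - τ) (T + τ))
        (fun x hx => by by_contra h; exact hx (hz x h))]
      exact Measure.integrableOn_of_bounded (M := B) isCompact_Icc.measure_lt_top.ne
        hf.aestronglyMeasurable ((ae_restrict_iff' measurableSet_Icc).2 (.of_forall hB'))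
    refine ⟨hint, fun S hS => ?_⟩
    have hvol : volume.real (Icc (T - τ) (T + τ)) = 2 * τ := by
      rw [Real.volume_real_Icc_of_le (by linarith)]; ring
    calc |∫ t in S, f t| ≤ ∫ t in S, |f t| := by
          simpa using norm_integral_le_integral_norm (μ := volume.restrict S) f
      _ ≤ ∫ t, |f t| := setIntegral_le_integral hint.abs (.of_forall fun t => abs_nonneg _)
      _ = ∫ t in Icc (T - τ) (T + τ), |f t| :=
          (setIntegral_eq_integral_of_forall_compl_eq_zero fun t ht => by simp [hz t ht]).symm
      _ ≤ ‖∫ t in Icc (T - τ) (T + τ), |f t|‖ := le_abs_self _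
      _ ≤ B * volume.real (Icc (T - τ) (T + τ)) :=
          norm_setIntegral_le_of_norm_le_const isCompact_Icc.measure_lt_top fun t ht => by
            rw [Real.norm_eq_abs, abs_abs]; exact hB' t ht
      _ = _ := by rw [hvol]
  have hFint := (hsuppT F hFm (fun t ht => by
      have : deriv χ t = 0 :=
        image_eq_zero_of_notMem_tsupport fun hm => hχz t ht (tsupport_deriv_subset hm)
      simp [hF, this]) (M' * (C * Q * V)) (fun t ht => by
      rw [hF, abs_mul]
      exact mul_le_mul (hM' t) (hint_q t ht).2 (abs_nonneg _) hM'0)).1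
  have hmain : ∀ θ : ℝ, 0 < θ →
      |-(χ 0 * ∫ x, ρ₀ x * q (0, x)) - ∫ t in Ici (0 : ℝ), F t| ≤
        θ * (M * C * V + (M' + M) * C * V * (2 * τ)) := by
    intro θ hθ
    obtain ⟨f, hf, H⟩ := hR θ hθ
    set ψ : ℝ × Plane → ℝ := fun p => χ p.1 * f p with hψ
    have hψs : ContDiff ℝ (⊤ : ℕ∞) ψ := (hχ.comp contDiff_fst).mul hf
    have hψc : HasCompactSupport ψ := by
      refine HasCompactSupport.intro (hχc.isCompact.prod (isCompact_closedBall (0 : Plane) R))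
        fun p hp => ?_
      rw [mem_prod, not_and_or] at hp
      by_cases hp1 : p.1 ∈ tsupport χ
      · have h1 : R < ‖p.2‖ := by
          rcases hp with h2 | h2
          · exact absurd hp1 h2
          · simpa using h2
        have h2 : |p.1 - T| ≤ τ := by by_contra hcon; exact hχz _ hcon hp1
        simp only [hψ, ((H p.1 h2 p.2).1 h1).1, mul_zero]
      · simp only [hψ, image_eq_zero_of_notMem_tsupport hp1, zero_mul]
    have hweak := w.weak ψ hψs hψc
    -- Product rule: only the term with the derivative of χ survives as θ → 0.
    have hψd : ∀ t x v, fderiv ℝ ψ (t, x) (1, v) =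
        deriv χ t * f (t, x) + χ t * fderiv ℝ f (t, x) (1, v) := by
      intro t x v
      have h1 : HasFDerivAt (fun p : ℝ × Plane => χ p.1)
          ((deriv χ t) • (ContinuousLinearMap.fst ℝ ℝ Plane)) (t, x) :=
        ((hχ.differentiable (by simp) t).hasDerivAt).comp_hasFDerivAt (t, x) hasFDerivAt_fst
      have h2 := (hf.differentiable (by simp) (t, x)).hasFDerivAt
      rw [show ψ = (fun p : ℝ × Plane => χ p.1) * f from rfl, (h1.mul h2).fderiv]
      simp
      ring
    set G : ℝ → ℝ := fun t => ∫ x, ρ t x * fderiv ℝ ψ (t, x) (1, fullDrift U ζ ζ' t x) with hG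
    have hum := h.measurable_fullDrift
    have hGm : Measurable G := by
      have h1 : StronglyMeasurable fun p : ℝ × Plane =>
          ρ p.1 p.2 * fderiv ℝ ψ p (1, fullDrift U ζ ζ' p.1 p.2) :=
        (w.meas.mul (measurable_fderiv_apply hψs measurable_id
          (measurable_const.prodMk hum))).stronglyMeasurable
      exact h1.integral_prod_right.measurable
    have hGF : ∀ t, |t - T| ≤ τ → |G t - F t| ≤ (M' + M) * θ * C * V := by
      intro t ht
      have hfm : Measurable fun x => f (t, x) :=
        hf.continuous.measurable.comp measurable_prodMk_left
      have hDm : Measurable fun x => fderiv ℝ f (t, x) (1, fullDrift U ζ ζ' t x) :=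
        measurable_fderiv_apply hf measurable_prodMk_left
          (measurable_const.prodMk (hum.comp measurable_prodMk_left))
      have hk := integrable_of_bounded_of_support (R := R)
        (k := fun x => ρ t x * (deriv χ t * (f (t, x) - q (t, x)) +
          χ t * fderiv ℝ f (t, x) (1, fullDrift U ζ ζ' t x))) (B := C * ((M' + M) * θ))
        ((hρm t).mul ((measurable_const.mul (hfm.sub (hqm.comp measurable_prodMk_left))).add
          (measurable_const.mul hDm))) (fun x => ?_) (fun x hx => ?_)
      · have e1 : G t - F t = ∫ x, ρ t x * (deriv χ t * (f (t, x) - q (t, x)) +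
            χ t * fderiv ℝ f (t, x) (1, fullDrift U ζ ζ' t x)) := by
          have e2 : G t = ∫ x, (ρ t x * (deriv χ t * (f (t, x) - q (t, x)) +
            χ t * fderiv ℝ f (t, x) (1, fullDrift U ζ ζ' t x)) +
              deriv χ t * (ρ t x * q (t, x))) := by
            rw [hG]
            refine integral_congr_ae (.of_forall fun x => ?_)
            simp only [hψd]
            ring
          rw [e2, integral_add hk.1 ((hint_q t ht).1.const_mul _), integral_const_mul, hF]
          ring
        rw [e1]
        refine hk.2.trans (le_of_eq ?_)
        ring
      · rw [abs_mul]
        refine mul_le_mul (w.bdd t x) ?_ (abs_nonneg _) hC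
        have h1 : |deriv χ t * (f (t, x) - q (t, x))| ≤ M' * θ := by
          rw [abs_mul]
          exact mul_le_mul (hM' t) (H t ht x).2.1 (abs_nonneg _) hM'0
        have h2 : |χ t * fderiv ℝ f (t, x) (1, fullDrift U ζ ζ' t x)| ≤ M * θ := by
          rw [abs_mul]
          exact mul_le_mul (hM t) (H t ht x).2.2 (abs_nonneg _) hM0
        calc _ ≤ M' * θ + M * θ := (abs_add_le _ _).trans (add_le_add h1 h2)
          _ = _ := by ring
      · have h1 := (H t ht x).1 hx
        simp only [hq, h1.1, h1.2, hR0 t ht x hx]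
        simp
    have hGF0 : ∀ t, ¬|t - T| ≤ τ → G t - F t = 0 := by
      intro t ht
      have h1 : deriv χ t = 0 :=
        image_eq_zero_of_notMem_tsupport fun hm => hχz t ht (tsupport_deriv_subset hm)
      have h2 : χ t = 0 := image_eq_zero_of_notMem_tsupport (hχz t ht)
      simp [hG, hF, hψd, h1, h2]
    have hd := hsuppT (fun t => G t - F t) (hGm.sub hFm) hGF0 _ hGF
    have e3 : ∫ t in Ici (0 : ℝ), G t = (∫ t in Ici (0 : ℝ), (G t - F t)) +
        ∫ t in Ici (0 : ℝ), F t := by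
      rw [← integral_add hd.1.integrableOn hFint.integrableOn]
      simp
    have e4 : |χ 0 * (∫ x, ρ₀ x * q (0, x)) - ∫ x, ρ₀ x * ψ (0, x)| ≤ M * (C * θ * V) := by
      by_cases h0 : |0 - T| ≤ τ
      · have hf0 : Measurable fun x => f (0, x) :=
          hf.continuous.measurable.comp measurable_prodMk_left
        have hk := integrable_of_bounded_of_support (R := R)
          (k := fun x => ρ₀ x * (q (0, x) - f (0, x))) (B := C * θ)
          (w.meas₀.mul ((hqm.comp measurable_prodMk_left).sub hf0)) (fun x => ?_) (fun x hx => ?_)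
        · have hk' := integrable_of_bounded_of_support (R := R) (k := fun x => ρ₀ x * f (0, x))
            (B := C * (Q + θ)) (w.meas₀.mul hf0) (fun x => ?_) (fun x hx => ?_)
          · have e6 : ∫ x, ρ₀ x * q (0, x) =
                (∫ x, ρ₀ x * (q (0, x) - f (0, x))) + ∫ x, ρ₀ x * f (0, x) := by
              rw [← integral_add hk.1 hk'.1]
              refine integral_congr_ae (.of_forall fun x => ?_)
              dsimp only
              ring
            have e7 : ∫ x, ρ₀ x * ψ (0, x) = χ 0 * ∫ x, ρ₀ x * f (0, x) := by
              rw [← integral_const_mul]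
              refine integral_congr_ae (.of_forall fun x => ?_)
              simp only [hψ]
              ring
            rw [e6, e7, mul_add, add_sub_cancel_right, abs_mul]
            exact mul_le_mul (hM 0) hk.2 (abs_nonneg _) hM0
          · rw [abs_mul]
            refine mul_le_mul (w.bdd₀ x) ?_ (abs_nonneg _) hC
            have h1 := (H 0 h0 x).2.1
            have h2 := abs_sub_abs_le_abs_sub (f (0, x)) (q (0, x))
            have h3 : |q (0, x)| ≤ Q := hQ _
            have h4 : |f (0, x) - q (0, x)| ≤ θ := h1
            linarith
          · simp only [((H 0 h0 x).1 hx).1, mul_zero]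
        · rw [abs_mul]
          refine mul_le_mul (w.bdd₀ x) ?_ (abs_nonneg _) hC
          rw [abs_sub_comm]
          exact (H 0 h0 x).2.1
        · simp only [hq, ((H 0 h0 x).1 hx).1, hR0 0 h0 x hx, sub_zero, mul_zero]
      · have h2 : χ 0 = 0 := image_eq_zero_of_notMem_tsupport (hχz 0 h0)
        simp only [hψ, h2, zero_mul, mul_zero, integral_zero, sub_zero, abs_zero]
        positivity
    have e5 := hd.2 (Ici 0) measurableSet_Ici
    have hweak' : -∫ x, ρ₀ x * ψ (0, x) = ∫ t in Ici (0 : ℝ), G t := hweak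
    have e8 : -(χ 0 * ∫ x, ρ₀ x * q (0, x)) - ∫ t in Ici (0 : ℝ), F t =
        -(χ 0 * (∫ x, ρ₀ x * q (0, x)) - ∫ x, ρ₀ x * ψ (0, x)) +
          ∫ t in Ici (0 : ℝ), (G t - F t) := by
      linarith
    rw [e8]
    refine (abs_add_le _ _).trans ?_
    rw [abs_neg]
    linarith
  have hzero : |-(χ 0 * ∫ x, ρ₀ x * q (0, x)) - ∫ t in Ici (0 : ℝ), F t| ≤ 0 := by
    refine le_of_forall_pos_le_add fun θ hθ => ?_
    set K := M * C * V + (M' + M) * C * V * (2 * τ)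
    have hK : 0 ≤ K := by positivity
    have := hmain (θ / (K + 1)) (by positivity)
    refine this.trans ?_
    rw [zero_add, div_mul_eq_mul_div, div_le_iff₀ (by positivity)]
    nlinarith
  exact sub_eq_zero.1 (abs_nonpos_iff.1 hzero)

end Frame

end VortexWave


/-! ### Conservation of integrals along the flow over all times -/

namespace VortexWave

namespace Frame

variable {A : ℝ} {U : ℝ → ℝ → Plane → Plane} {ζ ζ' : ℝ → Plane}

theorem vortexFlow_self (h : Frame A U ζ ζ') (s : ℝ) (y : Plane) : vortexFlow U s s y = y := by
  rcases eq_or_ne y 0 with rfl | hy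
  · exact vortexFlow_zero U s s
  · exact h.field.flow_self s hy

theorem vortexFlow_comp (h : Frame A U ζ ζ') (s t r : ℝ) (y : Plane) :
    vortexFlow U t r (vortexFlow U s t y) = vortexFlow U s r y := by
  rcases eq_or_ne y 0 with rfl | hy
  · rw [vortexFlow_zero, vortexFlow_zero, vortexFlow_zero]
  · exact h.field.flow_comp s t r hy

theorem exists_annulus (h : Frame A U ζ ζ') (M : ℝ) {a P : ℝ} (ha : 0 < a) :
    ∃ r R : ℝ, 0 < r ∧ ∀ s t, |t - s| ≤ M → ∀ y, a ≤ ‖vortexFlow U t s y‖ →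
      ‖vortexFlow U t s y‖ ≤ P → r ≤ ‖y‖ ∧ ‖y‖ ≤ R := by
  obtain ⟨r, R, hr, H⟩ := h.field.exists_cut_radius M a P ha
  refine ⟨r, R, hr, fun s t hst y h1 h2 => ?_⟩
  have := (H s t hst _ h1 h2).1
  rwa [h.vortexFlow_comp, h.vortexFlow_self] at this

/-- The flow need not be continuous at the origin, but Ψ∘flow vanishes near it because trajectories
that reach the support of Ψ start away from 0. -/
theorem continuous_comp_flow (h : Frame A U ζ ζ') {s t a P : ℝ} (ha : 0 < a)
    {Ψ : Plane → ℝ} (hΨ : Continuous Ψ) (hsupp : ∀ y, Ψ y ≠ 0 → a ≤ ‖y‖ ∧ ‖y‖ ≤ P) :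
    Continuous fun y => Ψ (vortexFlow U t s y) := by
  obtain ⟨r, R, hr, H⟩ := h.exists_annulus |t - s| (P := P) ha
  refine continuous_iff_continuousAt.2 fun y => ?_
  rcases eq_or_ne y 0 with rfl | hy
  · have hev : (fun y => Ψ (vortexFlow U t s y)) =ᶠ[nhds 0] fun _ => 0 := by
      filter_upwards [Metric.ball_mem_nhds (0 : Plane) hr] with y hy
      by_contra hne
      have h1 := hsupp _ hne
      have h2 := H s t le_rfl y h1.1 h1.2
      rw [mem_ball_zero_iff] at hy
      linarith [h2.1]
    exact continuousAt_const.congr hev.symm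
  · have h1 := h.field.continuousOn_flow.continuousAt (x := ((t, s, y) : ℝ × ℝ × Plane))
      ((isOpen_ne.preimage (by fun_prop : Continuous fun p : ℝ × ℝ × Plane => p.2.2)).mem_nhds hy)
    exact hΨ.continuousAt.comp (h1.comp (f := fun y : Plane => ((t, s, y) : ℝ × ℝ × Plane))
      (by fun_prop))

/-- On the window around T the short-time result is applied to Ψ∘(flow from T to 0); by the
composition law the resulting function of t does not depend on T, so the windows chain. -/
theorem ae_integral_transport (h : Frame A U ζ ζ') {C : ℝ} {ρ₀ : Plane → ℝ}
    {ρ : ℝ → Plane → ℝ} (w : WeakTransport C (fullDrift U ζ ζ') ρ₀ ρ) {a P : ℝ} (ha : 0 < a)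
    {Ψ : Plane → ℝ} (hΨ : Continuous Ψ) (hsupp : ∀ y, Ψ y ≠ 0 → a ≤ ‖y‖ ∧ ‖y‖ ≤ P) :
    ∀ᵐ t ∂(volume.restrict (Ici (0 : ℝ))),
      ∫ x, ρ t x * Ψ (vortexFlow U t 0 (x - ζ t)) = ∫ x, ρ₀ x * Ψ (x - ζ 0) := by
  have hC : 0 ≤ C := (abs_nonneg _).trans (w.bdd₀ 0)
  have hm : Measurable fun p : ℝ × Plane => ρ p.1 p.2 * Ψ (vortexFlow U p.1 0 (p.2 - ζ p.1)) :=
    w.meas.mul (hΨ.measurable.comp (h.measurable_vortexFlow_comp 0))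
  refine ae_eq_const_of_integral_deriv h.step_pos hm.stronglyMeasurable.integral_prod_right.measurable
    (fun M => ?_) fun T _ χ hχ hχc hχs => ?_
  · obtain ⟨r, R, hr, H⟩ := h.exists_annulus M (P := P) ha
    obtain ⟨Q, hQ⟩ : ∃ Q, ∀ y, |Ψ y| ≤ Q := by
      refine hΨ.bounded_above_of_compact_support
        (HasCompactSupport.intro (isCompact_closedBall 0 P) fun x hx => ?_)
      by_contra hne
      exact hx (by simpa using (hsupp x hne).2)
    obtain ⟨Z, hZ⟩ := (isCompact_Icc (a := -M) (b := M)).exists_bound_of_continuousOn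
      h.continuous.continuousOn
    refine ⟨C * Q * volume.real (Metric.closedBall (0 : Plane) (R + Z)), fun t ht => ?_⟩
    refine (integrable_of_bounded_of_support (R := R + Z)
      (k := fun x => ρ t x * Ψ (vortexFlow U t 0 (x - ζ t)))
      (hm.comp measurable_prodMk_left) (fun x => ?_) fun x hx => ?_).2
    · rw [abs_mul]
      exact mul_le_mul (w.bdd t x) (hQ _) (abs_nonneg _) hC
    · by_contra hne
      have h1 := hsupp _ (right_ne_zero_of_mul hne)
      have h2 := (H 0 t (by simpa using ht) _ h1.1 h1.2).2
      have h3 := hZ t (abs_le.1 ht)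
      have h4 := norm_sub_norm_le x (ζ t)
      linarith
  · obtain ⟨r, R, hr, H⟩ := h.exists_annulus |T - 0| (P := P) ha
    have key := h.integral_deriv_mul_transport w (T := T) hr
      (h.continuous_comp_flow (s := 0) (t := T) ha hΨ hsupp)
      (fun y hy => H 0 T le_rfl y (hsupp _ hy).1 (hsupp _ hy).2) hχ hχc hχs
    simp_rw [h.vortexFlow_comp, h.vortexFlow_self] at key
    exact key

end Frame

end VortexWave


namespace VortexWave

/-! ### The velocity fields are divergence free -/

noncomputable def unitVec (i : Fin 2) : Plane := EuclideanSpace.single i 1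

theorem plane_eq_sum (v : Plane) : v = v 0 • unitVec 0 + v 1 • unitVec 1 := by
  apply plane_ext <;> simp [unitVec]

/-- The kernel is a radial function times the rotated position: the radial gradient is orthogonal to
the rotated vector, and the latter is divergence free. Here this is a computation along the two
axes. -/
theorem fderiv_kern_add (e : ℝ) (he : e ≠ 0) (x : Plane) :
    fderiv ℝ (fun y => kern e y 0) x (unitVec 0) +
      fderiv ℝ (fun y => kern e y 1) x (unitVec 1) = 0 := by
  have hk : ∀ i : Fin 2, Differentiable ℝ fun y => kern e y i := fun i =>
    ((contDiff_piLp_apply 2 (i := i) (n := 1)).comp (contDiff_kern he)).differentiable (by simp)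
  have hD : ∀ s b : ℝ, HasDerivAt (fun t : ℝ => 1 / (2 * Real.pi * ((s + t) ^ 2 + b ^ 2 + e ^ 2)))
      (-(2 * Real.pi * (2 * s)) / (2 * Real.pi * (s ^ 2 + b ^ 2 + e ^ 2)) ^ 2) 0 := by
    intro s b
    have h1 : HasDerivAt (fun t : ℝ => 2 * Real.pi * ((s + t) ^ 2 + b ^ 2 + e ^ 2))
        (2 * Real.pi * (2 * s)) 0 := by
      have := (((((hasDerivAt_id (0 : ℝ)).const_add s).pow 2).add_const (b ^ 2)).add_const
        (e ^ 2)).const_mul (2 * Real.pi)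
      exact this.congr_deriv (by simp)
    have h2 : 2 * Real.pi * ((s + 0) ^ 2 + b ^ 2 + e ^ 2) ≠ 0 := by positivity
    exact ((h1.inv h2).congr_deriv (by simp)).congr_of_eventuallyEq
      (.of_forall fun t => by simp only [Pi.inv_apply, one_div])
  have h0 : fderiv ℝ (fun y => kern e y 0) x (unitVec 0) =
      -(2 * Real.pi * (2 * x 0)) / (2 * Real.pi * (x 0 ^ 2 + x 1 ^ 2 + e ^ 2)) ^ 2 * -x 1 := by
    rw [← (hk 0 x).lineDeriv_eq_fderiv, lineDeriv]
    refine HasDerivAt.deriv ?_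
    refine ((hD (x 0) (x 1)).mul_const (-x 1)).congr_of_eventuallyEq (.of_forall fun t => ?_)
    simp [kern, perp, norm_sq_plane, unitVec]
  have h1 : fderiv ℝ (fun y => kern e y 1) x (unitVec 1) =
      -(2 * Real.pi * (2 * x 1)) / (2 * Real.pi * (x 1 ^ 2 + x 0 ^ 2 + e ^ 2)) ^ 2 * x 0 := by
    rw [← (hk 1 x).lineDeriv_eq_fderiv, lineDeriv]
    refine HasDerivAt.deriv ?_
    refine ((hD (x 1) (x 0)).mul_const (x 0)).congr_of_eventuallyEq (.of_forall fun t => ?_)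
    simp [kern, perp, norm_sq_plane, unitVec, add_comm (x.ofLp 0 ^ 2)]
  rw [h0, h1, add_comm (x 1 ^ 2) (x 0 ^ 2)]
  ring

theorem exists_boundedL1_fderiv {g : Plane → ℝ} (hg : ContDiff ℝ (⊤ : ℕ∞) g)
    (hgc : HasCompactSupport g) : ∃ C, BoundedL1 C fun x => ‖fderiv ℝ g x‖ := by
  have hd : Continuous fun x => ‖fderiv ℝ g x‖ := (hg.continuous_fderiv (by simp)).norm
  have hc : HasCompactSupport fun x => ‖fderiv ℝ g x‖ := (hgc.fderiv ℝ).norm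
  obtain ⟨M, hM⟩ := hd.bounded_above_of_compact_support hc
  exact ⟨max M (∫ x, |‖fderiv ℝ g x‖|), hd.integrable_of_hasCompactSupport hc,
    fun x => (hM x).trans (le_max_left _ _), le_max_right _ _⟩

theorem integral_fderiv_kern {e : ℝ} (he : e ≠ 0) {g : Plane → ℝ} (hg : ContDiff ℝ (⊤ : ℕ∞) g)
    (hgc : HasCompactSupport g) (a : Plane) :
    ∫ x, fderiv ℝ g x (kern e (x - a)) = 0 := by
  have hks : ∀ i : Fin 2, ContDiff ℝ 1 fun y => kern e (y - a) i := fun i =>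
    (contDiff_piLp_apply 2 (i := i) (n := 1)).comp ((contDiff_kern he).comp
      (contDiff_id.sub contDiff_const))
  have hgd : ∀ v, Continuous fun x => fderiv ℝ g x v := fun v =>
    (hg.continuous_fderiv (by simp)).clm_apply continuous_const
  have hgdc : ∀ v, HasCompactSupport fun x => fderiv ℝ g x v := fun v => hgc.fderiv_apply ℝ v
  have i1 : ∀ i v, Integrable fun x => kern e (x - a) i * fderiv ℝ g x v := fun i v =>
    ((hks i).continuous.mul (hgd v)).integrable_of_hasCompactSupport (hgdc v).mul_left
  have i2 : ∀ i v, Integrable fun x => fderiv ℝ (fun y => kern e (y - a) i) x v * g x :=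
    fun i v => ((((hks i).continuous_fderiv (by simp)).clm_apply continuous_const).mul
      hg.continuous).integrable_of_hasCompactSupport hgc.mul_left
  have i3 : ∀ i, Integrable fun x => kern e (x - a) i * g x := fun i =>
    ((hks i).continuous.mul hg.continuous).integrable_of_hasCompactSupport hgc.mul_left
  have parts : ∀ i v, ∫ x, kern e (x - a) i * fderiv ℝ g x v =
      -∫ x, fderiv ℝ (fun y => kern e (y - a) i) x v * g x := fun i v =>
    integral_mul_fderiv_eq_neg_fderiv_mul_of_integrable (i2 i v) (i1 i v) (i3 i)
      (fun x _ => (hks i).differentiable (by simp) x) (fun x _ => hg.differentiable (by simp) x)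
  have e1 : ∀ x, fderiv ℝ g x (kern e (x - a)) = kern e (x - a) 0 * fderiv ℝ g x (unitVec 0) +
      kern e (x - a) 1 * fderiv ℝ g x (unitVec 1) := fun x => by
    conv_lhs => rw [plane_eq_sum (kern e (x - a))]
    rw [map_add, map_smul, map_smul, smul_eq_mul, smul_eq_mul]
  simp_rw [e1]
  rw [integral_add (i1 0 _) (i1 1 _), parts, parts, ← neg_add, ← integral_add (i2 0 _) (i2 1 _)]
  have e2 : ∀ x, fderiv ℝ (fun y => kern e (y - a) 0) x (unitVec 0) * g x +
      fderiv ℝ (fun y => kern e (y - a) 1) x (unitVec 1) * g x = 0 := fun x => by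
    rw [fderiv_comp_sub (f := fun y => kern e y 0),
      fderiv_comp_sub (f := fun y => kern e y 1), ← add_mul, fderiv_kern_add e he, zero_mul]
  simp_rw [e2]
  simp

theorem integrable_fderiv_kern (e : ℝ) {g : Plane → ℝ} (hg : ContDiff ℝ (⊤ : ℕ∞) g)
    (hgc : HasCompactSupport g) (a : Plane) :
    Integrable fun x => fderiv ℝ g x (kern e (x - a)) := by
  obtain ⟨C, hC⟩ := exists_boundedL1_fderiv hg hgc
  have hm : Measurable fun x => fderiv ℝ g x (kern e (x - a)) :=
    (isBoundedBilinearMap_apply (𝕜 := ℝ) (E := Plane) (F := ℝ)).continuous.measurable.comp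
      ((hg.continuous_fderiv (by simp)).measurable.prodMk
        ((measurable_kern e).comp (measurable_id.sub_const a)))
  refine (hC.integrable_inv a).1.mono' hm.aestronglyMeasurable (.of_forall fun x => ?_)
  refine (ContinuousLinearMap.le_opNorm _ _).trans ?_
  rw [abs_norm, norm_sub_rev a x]
  exact mul_le_mul_of_nonneg_left (norm_kern_le e _) (norm_nonneg _)

/-- Limit e → 0 of the smooth case, dominated by |∇g(x)|/|x − a|. -/
theorem integral_fderiv_kernel {g : Plane → ℝ} (hg : ContDiff ℝ (⊤ : ℕ∞) g)
    (hgc : HasCompactSupport g) (a : Plane) :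
    ∫ x, fderiv ℝ g x (kernel (x - a)) = 0 := by
  obtain ⟨C, hC⟩ := exists_boundedL1_fderiv hg hgc
  have hlim : Filter.Tendsto (fun n : ℕ => ∫ x, fderiv ℝ g x (kern (1 / ((n : ℝ) + 1)) (x - a)))
      Filter.atTop (nhds (∫ x, fderiv ℝ g x (kern 0 (x - a)))) := by
    refine tendsto_integral_of_dominated_convergence _
      (fun n => (integrable_fderiv_kern _ hg hgc a).aestronglyMeasurable)
      (hC.integrable_inv a).1 (fun n => .of_forall fun x => ?_) ?_
    · refine (ContinuousLinearMap.le_opNorm _ _).trans ?_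
      rw [abs_norm, norm_sub_rev a x]
      exact mul_le_mul_of_nonneg_left (norm_kern_le _ _) (norm_nonneg _)
    · have hne : ∀ᵐ x : Plane, x ≠ a := by simp [ae_iff]
      filter_upwards [hne] with x hx
      have hx' : ‖x - a‖ ≠ 0 := norm_ne_zero_iff.2 (sub_ne_zero.2 hx)
      refine ((fderiv ℝ g x).continuous.tendsto _).comp ?_
      have hc : ContinuousAt (fun e : ℝ => kern e (x - a)) 0 := by
        unfold kern
        refine ContinuousAt.smul (ContinuousAt.div continuousAt_const
          (f := fun _ => (1 : ℝ)) (g := fun e : ℝ => 2 * Real.pi * (‖x - a‖ ^ 2 + e ^ 2)) (by fun_prop) ?_)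
          continuousAt_const
        have : 0 < ‖x - a‖ ^ 2 + (0 : ℝ) ^ 2 := by positivity
        positivity
      exact hc.tendsto.comp tendsto_one_div_add_atTop_nhds_zero_nat
  rw [← kern_zero_left]
  refine tendsto_nhds_unique hlim ?_
  refine tendsto_const_nhds.congr fun n => ?_
  exact (integral_fderiv_kern (by positivity) hg hgc a).symm

/-- Fubini reduces the claim to the kernel centred at each y; integrability of the double integral
comes from the singular integral bound applied to |∇g|. -/
theorem integral_fderiv_biotSavart {C : ℝ} {f : Plane → ℝ} (hf : BoundedL1 C f) {g : Plane → ℝ}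
    (hg : ContDiff ℝ (⊤ : ℕ∞) g) (hgc : HasCompactSupport g) :
    ∫ x, fderiv ℝ g x (biotSavart f x) = 0 := by
  obtain ⟨D, hD⟩ := exists_boundedL1_fderiv hg hgc
  have e1 : ∀ x, fderiv ℝ g x (biotSavart f x) = ∫ y, f y * fderiv ℝ g x (kernel (x - y)) := by
    intro x
    have h1 := hf.integrable_kern 0 x
    rw [kern_zero_left] at h1
    rw [biotSavart, ← ContinuousLinearMap.integral_comp_comm _ h1]
    simp
  simp_rw [e1]
  have hm : AEStronglyMeasurable (fun p : Plane × Plane => f p.1 * fderiv ℝ g p.2 (kernel (p.2 - p.1)))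
      (volume.prod volume) := by
    refine (hf.integrable.aestronglyMeasurable.comp_fst).mul (Measurable.aestronglyMeasurable ?_)
    exact (isBoundedBilinearMap_apply (𝕜 := ℝ) (E := Plane) (F := ℝ)).continuous.measurable.comp
      (((hg.continuous_fderiv (by simp)).measurable.comp measurable_snd).prodMk
        (measurable_kernel.comp (measurable_snd.sub measurable_fst)))
  have hint : Integrable (fun p : Plane × Plane => f p.1 * fderiv ℝ g p.2 (kernel (p.2 - p.1)))
      (volume.prod volume) := by
    rw [integrable_prod_iff hm]
    refine ⟨.of_forall fun y => ?_, ?_⟩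
    · have := integrable_fderiv_kern 0 hg hgc y
      rw [kern_zero_left] at this
      exact this.const_mul (f y)
    · refine (hf.integrable.abs.mul_const (D * kernConst)).mono' hm.norm.integral_prod_right'
        (.of_forall fun y => ?_)
      rw [Real.norm_of_nonneg (integral_nonneg fun x => norm_nonneg _)]
      simp_rw [norm_mul]
      rw [integral_const_mul]
      refine mul_le_mul_of_nonneg_left ?_ (abs_nonneg _)
      refine (integral_mono_of_nonneg (.of_forall fun x => norm_nonneg _) (hD.integrable_inv y).1
        (.of_forall fun x => ?_)).trans (hD.integrable_inv y).2
      refine (ContinuousLinearMap.le_opNorm _ _).trans ?_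
      dsimp only
      rw [abs_norm, norm_sub_rev y x, ← kern_zero_left]
      exact mul_le_mul_of_nonneg_left (norm_kern_le _ _) (norm_nonneg _)
  rw [integral_integral_swap (f := fun x y => f y * fderiv ℝ g x (kernel (x - y))) hint.swap]
  simp_rw [integral_const_mul, integral_fderiv_kernel hg hgc, mul_zero]
  simp

end VortexWave


namespace VortexWave

/-! ### Measures on the punctured plane -/

/-- The punctured plane is a countable union of open annuli. On each, weighting by the distance to
the complement gives finite measures that agree on bounded continuous functions; dividing by the
weight recovers the restrictions. -/
theorem restrict_compl_zero_eq {μ : Measure Plane}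
    (h : ∀ (a P : ℝ) (Ψ : Plane → ℝ), 0 < a → Continuous Ψ → (∀ y, 0 ≤ Ψ y) →
      (∀ y, Ψ y ≠ 0 → a ≤ ‖y‖ ∧ ‖y‖ ≤ P) →
      ∫⁻ y, ENNReal.ofReal (Ψ y) ∂μ = ∫⁻ y, ENNReal.ofReal (Ψ y)) :
    μ.restrict {0}ᶜ = (volume : Measure Plane).restrict {0}ᶜ := by
  have hU : ({0}ᶜ : Set Plane) = ⋃ n : ℕ, {y : Plane | 1 / ((n : ℝ) + 1) < ‖y‖ ∧ ‖y‖ < n} := by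
    ext y
    simp only [mem_compl_iff, mem_singleton_iff, mem_iUnion, mem_ofPred_eq]
    constructor
    · intro hy
      obtain ⟨n, hn⟩ := exists_nat_gt (max ‖y‖ (1 / ‖y‖))
      have hy' : 0 < ‖y‖ := norm_pos_iff.2 hy
      refine ⟨n, ?_, (le_max_left _ _).trans_lt hn⟩
      have := (le_max_right _ _).trans_lt hn
      rw [div_lt_iff₀ hy'] at this
      rw [div_lt_iff₀ (by positivity)]
      nlinarith
    · rintro ⟨n, hn, -⟩ rfl
      rw [norm_zero] at hn
      exact absurd hn (not_lt.2 (by positivity))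
  rw [hU, Measure.restrict_iUnion_congr]
  intro n
  set S : Set Plane := {y : Plane | 1 / ((n : ℝ) + 1) < ‖y‖ ∧ ‖y‖ < n} with hS
  have hSo : IsOpen S :=
    (isOpen_lt continuous_const continuous_norm).inter (isOpen_lt continuous_norm continuous_const)
  have ha : 0 < 1 / ((n : ℝ) + 1) := by positivity
  have hSc : Sᶜ.Nonempty := ⟨0, fun h0 => by
    have := h0.1
    rw [norm_zero] at this
    linarith⟩
  set η : Plane → ℝ := fun y => Metric.infDist y Sᶜ with hη
  have hηc : Continuous η := Metric.continuous_infDist_pt _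
  have hη0 : ∀ y, 0 ≤ η y := fun y => Metric.infDist_nonneg
  have hηS : ∀ y, η y ≠ 0 ↔ y ∈ S := fun y => by
    rw [hη, Ne, ← hSo.isClosed_compl.mem_iff_infDist_zero hSc, mem_compl_iff, not_not]
  have hηs : ∀ y, η y ≠ 0 → 1 / ((n : ℝ) + 1) ≤ ‖y‖ ∧ ‖y‖ ≤ n := fun y hy =>
    ⟨((hηS y).1 hy).1.le, ((hηS y).1 hy).2.le⟩
  set w : Plane → ℝ≥0∞ := fun y => ENNReal.ofReal (η y) with hw
  have hwm : Measurable w := hηc.measurable.ennreal_ofReal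
  have hind : S.indicator w = w := indicator_eq_self.2 fun y hy => (hηS y).1 fun h0 => hy (by
    simp [hw, h0])
  have hfin : ∫⁻ y, w y < ∞ := by
    have : Integrable η := hηc.integrable_of_hasCompactSupport
      (HasCompactSupport.intro (isCompact_closedBall 0 n) fun x hx => by
        by_contra hne
        exact hx (by simpa using (hηs x hne).2))
    rw [hw, ← ofReal_integral_eq_lintegral_ofReal this (.of_forall hη0)]
    exact ENNReal.ofReal_lt_top
  have hfinμ : ∫⁻ y, w y ∂μ < ∞ := by rwa [h _ _ η ha hηc hη0 hηs]
  have : IsFiniteMeasure (μ.withDensity w) := isFiniteMeasure_withDensity hfinμ.ne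
  have : IsFiniteMeasure ((volume : Measure Plane).withDensity w) :=
    isFiniteMeasure_withDensity hfin.ne
  have key : μ.withDensity w = (volume : Measure Plane).withDensity w := by
    refine ext_of_forall_lintegral_eq_of_IsFiniteMeasure fun f => ?_
    have hfm : Measurable fun y => (f y : ℝ≥0∞) := f.continuous.measurable.coe_nnreal_ennreal
    rw [lintegral_withDensity_eq_lintegral_mul _ hwm hfm,
      lintegral_withDensity_eq_lintegral_mul _ hwm hfm]
    have e : ∀ y, (w * fun y => (f y : ℝ≥0∞)) y = ENNReal.ofReal (η y * f y) := fun y => by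
      rw [ENNReal.ofReal_mul (hη0 y), ENNReal.ofReal_coe_nnreal]
      rfl
    simp_rw [e]
    exact h _ _ (fun y => η y * f y) ha (hηc.mul (NNReal.continuous_coe.comp f.continuous))
      (fun y => mul_nonneg (hη0 y) (f y).coe_nonneg) fun y hy => hηs y (left_ne_zero_of_mul hy)
  have hrec : ∀ ν : Measure Plane, (ν.withDensity w).withDensity (fun y => (w y)⁻¹) =
      ν.restrict S := by
    intro ν
    rw [← hind, withDensity_indicator hSo.measurableSet, hind]
    refine withDensity_inv_same hwm ((ae_restrict_iff' hSo.measurableSet).2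
      (.of_forall fun y hy => ?_)) (.of_forall fun y => ENNReal.ofReal_ne_top)
    have := lt_of_le_of_ne (hη0 y) ((hηS y).2 hy).symm
    simpa [hw] using this
  rw [← hrec μ, key, hrec]

/-! ### The flow preserves Lebesgue measure -/

/-- The space derivative integrates to 0 because the field is divergence free, and the time
derivative integrates to −ψ(0, x). -/
theorem weak_one {u : ℝ → Plane → Plane}
    (hu : ∀ᵐ t ∂(volume.restrict (Ici (0 : ℝ))), ∀ g : Plane → ℝ, ContDiff ℝ (⊤ : ℕ∞) g →
      HasCompactSupport g → Integrable (fun x => fderiv ℝ g x (u t x)) ∧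
        ∫ x, fderiv ℝ g x (u t x) = 0)
    {ψ : ℝ × Plane → ℝ} (hψ : ContDiff ℝ (⊤ : ℕ∞) ψ) (hψc : HasCompactSupport ψ) :
    -∫ x, (1 : ℝ) * ψ (0, x) =
      ∫ t in Ici (0 : ℝ), ∫ x, (1 : ℝ) * fderiv ℝ ψ (t, x) (1, u t x) := by
  have hd : Continuous fun p => fderiv ℝ ψ p (1, 0) :=
    (hψ.continuous_fderiv (by simp)).clm_apply continuous_const
  have hdc : HasCompactSupport fun p => fderiv ℝ ψ p (1, 0) := hψc.fderiv_apply ℝ _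
  have hdi : Integrable fun p => fderiv ℝ ψ p (1, 0) := hd.integrable_of_hasCompactSupport hdc
  have hcx : ∀ t : ℝ, Topology.IsClosedEmbedding fun x : Plane => (t, x) := fun t =>
    .of_continuous_injective_isClosedMap (by fun_prop) (Prod.mk_right_injective t)
      (isClosedMap_prodMk_left t)
  have hct : ∀ x : Plane, Topology.IsClosedEmbedding fun t : ℝ => (t, x) := fun x =>
    .of_continuous_injective_isClosedMap (by fun_prop) (Prod.mk_left_injective x)
      (isClosedMap_prodMk_right x)
  have e1 : ∫ t in Ici (0 : ℝ), ∫ x, (1 : ℝ) * fderiv ℝ ψ (t, x) (1, u t x) =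
      ∫ t in Ici (0 : ℝ), ∫ x, fderiv ℝ ψ (t, x) (1, 0) := by
    refine integral_congr_ae ?_
    filter_upwards [hu] with t ht
    have hs : ContDiff ℝ (⊤ : ℕ∞) fun x => ψ (t, x) := hψ.comp (contDiff_const.prodMk contDiff_id)
    have hsc : HasCompactSupport fun x => ψ (t, x) := hψc.comp_isClosedEmbedding (hcx t)
    obtain ⟨h1, h2⟩ := ht _ hs hsc
    have e : ∀ x, (1 : ℝ) * fderiv ℝ ψ (t, x) (1, u t x) = fderiv ℝ ψ (t, x) (1, 0) +
        fderiv ℝ (fun x => ψ (t, x)) x (u t x) := by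
      intro x
      have h3 := ((hψ.differentiable (by simp) (t, x)).hasFDerivAt).comp x
        (hasFDerivAt_prodMk_right t x)
      rw [show (fun x => ψ (t, x)) = ψ ∘ fun x => (t, x) from rfl, h3.fderiv, one_mul,
        ContinuousLinearMap.comp_apply, ← map_add]
      simp
    simp_rw [e]
    rw [integral_add ?_ h1, h2, add_zero]
    exact (hd.comp (by fun_prop : Continuous fun x : Plane => (t, x))).integrable_of_hasCompactSupport
      (hdc.comp_isClosedEmbedding (hcx t))
  rw [e1, integral_integral_swap (f := fun t x => fderiv ℝ ψ (t, x) (1, 0))]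
  · rw [← integral_neg]
    refine integral_congr_ae (.of_forall fun x => ?_)
    have hs : ContDiff ℝ (⊤ : ℕ∞) fun t => ψ (t, x) := hψ.comp (contDiff_id.prodMk contDiff_const)
    have hsc : HasCompactSupport fun t => ψ (t, x) := hψc.comp_isClosedEmbedding (hct x)
    have h1 := hsc.integral_Ioi_deriv_eq (hs.of_le (by simp)) 0
    dsimp only
    rw [one_mul, ← h1, integral_Ici_eq_integral_Ioi]
    refine integral_congr_ae (.of_forall fun t => ?_)
    have h3 := ((hψ.differentiable (by simp) (t, x)).hasFDerivAt).comp_hasDerivAt t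
        ((hasDerivAt_id t).prodMk (hasDerivAt_const t x))
    exact h3.deriv
  · exact Integrable.mono_measure hdi (Measure.prod_mono Measure.restrict_le_self le_rfl)

/-- A bounded integrable vorticity whose velocity is described in the frame moving with the
vortex. -/
structure Driven (A C : ℝ) (U : ℝ → ℝ → Plane → Plane) (ζ ζ' : ℝ → Plane) (ω : ℝ → Plane → ℝ) :
    Prop where
  frame : Frame A U ζ ζ'
  meas : Measurable (Function.uncurry ω)
  bdd : ∀ t, BoundedL1 C (ω t)
  drift : ∀ᵐ t ∂(volume.restrict (Ici (0 : ℝ))), ∀ x,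
    ζ' t + U 0 t (x - ζ t) = biotSavart (ω t) x

namespace Driven

variable {A C : ℝ} {U : ℝ → ℝ → Plane → Plane} {ζ ζ' : ℝ → Plane} {ω : ℝ → Plane → ℝ}

theorem fullDrift_eq (h : Driven A C U ζ ζ' ω) :
    ∀ᵐ t ∂(volume.restrict (Ici (0 : ℝ))), ∀ x,
      fullDrift U ζ ζ' t x = biotSavart (ω t) x + kernel (x - ζ t) := by
  filter_upwards [h.drift] with t ht x
  rw [← ht x, fullDrift, vortexDrift, add_assoc]

/-- The point of treating the constant 1 as a weak solution is to obtain area preservation of a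
non-Lipschitz flow from the transport theorem, with no Jacobian. -/
theorem weakTransport_one (h : Driven A C U ζ ζ' ω) :
    WeakTransport 1 (fullDrift U ζ ζ') (fun _ => 1) (fun _ _ => 1) where
  meas := measurable_const
  meas₀ := measurable_const
  bdd _ _ := by simp
  bdd₀ _ := by simp
  weak ψ hψ hψc := by
    refine weak_one ?_ hψ hψc
    filter_upwards [h.drift, h.fullDrift_eq] with t ht1 ht2 g hg hgc
    have hbc : Continuous (biotSavart (ω t)) := by
      rw [show biotSavart (ω t) = fun x => ζ' t + U 0 t (x - ζ t) from funext fun x => (ht1 x).symm]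
      exact continuous_const.add ((h.frame.field.reg.cont 0 (by simp)).comp
        (continuous_const.prodMk (continuous_id.sub continuous_const)))
    have i1 : Integrable fun x => fderiv ℝ g x (biotSavart (ω t) x) :=
      ((hg.continuous_fderiv (by simp)).clm_apply hbc).integrable_of_hasCompactSupport
        ((hgc.fderiv ℝ).mono' fun x hx => subset_tsupport _ fun h0 => hx (by
          simp [h0]))
    have i2 := integrable_fderiv_kern 0 hg hgc (ζ t)
    rw [kern_zero_left] at i2
    simp_rw [ht2, map_add]
    refine ⟨i1.add i2, ?_⟩
    rw [integral_add i1 i2, integral_fderiv_biotSavart (h.bdd t) hg hgc,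
      integral_fderiv_kernel hg hgc, add_zero]

end Driven

namespace Frame

variable {A : ℝ} {U : ℝ → ℝ → Plane → Plane} {ζ ζ' : ℝ → Plane}

theorem measurable_vortexFlow_apply (h : Frame A U ζ ζ') (s t : ℝ) :
    Measurable (vortexFlow U s t) :=
  h.measurable_vortexFlow.comp (measurable_const.prodMk (measurable_const.prodMk measurable_id))

/-- The flow relative to the vortex as a measurable equivalence of the plane. -/
noncomputable def flowEquiv (h : Frame A U ζ ζ') (s t : ℝ) : Plane ≃ᵐ Plane where
  toFun := vortexFlow U s t
  invFun := vortexFlow U t s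
  left_inv y := by rw [h.vortexFlow_comp, h.vortexFlow_self]
  right_inv y := by rw [h.vortexFlow_comp, h.vortexFlow_self]
  measurable_toFun := h.measurable_vortexFlow_apply s t
  measurable_invFun := h.measurable_vortexFlow_apply t s

theorem continuous_vortexFlow_left (h : Frame A U ζ ζ') (t : ℝ) (y : Plane) :
    Continuous fun s => vortexFlow U s t y := by
  rcases eq_or_ne y 0 with rfl | hy
  · simp_rw [vortexFlow_zero]; exact continuous_const
  · exact h.field.continuousOn_flow.comp_continuous
      (f := fun s : ℝ => ((s, t, y) : ℝ × ℝ × Plane)) (by fun_prop) fun s => hy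

theorem continuous_integral_flow (h : Frame A U ζ ζ') {f : Plane → ℝ} {C : ℝ} (hf : Measurable f)
    (hfC : ∀ x, |f x| ≤ C) {a P : ℝ} (ha : 0 < a) {Ψ : Plane → ℝ} (hΨ : Continuous Ψ)
    (hsupp : ∀ y, Ψ y ≠ 0 → a ≤ ‖y‖ ∧ ‖y‖ ≤ P) (T : ℝ) :
    Continuous fun t => ∫ y, f y * Ψ (vortexFlow U t T y) := by
  refine continuous_iff_continuousAt.2 fun t₀ => ?_
  have hC : 0 ≤ C := (abs_nonneg _).trans (hfC 0)
  obtain ⟨r, R, hr, H⟩ := h.exists_annulus (|t₀ - T| + 1) (P := P) ha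
  obtain ⟨Q, hQ⟩ : ∃ Q, ∀ y, |Ψ y| ≤ Q := by
    refine hΨ.bounded_above_of_compact_support
      (HasCompactSupport.intro (isCompact_closedBall 0 P) fun x hx => ?_)
    by_contra hne
    exact hx (by simpa using (hsupp x hne).2)
  have hQ0 : 0 ≤ Q := (abs_nonneg _).trans (hQ 0)
  refine continuousAt_of_dominated
    (bound := (Metric.closedBall (0 : Plane) R).indicator fun _ => C * Q)
    (.of_forall fun t => (hf.mul (hΨ.measurable.comp
      (h.measurable_vortexFlow_apply t T))).aestronglyMeasurable) ?_ ?_ (.of_forall fun y => ?_)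
  · filter_upwards [Metric.ball_mem_nhds t₀ one_pos] with t ht
    refine .of_forall fun y => ?_
    by_cases hy : y ∈ Metric.closedBall (0 : Plane) R
    · rw [indicator_of_mem hy, norm_mul]
      exact mul_le_mul (hfC y) (hQ _) (norm_nonneg _) hC
    · rw [indicator_of_notMem hy, norm_le_zero_iff]
      by_contra hne
      have h1 := hsupp _ (right_ne_zero_of_mul hne)
      rw [Metric.mem_ball, Real.dist_eq] at ht
      have := abs_sub_le t t₀ T
      exact hy (by simpa using (H T t (by linarith) _ h1.1 h1.2).2)
  · rw [integrable_indicator_iff Metric.isClosed_closedBall.measurableSet]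
    exact integrableOn_const (isCompact_closedBall _ _).measure_lt_top.ne
  · exact (continuous_const.mul (hΨ.comp (h.continuous_vortexFlow_left T y))).continuousAt

end Frame

namespace Driven

variable {A C : ℝ} {U : ℝ → ℝ → Plane → Plane} {ζ ζ' : ℝ → Plane} {ω : ℝ → Plane → ℝ}

/-- The transport theorem gives equality for almost every time; continuity in t of the left side
gives every t ≥ 0. -/
theorem integral_comp_flow (h : Driven A C U ζ ζ' ω) {a P : ℝ} (ha : 0 < a) {Ψ : Plane → ℝ}
    (hΨ : Continuous Ψ) (hsupp : ∀ y, Ψ y ≠ 0 → a ≤ ‖y‖ ∧ ‖y‖ ≤ P) {t : ℝ} (ht : 0 ≤ t) :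
    ∫ y, Ψ (vortexFlow U t 0 y) = ∫ y, Ψ y := by
  have h1 := h.frame.ae_integral_transport h.weakTransport_one ha hΨ hsupp
  have hc := h.frame.continuous_integral_flow (f := fun _ => 1) (C := 1) measurable_const
    (fun _ => by simp) ha hΨ hsupp 0
  have h2 : EqOn (fun t => ∫ y, (1 : ℝ) * Ψ (vortexFlow U t 0 y)) (fun _ => ∫ y, Ψ y) (Ici 0) := by
    refine Measure.eqOn_of_ae_eq (μ := volume) ?_ hc.continuousOn continuousOn_const
      (by rw [interior_Ici, closure_Ioi])
    filter_upwards [h1] with t ht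
    simp only [one_mul] at ht ⊢
    rw [integral_sub_right_eq_self (fun x => Ψ (vortexFlow U t 0 x)),
      integral_sub_right_eq_self Ψ] at ht
    exact ht
  simpa using h2 ht

theorem measurePreserving_vortexFlow_left (h : Driven A C U ζ ζ' ω) {t : ℝ} (ht : 0 ≤ t) :
    MeasurePreserving (vortexFlow U t 0) := by
  have hm := h.frame.measurable_vortexFlow_apply t 0
  refine ⟨hm, ?_⟩
  have key : (Measure.map (vortexFlow U t 0) volume).restrict {0}ᶜ =
      (volume : Measure Plane).restrict {0}ᶜ := by
    refine restrict_compl_zero_eq fun a P Ψ ha hΨ h0 hsupp => ?_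
    have hi : ∀ {Φ : Plane → ℝ} {b Q : ℝ}, Continuous Φ → (∀ y, Φ y ≠ 0 → b ≤ ‖y‖ ∧ ‖y‖ ≤ Q) →
        Integrable Φ := fun hΦ hs => hΦ.integrable_of_hasCompactSupport
      (HasCompactSupport.intro (isCompact_closedBall 0 _) fun x hx => by
        by_contra hne
        exact hx (by simpa using (hs x hne).2))
    obtain ⟨r, R, hr, H⟩ := h.frame.exists_annulus |t - 0| (P := P) ha
    rw [lintegral_map hΨ.measurable.ennreal_ofReal hm,
      ← ofReal_integral_eq_lintegral_ofReal (hi hΨ hsupp) (.of_forall h0),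
      ← ofReal_integral_eq_lintegral_ofReal (f := fun y => Ψ (vortexFlow U t 0 y))
        (hi (h.frame.continuous_comp_flow ha hΨ hsupp) fun y hy => H 0 t le_rfl y (hsupp _ hy).1
          (hsupp _ hy).2) (.of_forall fun y => h0 _),
      h.integral_comp_flow ha hΨ hsupp ht]
  -- Only the origin is mapped to the origin, so the comparison on the punctured plane is a
  -- comparison on the plane.
  have hz : Measure.map (vortexFlow U t 0) volume {0} = 0 := by
    rw [Measure.map_apply hm (measurableSet_singleton 0)]
    refine measure_mono_null (t := {0}) (fun y hy => ?_) (measure_singleton 0)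
    have h1 : vortexFlow U t 0 y = 0 := hy
    have h2 := h.frame.vortexFlow_comp t 0 t y
    rw [h1, vortexFlow_zero, h.frame.vortexFlow_self] at h2
    exact h2.symm
  have hfull : ∀ μ : Measure Plane, μ {0} = 0 → μ.restrict {0}ᶜ = μ := fun μ hμ =>
    Measure.restrict_eq_self_of_ae_mem (by
      rw [ae_iff]
      simpa using hμ)
  rwa [hfull _ hz, hfull _ (measure_singleton 0)] at key

theorem measurePreserving_vortexFlow (h : Driven A C U ζ ζ' ω) {t : ℝ} (ht : 0 ≤ t) :
    MeasurePreserving (vortexFlow U 0 t) :=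
  MeasurePreserving.symm (h.frame.flowEquiv t 0) (h.measurePreserving_vortexFlow_left ht)

end Driven

end VortexWave


namespace VortexWave

/-! ### Identification of the vorticity with the transported datum -/

/-- The datum transported by the flow. -/
noncomputable def transported (U : ℝ → ℝ → Plane → Plane) (ζ : ℝ → Plane) (ω₀ : Plane → ℝ) (t : ℝ)
    (x : Plane) : ℝ :=
  ω₀ (fullFlow U ζ t 0 x)

namespace Frame

variable {A : ℝ} {U : ℝ → ℝ → Plane → Plane} {ζ ζ' : ℝ → Plane}

theorem fullFlow_comp (h : Frame A U ζ ζ') (s t r : ℝ) (x : Plane) :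
    fullFlow U ζ t r (fullFlow U ζ s t x) = fullFlow U ζ s r x := by
  simp only [fullFlow, add_sub_cancel_left, h.vortexFlow_comp]

theorem fullFlow_self (h : Frame A U ζ ζ') (s : ℝ) (x : Plane) : fullFlow U ζ s s x = x := by
  simp only [fullFlow, h.vortexFlow_self, add_sub_cancel]

theorem measurable_fullFlow (h : Frame A U ζ ζ') :
    Measurable fun p : ℝ × ℝ × Plane => fullFlow U ζ p.1 p.2.1 p.2.2 := by
  have hζ := h.continuous.measurable
  exact (hζ.comp (measurable_fst.comp measurable_snd)).add (h.measurable_vortexFlow.comp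
    (measurable_fst.prodMk ((measurable_fst.comp measurable_snd).prodMk
      ((measurable_snd.comp measurable_snd).sub (hζ.comp measurable_fst)))))

theorem measurable_fullFlow_apply (h : Frame A U ζ ζ') (s t : ℝ) :
    Measurable (fullFlow U ζ s t) :=
  h.measurable_fullFlow.comp (measurable_const.prodMk (measurable_const.prodMk measurable_id))

theorem measurable_transported (h : Frame A U ζ ζ') {ω₀ : Plane → ℝ} (hω₀ : Measurable ω₀) :
    Measurable (Function.uncurry (transported U ζ ω₀)) :=
  hω₀.comp (h.measurable_fullFlow.comp
    (measurable_fst.prodMk (measurable_const.prodMk measurable_snd)))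

/-- The flow as a measurable equivalence of the plane. -/
noncomputable def fullEquiv (h : Frame A U ζ ζ') (s t : ℝ) : Plane ≃ᵐ Plane where
  toFun := fullFlow U ζ s t
  invFun := fullFlow U ζ t s
  left_inv y := by rw [h.fullFlow_comp, h.fullFlow_self]
  right_inv y := by rw [h.fullFlow_comp, h.fullFlow_self]
  measurable_toFun := h.measurable_fullFlow_apply s t
  measurable_invFun := h.measurable_fullFlow_apply t s

end Frame

theorem continuous_integral_mul_of_compactSupport {f : Plane → ℝ} {C : ℝ} (hf : Measurable f)
    (hfC : ∀ x, |f x| ≤ C) {Φ : ℝ × Plane → ℝ} (hΦ : Continuous Φ) (hΦc : HasCompactSupport Φ) :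
    Continuous fun s => ∫ y, f y * Φ (s, y) := by
  have hC : 0 ≤ C := (abs_nonneg _).trans (hfC 0)
  obtain ⟨Q, hQ⟩ := hΦ.bounded_above_of_compact_support hΦc
  obtain ⟨R, hR⟩ := hΦc.isCompact.isBounded.subset_closedBall 0
  refine continuous_of_dominated
    (bound := (Metric.closedBall (0 : Plane) R).indicator fun _ => C * Q)
    (fun s => (hf.mul (hΦ.measurable.comp measurable_prodMk_left)).aestronglyMeasurable)
    (fun s => .of_forall fun y => ?_) ?_ (.of_forall fun y => by fun_prop)
  · by_cases hy : y ∈ Metric.closedBall (0 : Plane) R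
    · rw [indicator_of_mem hy, norm_mul]
      exact mul_le_mul (hfC y) (hQ _) (norm_nonneg _) hC
    · rw [indicator_of_notMem hy, norm_le_zero_iff]
      have : (s, y) ∉ tsupport Φ := fun hm => hy (by
        have := hR hm
        simp only [Metric.mem_closedBall, dist_zero_right] at this ⊢
        exact (norm_snd_le (s, y)).trans this)
      rw [image_eq_zero_of_notMem_tsupport this, mul_zero]
  · rw [integrable_indicator_iff Metric.isClosed_closedBall.measurableSet]
    exact integrableOn_const (isCompact_closedBall _ _).measure_lt_top.ne

/-- The exceptional set of times depends on Ψ, whereas space-time test functions require one null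
set for all their slices. Rational slices give a countable family, and continuity in the slice
parameter allows the slice at t itself. -/
theorem ae_eq_zero_of_integral_mul_eq_zero {G : ℝ → Plane → ℝ} {C : ℝ}
    (hG : Measurable (Function.uncurry G)) (hC : ∀ t y, |G t y| ≤ C)
    (h : ∀ (a P : ℝ) (Ψ : Plane → ℝ), 0 < a → Continuous Ψ →
      (∀ y, Ψ y ≠ 0 → a ≤ ‖y‖ ∧ ‖y‖ ≤ P) →
      ∀ᵐ t ∂(volume.restrict (Ici (0 : ℝ))), ∫ y, G t y * Ψ y = 0) :
    ∀ᵐ t ∂(volume.restrict (Ici (0 : ℝ))), ∀ᵐ y, G t y = 0 := by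
  set O : Set (ℝ × Plane) := Ioi 0 ×ˢ {0}ᶜ with hO
  have hOo : IsOpen O := isOpen_Ioi.prod isOpen_compl_singleton
  have hloc : LocallyIntegrable (Function.uncurry G) (volume.prod volume) :=
    (locallyIntegrable_const C).mono hG.aestronglyMeasurable (.of_forall fun p =>
      (hC p.1 p.2).trans (le_abs_self C))
  have key := hOo.ae_eq_zero_of_integral_contDiff_smul_eq_zero (hloc.locallyIntegrableOn O)
    (fun Φ hΦ hΦc hΦs => ?_)
  · have hae := Measure.ae_ae_of_ae_prod key
    have hne : ∀ᵐ t : ℝ, t ≠ 0 := by simp [ae_iff]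
    have hne' : ∀ᵐ y : Plane, y ≠ 0 := by simp [ae_iff]
    rw [ae_restrict_iff' measurableSet_Ici]
    filter_upwards [hae, hne] with t ht h0 ht0
    filter_upwards [ht, hne'] with y hy hy0
    exact hy ⟨lt_of_le_of_ne ht0 (Ne.symm h0), hy0⟩
  · have hΦcont := hΦ.continuous
    obtain ⟨a, P, ha, haP⟩ : ∃ a P : ℝ, 0 < a ∧ ∀ p ∈ tsupport Φ, a ≤ ‖p.2‖ ∧ ‖p.2‖ ≤ P := by
      have hcn : Continuous fun p : ℝ × Plane => ‖p.2‖ := by fun_prop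
      obtain ⟨P, hP⟩ := hΦc.isCompact.bddAbove_image hcn.continuousOn
      rcases (tsupport Φ).eq_empty_or_nonempty with he | hne
      · exact ⟨1, P, one_pos, fun p hp => by rw [he] at hp; exact hp.elim⟩
      · obtain ⟨q, hq, hqm⟩ := hΦc.isCompact.exists_isMinOn hne hcn.continuousOn
        exact ⟨‖q.2‖, P, norm_pos_iff.2 (hΦs hq).2, fun p hp => ⟨hqm hp, hP (mem_image_of_mem _ hp)⟩⟩
    have hGm : ∀ t, Measurable (G t) := fun t => hG.comp measurable_prodMk_left
    have hq : ∀ q : ℚ, ∀ᵐ t ∂(volume.restrict (Ici (0 : ℝ))), ∫ y, G t y * Φ ((q : ℝ), y) = 0 :=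
      fun q => h a P (fun y => Φ ((q : ℝ), y)) ha (by fun_prop) fun y hy =>
        haP (q, y) (subset_tsupport _ hy)
    have hall : ∀ᵐ t ∂(volume.restrict (Ici (0 : ℝ))), ∫ y, G t y * Φ (t, y) = 0 := by
      filter_upwards [ae_all_iff.2 hq] with t ht
      have hc := continuous_integral_mul_of_compactSupport (hGm t) (hC t) hΦcont hΦc
      have := Continuous.ext_on Rat.denseRange_cast hc continuous_const (g := fun _ => (0 : ℝ))
        (by rintro _ ⟨q, rfl⟩; exact ht q)
      exact congr_fun this t
    have hint : Integrable (fun p => Φ p • Function.uncurry G p) (volume.prod volume) :=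
      hloc.integrable_smul_left_of_hasCompactSupport hΦcont hΦc
    change ∫ p, Φ p • Function.uncurry G p ∂(volume.prod volume) = 0
    rw [integral_prod _ hint, ← setIntegral_eq_integral_of_forall_compl_eq_zero (s := Ici (0 : ℝ))]
    · refine integral_eq_zero_of_ae ?_
      filter_upwards [hall] with t ht
      rw [Pi.zero_apply, ← ht]
      refine integral_congr_ae (.of_forall fun y => ?_)
      simp [mul_comm]
    · intro t ht
      refine integral_eq_zero_of_ae (.of_forall fun y => ?_)
      have : (t, y) ∉ tsupport Φ := fun hm => by
        have h1 : 0 < t := (hΦs hm).1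
        exact ht h1.le
      simp [image_eq_zero_of_notMem_tsupport this]

namespace Driven

variable {A C : ℝ} {U : ℝ → ℝ → Plane → Plane} {ζ ζ' : ℝ → Plane} {ω : ℝ → Plane → ℝ}
  {ω₀ : Plane → ℝ}

theorem measurePreserving_fullFlow (h : Driven A C U ζ ζ' ω) {t : ℝ} (ht : 0 ≤ t) :
    MeasurePreserving (fullFlow U ζ 0 t) :=
  (measurePreserving_add_left volume (ζ t)).comp
    ((h.measurePreserving_vortexFlow ht).comp (measurePreserving_sub_right volume (ζ 0)))

theorem measurePreserving_fullFlow_left (h : Driven A C U ζ ζ' ω) {t : ℝ} (ht : 0 ≤ t) :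
    MeasurePreserving (fullFlow U ζ t 0) :=
  MeasurePreserving.symm (h.frame.fullEquiv 0 t) (h.measurePreserving_fullFlow ht)

theorem integral_comp_fullFlow (h : Driven A C U ζ ζ' ω) {E : Type*} [NormedAddCommGroup E]
    [NormedSpace ℝ E] {t : ℝ} (ht : 0 ≤ t) (f : Plane → E) :
    ∫ x, f (fullFlow U ζ 0 t x) = ∫ x, f x :=
  (h.measurePreserving_fullFlow ht).integral_comp
    (h.frame.fullEquiv 0 t).measurableEmbedding f

/-- By area preservation the conserved integrals say that the pull-back of ω(t) by the flow and the
datum have the same integral against every Ψ supported in an annulus around the vortex. -/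
theorem ae_eq_transported (h : Driven A C U ζ ζ' ω)
    (w : WeakTransport C (fullDrift U ζ ζ') ω₀ ω) :
    ∀ᵐ t ∂(volume.restrict (Ici (0 : ℝ))), ω t =ᵐ[volume] transported U ζ ω₀ t := by
  set G : ℝ → Plane → ℝ := fun t y => ω t (ζ t + vortexFlow U 0 t y) - ω₀ (ζ 0 + y) with hG
  have hm1 : Measurable fun p : ℝ × Plane => ω p.1 (ζ p.1 + vortexFlow U 0 p.1 p.2) :=
    h.meas.comp (measurable_fst.prodMk ((h.frame.continuous.measurable.comp measurable_fst).add
      (h.frame.measurable_vortexFlow.comp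
        (measurable_const.prodMk (measurable_fst.prodMk measurable_snd)))))
  have hm2 : Measurable fun y : Plane => ω₀ (ζ 0 + y) :=
    w.meas₀.comp (measurable_const.add measurable_id)
  have hGm : Measurable (Function.uncurry G) := hm1.sub (hm2.comp measurable_snd)
  have hi : ∀ {f Ψ : Plane → ℝ} {a P : ℝ}, Measurable f → (∀ y, |f y| ≤ C) → Continuous Ψ →
      (∀ y, Ψ y ≠ 0 → a ≤ ‖y‖ ∧ ‖y‖ ≤ P) → Integrable fun y => f y * Ψ y := by
    intro f Ψ a P hf hfC hΨ hs
    refine (hΨ.integrable_of_hasCompactSupport ?_).bdd_mul hf.aestronglyMeasurable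
      (.of_forall fun y => hfC y)
    exact HasCompactSupport.intro (isCompact_closedBall 0 P) fun x hx => by
      by_contra hne
      exact hx (by simpa using (hs x hne).2)
  have key := ae_eq_zero_of_integral_mul_eq_zero (C := C + C) hGm
    (fun t y => (abs_sub _ _).trans (add_le_add (w.bdd _ _) (w.bdd₀ _)))
    (fun a P Ψ ha hΨ hs => ?_)
  · filter_upwards [key, ae_restrict_mem measurableSet_Ici] with t ht ht0
    have hmp : MeasurePreserving fun x => vortexFlow U t 0 (x - ζ t) :=
      (h.measurePreserving_vortexFlow_left ht0).comp (measurePreserving_sub_right volume (ζ t))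
    filter_upwards [hmp.quasiMeasurePreserving.ae ht] with x hx
    simp only [hG, h.frame.vortexFlow_comp, h.frame.vortexFlow_self, add_sub_cancel] at hx
    exact sub_eq_zero.1 hx
  · filter_upwards [h.frame.ae_integral_transport w ha hΨ hs,
      ae_restrict_mem measurableSet_Ici] with t ht ht0
    have e1 : ∫ x, ω t x * Ψ (vortexFlow U t 0 (x - ζ t)) =
        ∫ y, ω t (ζ t + vortexFlow U 0 t y) * Ψ y := by
      rw [← integral_add_left_eq_self (fun x => ω t x * Ψ (vortexFlow U t 0 (x - ζ t))) (ζ t),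
        ← (h.measurePreserving_vortexFlow ht0).integral_comp
          (h.frame.flowEquiv 0 t).measurableEmbedding]
      simp_rw [add_sub_cancel_left, h.frame.vortexFlow_comp, h.frame.vortexFlow_self]
    have e2 : ∫ x, ω₀ x * Ψ (x - ζ 0) = ∫ y, ω₀ (ζ 0 + y) * Ψ y := by
      rw [← integral_add_left_eq_self (fun x => ω₀ x * Ψ (x - ζ 0)) (ζ 0)]
      simp_rw [add_sub_cancel_left]
    simp only [hG, sub_mul]
    rw [integral_sub (hi (f := fun y => ω t (ζ t + vortexFlow U 0 t y))
      (hm1.comp measurable_prodMk_left) (fun y => w.bdd _ _) hΨ hs)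
      (hi (f := fun y => ω₀ (ζ 0 + y)) hm2 (fun y => w.bdd₀ _) hΨ hs), ← e1, ← e2, ht, sub_self]

theorem boundedL1_transported (h : Driven A C U ζ ζ' ω) (hω₀ : BoundedL1 C ω₀) {t : ℝ}
    (ht : 0 ≤ t) : BoundedL1 C (transported U ζ ω₀ t) where
  integrable := (h.measurePreserving_fullFlow_left ht).integrable_comp_of_integrable
    hω₀.integrable
  abs_le x := hω₀.abs_le _
  integral_le := by
    have := (h.measurePreserving_fullFlow_left ht).integral_comp
      (h.frame.fullEquiv t 0).measurableEmbedding fun x => |ω₀ x|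
    unfold transported
    rw [this]
    exact hω₀.integral_le

/-- The change of variables by the flow leaves a fixed density and moves the time dependence into
the continuous bounded kernel. -/
theorem continuousOn_smoothVelocity_transported (h : Driven A C U ζ ζ' ω) (hω₀ : BoundedL1 C ω₀)
    {e : ℝ} (he : 0 < e) (x : Plane) :
    ContinuousOn (fun t => smoothVelocity e (transported U ζ ω₀ t) x) (Ici 0) := by
  have hc : Continuous fun t => ∫ y, ω₀ y • kern e (x - fullFlow U ζ 0 t y) := by
    refine continuous_of_dominated (bound := fun y => |ω₀ y| * e⁻¹) (fun t => ?_)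
      (fun t => .of_forall fun y => ?_) (hω₀.integrable.abs.mul_const _) (.of_forall fun y => ?_)
    · exact hω₀.integrable.aestronglyMeasurable.smul ((continuous_kern he.ne').measurable.comp
        (measurable_const.sub (h.frame.measurable_fullFlow_apply 0 t))).aestronglyMeasurable
    · rw [norm_smul]
      exact mul_le_mul_of_nonneg_left (norm_kern_le_inv he _) (norm_nonneg _)
    · suffices hs : Continuous fun t => fullFlow U ζ 0 t y from
        ((continuous_kern he.ne').comp (continuous_const.sub hs)).const_smul (ω₀ y)
      refine h.frame.continuous.add ?_
      rcases eq_or_ne (y - ζ 0) 0 with h0 | h0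
      · simp_rw [h0, vortexFlow_zero]; exact continuous_const
      · exact h.frame.field.continuousOn_flow.comp_continuous
          (f := fun t : ℝ => ((0, t, y - ζ 0) : ℝ × ℝ × Plane)) (by fun_prop) fun s => h0
  refine hc.continuousOn.congr fun t ht => ?_
  dsimp only [smoothVelocity]
  rw [← h.integral_comp_fullFlow ht]
  refine integral_congr_ae (.of_forall fun y => ?_)
  simp only [transported, h.frame.fullFlow_comp, h.frame.fullFlow_self]

/-- Both sides agree for almost every time and are continuous in t, the left one as a uniform limit
of smoothed velocities; hence they agree for every t ≥ 0. -/
theorem biotSavart_transported (h : Driven A C U ζ ζ' ω) (hω₀ : BoundedL1 C ω₀)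
    (w : WeakTransport C (fullDrift U ζ ζ') ω₀ ω) {t : ℝ} (ht : 0 ≤ t) (x : Plane) :
    biotSavart (transported U ζ ω₀ t) x = ζ' t + U 0 t (x - ζ t) := by
  have hc : ContinuousOn (fun t => smoothVelocity 0 (transported U ζ ω₀ t) x) (Ici 0) := by
    have hlim : TendstoUniformlyOn
        (fun (n : ℕ) t => smoothVelocity (1 / ((n : ℝ) + 1)) (transported U ζ ω₀ t) x)
        (fun t => smoothVelocity 0 (transported U ζ ω₀ t) x) Filter.atTop (Ici 0) := by
      rw [Metric.tendstoUniformlyOn_iff]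
      intro θ hθ
      have hz : Filter.Tendsto (fun n : ℕ => C * kernConst * (1 / ((n : ℝ) + 1))) Filter.atTop
          (nhds 0) := by
        simpa using tendsto_one_div_add_atTop_nhds_zero_nat.const_mul (C * kernConst)
      filter_upwards [hz.eventually (gt_mem_nhds hθ)] with n hn s hs
      rw [dist_comm, dist_eq_norm]
      exact ((h.boundedL1_transported hω₀ hs).norm_smoothVelocity_sub_le (by positivity) x).trans_lt hn
    exact hlim.continuousOn (.of_forall fun n =>
      h.continuousOn_smoothVelocity_transported hω₀ (by positivity) x)
  have hc' : Continuous fun t => ζ' t + U 0 t (x - ζ t) :=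
    h.frame.continuous_deriv.add ((h.frame.field.reg.cont 0 (by simp)).comp
      (continuous_id.prodMk (continuous_const.sub h.frame.continuous)))
  have key : EqOn (fun t => smoothVelocity 0 (transported U ζ ω₀ t) x)
      (fun t => ζ' t + U 0 t (x - ζ t)) (Ici 0) := by
    refine Measure.eqOn_of_ae_eq (μ := volume) ?_ hc hc'.continuousOn
      (by rw [interior_Ici, closure_Ioi])
    filter_upwards [h.ae_eq_transported w, h.drift] with s hs hs'
    rw [hs', smoothVelocity_zero]
    refine integral_congr_ae ?_
    filter_upwards [hs] with y hy
    rw [hy]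
  have : smoothVelocity 0 (transported U ζ ω₀ t) x = ζ' t + U 0 t (x - ζ t) := key ht
  rwa [smoothVelocity_zero] at this

end Driven

end VortexWave


namespace VortexWave

/-! ### Regularity in time of the velocity -/

/-- A bounded integrable weak solution of the vorticity equation for a vortex moving along `z`. -/
structure WeakVorticity (C : ℝ) (ω₀ : Plane → ℝ) (z : ℝ → Plane) (ω : ℝ → Plane → ℝ) : Prop where
  meas : Measurable (Function.uncurry ω)
  bdd : ∀ t, BoundedL1 C (ω t)
  meas₀ : Measurable ω₀
  bdd₀ : BoundedL1 C ω₀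
  cont : Continuous z
  weak : ∀ ψ : ℝ × Plane → ℝ, ContDiff ℝ (⊤ : ℕ∞) ψ → HasCompactSupport ψ →
    -∫ x, ω₀ x * ψ (0, x) = ∫ t in Ici (0 : ℝ), ∫ x, ω t x *
      fderiv ℝ ψ (t, x) (1, biotSavart (ω t) x + kernel (x - z t))

theorem kernConst_nonneg : 0 ≤ kernConst := by
  have h : BoundedL1 1 fun _ : Plane => (0 : ℝ) := ⟨by simp, by simp, by simp⟩
  simpa using (norm_nonneg _).trans (h.norm_smoothVelocity_le 0 0)

theorem measurable_smoothVelocity {ω : ℝ → Plane → ℝ} (hω : Measurable (Function.uncurry ω)) (e : ℝ) :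
    Measurable fun p : ℝ × Plane => smoothVelocity e (ω p.1) p.2 := by
  have : Measurable fun q : (ℝ × Plane) × Plane => ω q.1.1 q.2 • kern e (q.1.2 - q.2) :=
    (hω.comp ((measurable_fst.comp measurable_fst).prodMk measurable_snd)).smul
      ((measurable_kern e).comp ((measurable_snd.comp measurable_fst).sub measurable_snd))
  exact this.stronglyMeasurable.integral_prod_right'.measurable

theorem measurable_biotSavart {ω : ℝ → Plane → ℝ} (hω : Measurable (Function.uncurry ω)) :
    Measurable fun p : ℝ × Plane => biotSavart (ω p.1) p.2 := by
  simpa only [smoothVelocity_zero] using measurable_smoothVelocity hω 0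

theorem BoundedL1.integral_mul_norm_velocity_le {C : ℝ} {f : Plane → ℝ} (h : BoundedL1 C f)
    (hm : Measurable (biotSavart f)) (a : Plane) :
    Integrable (fun x => |f x| * ‖biotSavart f x + kernel (x - a)‖) ∧
    ∫ x, |f x| * ‖biotSavart f x + kernel (x - a)‖ ≤
      C * (C * kernConst) + C * kernConst := by
  have hC := h.nonneg
  have hi := h.integrable_inv a
  have hdom : Integrable fun x => |f x| * (C * kernConst) + |f x| * ‖a - x‖⁻¹ :=
    (h.integrable.abs.mul_const _).add hi.1
  have hle : ∀ x, |f x| * ‖biotSavart f x + kernel (x - a)‖ ≤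
      |f x| * (C * kernConst) + |f x| * ‖a - x‖⁻¹ := by
    intro x
    rw [← mul_add]
    refine mul_le_mul_of_nonneg_left ((norm_add_le _ _).trans (add_le_add ?_ ?_)) (abs_nonneg _)
    · rw [← smoothVelocity_zero]; exact h.norm_smoothVelocity_le 0 x
    · rw [← kern_zero_left, norm_sub_rev]; exact norm_kern_le 0 _
  have hm' : Measurable fun x => biotSavart f x + kernel (x - a) :=
    hm.add (measurable_kernel.comp (measurable_id.sub_const _))
  have hint : Integrable (fun x => |f x| * ‖biotSavart f x + kernel (x - a)‖) :=
    hdom.mono' (h.integrable.abs.aestronglyMeasurable.mul hm'.norm.aestronglyMeasurable)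
      (.of_forall fun x => by
        rw [Real.norm_of_nonneg (by positivity)]; exact hle x)
  refine ⟨hint, (integral_mono hint hdom hle).trans ?_⟩
  rw [integral_add (h.integrable.abs.mul_const _) hi.1, integral_mul_const]
  refine add_le_add (mul_le_mul_of_nonneg_right h.integral_le ?_) hi.2
  exact mul_nonneg hC kernConst_nonneg

namespace WeakVorticity

variable {C : ℝ} {ω₀ : Plane → ℝ} {z : ℝ → Plane} {ω : ℝ → Plane → ℝ}

theorem integral_bound (h : WeakVorticity C ω₀ z ω) (t : ℝ) :
    Integrable (fun x => |ω t x| * ‖biotSavart (ω t) x + kernel (x - z t)‖) ∧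
    ∫ x, |ω t x| * ‖biotSavart (ω t) x + kernel (x - z t)‖ ≤
      C * (C * kernConst) + C * kernConst :=
  (h.bdd t).integral_mul_norm_velocity_le
    ((measurable_biotSavart h.meas).comp (measurable_prodMk_left (x := t))) (z t)

/-- Testing with χ(t) g(x) identifies the weak time derivative of ∫ ω g, which is bounded because
the total velocity is integrable against |ω|. The constant depends on g only through the sup of its
gradient, so it survives the removal of spatial cut-offs. -/
theorem exists_lipschitz_rep (h : WeakVorticity C ω₀ z ω) {g : Plane → ℝ}
    (hg : ContDiff ℝ (⊤ : ℕ∞) g) (hgc : HasCompactSupport g) {L : ℝ}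
    (hL : ∀ x, ‖fderiv ℝ g x‖ ≤ L) :
    ∃ P : ℝ → ℝ, (∀ s t, |P t - P s| ≤ L * (C * (C * kernConst) + C * kernConst) * |t - s|) ∧
      ∀ᵐ t ∂(volume.restrict (Ici (0 : ℝ))), ∫ x, ω t x * g x = P t := by
  set B := C * (C * kernConst) + C * kernConst with hB
  have hL0 : 0 ≤ L := (norm_nonneg _).trans (hL 0)
  have hC := (h.bdd 0).nonneg
  have hum : Measurable fun p : ℝ × Plane => biotSavart (ω p.1) p.2 + kernel (p.2 - z p.1) :=
    (measurable_biotSavart h.meas).add (measurable_kernel.comp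
      (measurable_snd.sub (h.cont.measurable.comp measurable_fst)))
  set F : ℝ → ℝ := fun t => ∫ x, ω t x * g x with hF
  set G : ℝ → ℝ := fun t => ∫ x, ω t x * fderiv ℝ g x (biotSavart (ω t) x + kernel (x - z t))
    with hG
  obtain ⟨Q, hQ⟩ := hg.continuous.bounded_above_of_compact_support hgc
  have hQ0 : 0 ≤ Q := (norm_nonneg _).trans (hQ 0)
  have hFi : ∀ t, Integrable fun x => ω t x * g x := fun t =>
    (h.bdd t).integrable.mul_bdd hg.continuous.aestronglyMeasurable (.of_forall hQ)
  have hgm : Measurable fun p : ℝ × Plane =>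
      fderiv ℝ g p.2 (biotSavart (ω p.1) p.2 + kernel (p.2 - z p.1)) :=
    (isBoundedBilinearMap_apply (𝕜 := ℝ) (E := Plane) (F := ℝ)).continuous.measurable.comp
      (((hg.continuous_fderiv (by simp)).measurable.comp measurable_snd).prodMk hum)
  have hGle : ∀ t x, ‖ω t x * fderiv ℝ g x (biotSavart (ω t) x + kernel (x - z t))‖ ≤
      L * (|ω t x| * ‖biotSavart (ω t) x + kernel (x - z t)‖) := fun t x => by
    rw [norm_mul, Real.norm_eq_abs, mul_left_comm]
    exact mul_le_mul_of_nonneg_left (((fderiv ℝ g x).le_opNorm _).trans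
      (mul_le_mul_of_nonneg_right (hL x) (norm_nonneg _))) (abs_nonneg _)
  have hGi : ∀ t, Integrable fun x =>
      ω t x * fderiv ℝ g x (biotSavart (ω t) x + kernel (x - z t)) := fun t =>
    ((h.integral_bound t).1.const_mul L).mono' ((h.bdd t).integrable.aestronglyMeasurable.mul
      (hgm.comp measurable_prodMk_left).aestronglyMeasurable) (.of_forall (hGle t))
  have hFm : Measurable F :=
    (h.meas.mul (hg.continuous.measurable.comp
      measurable_snd)).stronglyMeasurable.integral_prod_right.measurable
  have hGm : Measurable G := (h.meas.mul hgm).stronglyMeasurable.integral_prod_right.measurable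
  have hFb : ∀ t, |F t| ≤ C * Q := fun t => by
    calc |F t| ≤ ∫ x, |ω t x| * Q := norm_integral_le_of_norm_le
          (f := fun x => ω t x * g x) ((h.bdd t).integrable.abs.mul_const _) (.of_forall fun x => by
            rw [norm_mul]; exact mul_le_mul_of_nonneg_left (hQ x) (norm_nonneg _))
      _ ≤ C * Q := by
          rw [integral_mul_const]; exact mul_le_mul_of_nonneg_right (h.bdd t).integral_le hQ0
  have hGb : ∀ t, |G t| ≤ L * B := fun t => by
    calc |G t| ≤ ∫ x, L * (|ω t x| * ‖biotSavart (ω t) x + kernel (x - z t)‖) :=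
          norm_integral_le_of_norm_le ((h.integral_bound t).1.const_mul L) (.of_forall (hGle t))
      _ ≤ L * B := by
          rw [integral_const_mul]; exact mul_le_mul_of_nonneg_left (h.integral_bound t).2 hL0
  refine ⟨fun t => (∫ x, ω₀ x * g x) + ∫ s in (0 : ℝ)..t, G s, fun s t => ?_,
    ae_eq_primitive_of_integral_deriv (C := max (C * Q) (L * B)) hFm hGm
      (fun t => (hFb t).trans (le_max_left _ _)) (fun t => (hGb t).trans (le_max_right _ _))
      fun χ hχ hχc => ?_⟩
  · have hGint : ∀ a b, IntervalIntegrable G volume a b := fun a b =>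
      (intervalIntegrable_const (c := L * B)).mono_fun hGm.aestronglyMeasurable
        (.of_forall fun t => (hGb t).trans (le_abs_self _))
    rw [add_sub_add_left_eq_sub, intervalIntegral.integral_interval_sub_left (hGint _ _) (hGint _ _)]
    exact intervalIntegral.norm_integral_le_of_norm_le_const (f := G) fun t _ => hGb t
  · have hψ : ContDiff ℝ (⊤ : ℕ∞) fun p : ℝ × Plane => χ p.1 * g p.2 :=
      (hχ.comp contDiff_fst).mul (hg.comp contDiff_snd)
    have hψc : HasCompactSupport fun p : ℝ × Plane => χ p.1 * g p.2 := by
      refine HasCompactSupport.intro (hχc.isCompact.prod hgc.isCompact) fun p hp => ?_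
      rw [mem_prod, not_and_or] at hp
      rcases hp with hp | hp
      · rw [image_eq_zero_of_notMem_tsupport hp, zero_mul]
      · rw [image_eq_zero_of_notMem_tsupport hp, mul_zero]
    have hw := h.weak _ hψ hψc
    have e0 : ∫ x, ω₀ x * (χ 0 * g x) = χ 0 * ∫ x, ω₀ x * g x := by
      rw [← integral_const_mul]
      exact integral_congr_ae (.of_forall fun x => by dsimp only; ring)
    dsimp only at hw
    rw [e0] at hw
    rw [hw]
    refine integral_congr_ae (.of_forall fun t => ?_)
    have hd : ∀ x v, fderiv ℝ (fun p : ℝ × Plane => χ p.1 * g p.2) (t, x) (1, v) =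
        deriv χ t * g x + χ t * fderiv ℝ g x v := by
      intro x v
      have h1 : HasFDerivAt (fun p : ℝ × Plane => χ p.1)
          ((deriv χ t) • (ContinuousLinearMap.fst ℝ ℝ Plane)) (t, x) :=
        ((hχ.differentiable (by simp) t).hasDerivAt).comp_hasFDerivAt (t, x) hasFDerivAt_fst
      have h2 : HasFDerivAt (fun p : ℝ × Plane => g p.2)
          ((fderiv ℝ g x).comp (ContinuousLinearMap.snd ℝ ℝ Plane)) (t, x) :=
        (hg.differentiable (by simp) x).hasFDerivAt.comp (t, x) hasFDerivAt_snd
      have h3 := (h1.mul h2).fderiv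
      rw [show (fun p : ℝ × Plane => χ p.1 * g p.2) =
        (fun p : ℝ × Plane => χ p.1) * fun p : ℝ × Plane => g p.2 from rfl, h3]
      simp
      ring
    simp only [hd, hG]
    rw [← integral_const_mul, ← integral_const_mul, ← integral_add ((hFi t).const_mul _)
      ((hGi t).const_mul _)]
    exact integral_congr_ae (.of_forall fun x => by dsimp only; ring)

end WeakVorticity

end VortexWave


/-! ### Lipschitz continuity in time of the smoothed velocities -/

namespace VortexWave

theorem abs_apply_le_norm (v : Plane) (i : Fin 2) : |v i| ≤ ‖v‖ := by
  simpa using PiLp.norm_apply_le v i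

theorem norm_le_add_abs (v : Plane) : ‖v‖ ≤ |v 0| + |v 1| := by
  rw [← abs_of_nonneg (norm_nonneg v), ← abs_of_nonneg (by positivity : 0 ≤ |v 0| + |v 1|),
    ← sq_le_sq, norm_sq_plane]
  nlinarith [sq_abs (v 0), sq_abs (v 1), abs_nonneg (v 0), abs_nonneg (v 1),
    mul_nonneg (abs_nonneg (v 0)) (abs_nonneg (v 1))]

theorem smoothVelocity_apply {C : ℝ} {f : Plane → ℝ} (hf : BoundedL1 C f) (e : ℝ) (x : Plane)
    (i : Fin 2) : smoothVelocity e f x i = ∫ y, f y * kern e (x - y) i := by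
  have h := (EuclideanSpace.proj (𝕜 := ℝ) i).integral_comp_comm (hf.integrable_kern e x)
  rw [smoothVelocity]
  simpa using h.symm

theorem norm_kern_sub_kern_le_of_pos {e : ℝ} (he : 0 < e) (x y : Plane) :
    ‖kern e x - kern e y‖ ≤ 2 * (e ^ 2)⁻¹ * ‖x - y‖ := by
  refine (norm_kern_sub_kern_le (by positivity) (by positivity)).trans ?_
  refine mul_le_mul_of_nonneg_right ?_ (norm_nonneg _)
  have h : ∀ w : Plane, (‖w‖ ^ 2 + e ^ 2)⁻¹ ≤ (e ^ 2)⁻¹ := fun w =>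
    inv_anti₀ (by positivity) (by nlinarith [sq_nonneg ‖w‖])
  linarith [h x, h y]

/-- A dilated bump times a component of the smoothed kernel. Dilation factors at most 1 keep the
gradient bounded uniformly in the radius n and the centre x: bump gradient times kernel sup, plus
the Lipschitz constant of the kernel. -/
theorem exists_cutoff_kern {e : ℝ} (he : 0 < e) :
    ∃ L : ℝ, ∀ (n : ℕ) (x : Plane) (i : Fin 2), ∃ g : Plane → ℝ, ContDiff ℝ (⊤ : ℕ∞) g ∧
      HasCompactSupport g ∧ (∀ y, ‖fderiv ℝ g y‖ ≤ L) ∧ (∀ y, |g y| ≤ e⁻¹) ∧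
      ∀ y, ‖y‖ ≤ n → g y = kern e (x - y) i := by
  set η : ContDiffBump (0 : Plane) := ⟨1, 2, one_pos, by norm_num⟩ with hη
  have hηs : ContDiff ℝ (⊤ : ℕ∞) η := η.contDiff
  obtain ⟨K, hK⟩ := (hηs.of_le (by simp)).lipschitzWith_of_hasCompactSupport (n := 1)
    η.hasCompactSupport one_ne_zero
  have hK' : ∀ y y', |η y - η y'| ≤ K * ‖y - y'‖ := fun y y' => by
    simpa [dist_eq_norm] using hK.dist_le_mul y y'
  refine ⟨K * e⁻¹ + 2 * (e ^ 2)⁻¹, fun n x i => ?_⟩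
  set c : ℝ := ((n : ℝ) + 1)⁻¹ with hc
  have hc0 : 0 < c := by positivity
  have hc1 : c ≤ 1 := inv_le_one_of_one_le₀ (by linarith [n.cast_nonneg (α := ℝ)])
  set k : Plane → ℝ := fun y => kern e (x - y) i with hk
  have hks : ContDiff ℝ (⊤ : ℕ∞) k :=
    (contDiff_piLp_apply 2 (i := i)).comp ((contDiff_kern he.ne').comp
      (contDiff_const.sub contDiff_id))
  have hkb : ∀ y, |k y| ≤ e⁻¹ := fun y => (abs_apply_le_norm _ i).trans (norm_kern_le_inv he _)
  have hkl : ∀ y y', |k y - k y'| ≤ 2 * (e ^ 2)⁻¹ * ‖y - y'‖ := fun y y' => by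
    have h1 := norm_kern_sub_kern_le_of_pos he (x - y) (x - y')
    rw [sub_sub_sub_cancel_left, norm_sub_rev y' y] at h1
    exact (abs_apply_le_norm (kern e (x - y) - kern e (x - y')) i).trans h1
  have hη1 : ∀ y, |η y| ≤ 1 := fun y => by
    rw [abs_of_nonneg (η.nonneg)]; exact η.le_one
  have hgs : ContDiff ℝ (⊤ : ℕ∞) fun y => η (c • y) * k y :=
    (hηs.comp (contDiff_const_smul c)).mul hks
  refine ⟨fun y => η (c • y) * k y, hgs, ?_, fun y => ?_, fun y => ?_, fun y hy => ?_⟩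
  · exact (η.hasCompactSupport.comp_smul hc0.ne').mul_right
  · refine norm_fderiv_le_of_lip' ℝ (by positivity) (.of_forall fun y' => ?_)
    have h1 : η (c • y') * k y' - η (c • y) * k y =
        (η (c • y') - η (c • y)) * k y' + η (c • y) * (k y' - k y) := by ring
    rw [h1, add_mul]
    refine (norm_add_le _ _).trans (add_le_add ?_ ?_)
    · rw [norm_mul, mul_right_comm]
      refine mul_le_mul ((hK' _ _).trans ?_) (hkb _) (norm_nonneg _) (by positivity)
      rw [← smul_sub, norm_smul, Real.norm_of_nonneg hc0.le]
      have := mul_le_mul_of_nonneg_right hc1 (norm_nonneg (y' - y))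
      rw [one_mul] at this
      exact mul_le_mul_of_nonneg_left this K.coe_nonneg
    · rw [norm_mul]
      have := mul_le_mul (hη1 (c • y)) (hkl y' y) (abs_nonneg _) zero_le_one
      rwa [one_mul] at this
  · rw [abs_mul]
    have := mul_le_mul (hη1 (c • y)) (hkb y) (abs_nonneg _) zero_le_one
    rwa [one_mul] at this
  · have : η (c • y) = 1 := by
      refine η.one_of_mem_closedBall ?_
      rw [mem_closedBall_zero_iff, norm_smul, Real.norm_of_nonneg hc0.le]
      change c * ‖y‖ ≤ 1
      rw [hc, inv_mul_le_iff₀ (by positivity)]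
      linarith
    dsimp only
    rw [this, one_mul]

theorem BoundedL1.continuous_smoothVelocity {C : ℝ} {f : Plane → ℝ} (h : BoundedL1 C f) {e : ℝ}
    (he : e ∈ Icc (0 : ℝ) 1) : Continuous (smoothVelocity e f) := by
  have hpos : ∀ e, 0 < e → e ≤ 1 → Continuous (smoothVelocity e f) := fun e he he1 => by
    refine (LipschitzWith.of_dist_le_mul (K := Real.toNNReal
      (2 * C * kernConst * (1 + Real.log (1 / e)))) fun x y => ?_).continuous
    have hC := h.nonneg
    have hk := kernConst_nonneg
    have hl : 0 ≤ Real.log (1 / e) := Real.log_nonneg (by rw [le_div_iff₀ he]; linarith)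
    rw [Real.coe_toNNReal _ (by positivity), dist_eq_norm, dist_eq_norm]
    exact h.lipschitz_smoothVelocity he he1 x y
  rcases he.1.eq_or_lt with h0 | h0
  · subst h0
    have hlim : TendstoUniformly (fun (n : ℕ) => smoothVelocity (1 / ((n : ℝ) + 1)) f)
        (smoothVelocity 0 f) Filter.atTop := by
      rw [Metric.tendstoUniformly_iff]
      intro θ hθ
      have hz : Filter.Tendsto (fun n : ℕ => C * kernConst * (1 / ((n : ℝ) + 1))) Filter.atTop
          (nhds 0) := by
        simpa using tendsto_one_div_add_atTop_nhds_zero_nat.const_mul (C * kernConst)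
      filter_upwards [hz.eventually (gt_mem_nhds hθ)] with n hn x
      rw [dist_comm, dist_eq_norm]
      exact (h.norm_smoothVelocity_sub_le (by positivity) x).trans_lt hn
    refine hlim.continuous (.of_forall fun n => hpos _ (by positivity) ?_)
    rw [div_le_one (by positivity)]
    linarith [n.cast_nonneg (α := ℝ)]
  · exact hpos e h0 he.2

namespace WeakVorticity

variable {C : ℝ} {ω₀ : Plane → ℝ} {z : ℝ → Plane} {ω : ℝ → Plane → ℝ}

/-- One null set must serve all points and scales. It is taken for countably many scales, cut-off
radii, centres in a dense sequence and components; removing the cut-off and then using density of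
the centres covers every x. The factor 2 sums the two components. -/
theorem exists_good_set (h : WeakVorticity C ω₀ z ω) :
    ∃ S : Set ℝ, S ⊆ Ici 0 ∧ (∀ᵐ t ∂(volume.restrict (Ici (0 : ℝ))), t ∈ S) ∧
      ∀ n : ℕ, ∃ D : ℝ, ∀ s ∈ S, ∀ t ∈ S, ∀ x,
        ‖smoothVelocity (1 / ((n : ℝ) + 1)) (ω t) x -
          smoothVelocity (1 / ((n : ℝ) + 1)) (ω s) x‖ ≤ D * |t - s| := by
  have hpos : ∀ n : ℕ, 0 < 1 / ((n : ℝ) + 1) := fun n => by positivity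
  choose L hL using fun n : ℕ => exists_cutoff_kern (hpos n)
  choose g hgs hgc hgL hgb hg using hL
  choose P hP hPe using fun (n R : ℕ) (k : ℕ) (i : Fin 2) =>
    h.exists_lipschitz_rep (hgs n R (TopologicalSpace.denseSeq Plane k) i) (hgc n R _ i)
      (hgL n R _ i)
  set B := C * (C * kernConst) + C * kernConst with hB
  refine ⟨{t | 0 ≤ t ∧ ∀ (n R k : ℕ) (i : Fin 2),
    ∫ y, ω t y * g n R (TopologicalSpace.denseSeq Plane k) i y = P n R k i t}, fun t ht => ht.1,
    ?_, fun n => ⟨2 * (L n * B), fun s hs t ht => ?_⟩⟩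
  · have hall : ∀ᵐ t ∂(volume.restrict (Ici (0 : ℝ))), ∀ (n R k : ℕ) (i : Fin 2),
        ∫ y, ω t y * g n R (TopologicalSpace.denseSeq Plane k) i y = P n R k i t :=
      ae_all_iff.2 fun n => ae_all_iff.2 fun R => ae_all_iff.2 fun k => ae_all_iff.2 fun i =>
        hPe n R k i
    filter_upwards [hall, ae_restrict_mem measurableSet_Ici] with t h1 h2
    exact ⟨h2, h1⟩
  · set e : ℝ := 1 / ((n : ℝ) + 1) with he
    have he0 : 0 < e := hpos n
    have he1 : e ≤ 1 := by
      rw [he, div_le_one (by positivity)]; linarith [n.cast_nonneg (α := ℝ)]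
    have hcomp : ∀ (k : ℕ) (i : Fin 2),
        |smoothVelocity e (ω t) (TopologicalSpace.denseSeq Plane k) i -
          smoothVelocity e (ω s) (TopologicalSpace.denseSeq Plane k) i| ≤ L n * B * |t - s| := by
      intro k i
      have hlim : ∀ r, Filter.Tendsto
          (fun R : ℕ => ∫ y, ω r y * g n R (TopologicalSpace.denseSeq Plane k) i y) Filter.atTop
          (nhds (smoothVelocity e (ω r) (TopologicalSpace.denseSeq Plane k) i)) := by
        intro r
        rw [smoothVelocity_apply (h.bdd r)]
        refine tendsto_integral_of_dominated_convergence (fun y => |ω r y| * e⁻¹)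
          (fun R => (h.bdd r).integrable.aestronglyMeasurable.mul
            (hgs n R _ i).continuous.aestronglyMeasurable)
          ((h.bdd r).integrable.abs.mul_const _) (fun R => .of_forall fun y => ?_)
          (.of_forall fun y => ?_)
        · rw [norm_mul]
          exact mul_le_mul_of_nonneg_left (hgb n R _ i y) (norm_nonneg _)
        · refine tendsto_const_nhds.congr' ?_
          obtain ⟨N, hN⟩ := exists_nat_ge ‖y‖
          filter_upwards [Filter.eventually_ge_atTop N] with R hR
          rw [hg n R _ i y (hN.trans (by exact_mod_cast hR))]
      refine le_of_tendsto ((hlim t).sub (hlim s)).abs (.of_forall fun R => ?_)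
      rw [ht.2 n R k i, hs.2 n R k i]
      exact hP n R k i s t
    have hdense : ∀ k : ℕ, ‖smoothVelocity e (ω t) (TopologicalSpace.denseSeq Plane k) -
        smoothVelocity e (ω s) (TopologicalSpace.denseSeq Plane k)‖ ≤ 2 * (L n * B) * |t - s| := by
      intro k
      refine (norm_le_add_abs _).trans ?_
      have h0 := hcomp k 0
      have h1 := hcomp k 1
      simp only [PiLp.sub_apply]
      linarith
    have hc : ∀ r, Continuous (smoothVelocity e (ω r)) := fun r =>
      (h.bdd r).continuous_smoothVelocity ⟨he0.le, he1⟩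
    have hcl : IsClosed {x | ‖smoothVelocity e (ω t) x - smoothVelocity e (ω s) x‖ ≤
        2 * (L n * B) * |t - s|} := isClosed_le ((hc t).sub (hc s)).norm continuous_const
    exact isClosed_property (TopologicalSpace.denseRange_denseSeq Plane) hcl hdense

end WeakVorticity

end VortexWave


/-! ### Extension of the velocity to all times and the moving frame -/

namespace VortexWave

theorem Ici_subset_closure_of_ae {S : Set ℝ}
    (hS : ∀ᵐ t ∂(volume.restrict (Ici (0 : ℝ))), t ∈ S) : Ici 0 ⊆ closure S := by
  have h1 : ∀ᵐ t : ℝ, t ∈ S ∪ Iio 0 := by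
    rw [ae_restrict_iff' measurableSet_Ici] at hS
    filter_upwards [hS] with t ht
    rcases lt_or_ge t 0 with h | h
    · exact Or.inr h
    · exact Or.inl (ht h)
  have h2 : Dense (S ∪ Iio 0) := Measure.dense_of_ae h1
  rw [← closure_Ioi]
  refine closure_minimal ((h2.open_subset_closure_inter isOpen_Ioi).trans
    (closure_mono fun t ht => ?_)) isClosed_closure
  rcases ht.2 with h | h
  · exact h
  · exact absurd (mem_Ioi.1 ht.1) (not_lt.2 (mem_Iio.1 h).le)

/-- Uniform continuity on a dense set of times extends to the half-line; composing with max(t, 0)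
freezes the value for negative times, so that the flow theory can be run on the whole line. -/
theorem exists_continuous_extension {E : Type*} [MetricSpace E] [CompleteSpace E] {S : Set ℝ}
    (hS0 : S ⊆ Ici 0) (hS : Ici 0 ⊆ closure S) {f : ℝ → E}
    (hf : ∀ θ : ℝ, 0 < θ → ∃ δ : ℝ, 0 < δ ∧ ∀ s ∈ S, ∀ t ∈ S, |t - s| < δ →
      dist (f s) (f t) < θ) :
    ∃ V : ℝ → E, Continuous V ∧ (∀ t ∈ S, V t = f t) ∧
      ∀ t, Filter.Tendsto f (nhdsWithin (max t 0) S) (nhds (V t)) := by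
  have : Nonempty E := ⟨f 0⟩
  have hne : ∀ t ∈ Ici (0 : ℝ), (nhdsWithin t S).NeBot := fun t ht =>
    mem_closure_iff_nhdsWithin_neBot.1 (hS ht)
  have hlim : ∀ t ∈ Ici (0 : ℝ), ∃ y, Filter.Tendsto f (nhdsWithin t S) (nhds y) := by
    intro t ht
    have := hne t ht
    refine cauchy_map_iff_exists_tendsto.1 (Metric.cauchy_iff.2 ⟨inferInstance, fun θ hθ => ?_⟩)
    obtain ⟨δ, hδ, H⟩ := hf θ hθ
    refine ⟨f '' (Metric.ball t (δ / 2) ∩ S), Filter.image_mem_map (Filter.inter_mem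
      (nhdsWithin_le_nhds (Metric.ball_mem_nhds t (half_pos hδ))) self_mem_nhdsWithin), ?_⟩
    rintro _ ⟨s, hs, rfl⟩ _ ⟨r, hr, rfl⟩
    refine H s hs.2 r hr.2 ?_
    have h1 := Metric.mem_ball.1 hs.1
    have h2 := Metric.mem_ball.1 hr.1
    have h3 := dist_triangle_right r s t
    rw [← Real.dist_eq]
    linarith
  have hcont : ContinuousOn (extendFrom S f) (Ici 0) := continuousOn_extendFrom hS hlim
  refine ⟨fun t => extendFrom S f (max t 0), ?_, fun t ht => ?_, fun t => ?_⟩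
  · exact hcont.comp_continuous (by fun_prop) fun t => le_max_right t 0
  · have ht0 : max t 0 = t := max_eq_left (hS0 ht)
    have := hne t (hS0 ht)
    obtain ⟨y, hy⟩ := hlim t (hS0 ht)
    have h1 : extendFrom S f t = y := extendFrom_eq (hS (hS0 ht)) hy
    have h2 : f t = y := by
      refine tendsto_nhds_unique ?_ hy
      refine Metric.tendsto_nhds.2 fun θ hθ => ?_
      obtain ⟨δ, hδ, H⟩ := hf θ hθ
      filter_upwards [nhdsWithin_le_nhds (Metric.ball_mem_nhds t hδ), self_mem_nhdsWithin]
        with s hs hsS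
      refine H s hsS t ht ?_
      rwa [Metric.mem_ball, dist_comm, Real.dist_eq] at hs
    dsimp only
    rw [ht0, h1, h2]
  · exact tendsto_extendFrom (hlim _ (le_max_right t 0))

/-- The velocity as a bounded continuous function. -/
noncomputable def BoundedL1.velocityBCF {C : ℝ} {f : Plane → ℝ} (h : BoundedL1 C f) {e : ℝ}
    (he : e ∈ Icc (0 : ℝ) 1) : BoundedContinuousFunction Plane Plane :=
  BoundedContinuousFunction.ofNormedAddCommGroup (smoothVelocity e f)
    (h.continuous_smoothVelocity he) (C * kernConst) (h.norm_smoothVelocity_le e)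

/-- The reciprocal of an integer which approximates the parameter `e` from below. -/
noncomputable def level (e : ℝ) : ℝ :=
  if e ≤ 0 then 0 else 1 / ((⌊1 / e⌋₊ : ℝ) + 1)

theorem level_zero : level 0 = 0 := by simp [level]

theorem level_of_pos {e : ℝ} (he : 0 < e) : level e = 1 / ((⌊1 / e⌋₊ : ℝ) + 1) := by
  simp [level, not_le.2 he]

theorem level_mem (e : ℝ) : level e ∈ Icc (0 : ℝ) 1 := by
  unfold level
  split_ifs with h
  · simp
  · refine ⟨by positivity, ?_⟩
    rw [div_le_one (by positivity)]
    linarith [(⌊1 / e⌋₊).cast_nonneg (α := ℝ)]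

theorem level_le {e : ℝ} (he : 0 < e) : level e ≤ e := by
  rw [level_of_pos he, div_le_iff₀ (by positivity)]
  have := Nat.lt_floor_add_one (1 / e)
  rw [div_lt_iff₀ he] at this
  linarith

/-- Passing to a reciprocal integer at most doubles 1/e, and log 2 < 1 is absorbed. -/
theorem log_level {e : ℝ} (he : e ∈ Ioc (0 : ℝ) 1) :
    1 + Real.log (1 / level e) ≤ 2 * (1 + Real.log (1 / e)) := by
  have he1 : 1 ≤ 1 / e := by rw [le_div_iff₀ he.1]; linarith [he.2]
  have h1 : 1 / level e ≤ 2 * (1 / e) := by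
    rw [level_of_pos he.1, one_div_one_div]
    linarith [Nat.floor_le (by linarith : 0 ≤ 1 / e)]
  have h0 : 0 < 1 / level e := by rw [level_of_pos he.1, one_div_one_div]; positivity
  have h2 := Real.log_le_log h0 h1
  rw [Real.log_mul (by norm_num) (by linarith)] at h2
  have h3 := Real.log_two_lt_d9
  have h4 := Real.log_nonneg he1
  linarith

namespace WeakVorticity

variable {C : ℝ} {ω₀ : Plane → ℝ} {z : ℝ → Plane} {ω : ℝ → Plane → ℝ}

/-- Velocities are viewed as elements of the space of bounded continuous functions, so extension in
time is uniform in x and gives joint continuity. Time regularity is known only at the scales 1/(n +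
1), hence the detour through `level`; the bounds pass to limits of good times. -/
theorem exists_velocity (h : WeakVorticity C ω₀ z ω) :
    ∃ V : ℝ → ℝ → Plane → Plane, (∀ e, Continuous (Function.uncurry (V e))) ∧
      (∀ e t x, ‖V e t x‖ ≤ C * kernConst) ∧
      (∀ e, 0 < e → ∀ t x, ‖V e t x - V 0 t x‖ ≤ C * kernConst * e) ∧
      (∀ e ∈ Ioc (0 : ℝ) 1, ∀ t x y,
        ‖V e t x - V e t y‖ ≤ 4 * C * kernConst * (1 + Real.log (1 / e)) * ‖x - y‖) ∧
      ∀ᵐ t ∂(volume.restrict (Ici (0 : ℝ))), ∀ x, V 0 t x = biotSavart (ω t) x := by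
  obtain ⟨S, hS0, hSae, hS⟩ := h.exists_good_set
  have hScl := Ici_subset_closure_of_ae hSae
  have hC := (h.bdd 0).nonneg
  have hCk : 0 ≤ C * kernConst := mul_nonneg hC kernConst_nonneg
  have hunif : ∀ e, ∀ θ : ℝ, 0 < θ → ∃ δ : ℝ, 0 < δ ∧ ∀ s ∈ S, ∀ t ∈ S, |t - s| < δ →
      dist ((h.bdd s).velocityBCF (level_mem e)) ((h.bdd t).velocityBCF (level_mem e)) < θ := by
    intro e θ hθ
    suffices hs : ∃ δ : ℝ, 0 < δ ∧ ∀ s ∈ S, ∀ t ∈ S, |t - s| < δ → ∀ x,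
        ‖smoothVelocity (level e) (ω t) x - smoothVelocity (level e) (ω s) x‖ ≤ θ / 2 by
      obtain ⟨δ, hδ, H⟩ := hs
      refine ⟨δ, hδ, fun s hs t ht hst => ?_⟩
      refine ((BoundedContinuousFunction.dist_le (half_pos hθ).le).2 fun x => ?_).trans_lt
        (half_lt_self hθ)
      rw [dist_comm, dist_eq_norm]
      exact H s hs t ht hst x
    have hpos : ∀ (n : ℕ) (θ : ℝ), 0 < θ → ∃ δ : ℝ, 0 < δ ∧ ∀ s ∈ S, ∀ t ∈ S, |t - s| < δ → ∀ x,
        ‖smoothVelocity (1 / ((n : ℝ) + 1)) (ω t) x -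
          smoothVelocity (1 / ((n : ℝ) + 1)) (ω s) x‖ ≤ θ := by
      intro n θ hθ
      obtain ⟨D, hD⟩ := hS n
      refine ⟨θ / (|D| + 1), by positivity, fun s hs t ht hst x => (hD s hs t ht x).trans ?_⟩
      rw [lt_div_iff₀ (by positivity)] at hst
      have := mul_le_mul_of_nonneg_right (le_abs_self D) (abs_nonneg (t - s))
      nlinarith [abs_nonneg (t - s)]
    by_cases he : e ≤ 0
    · have hl : level e = 0 := by simp [level, he]
      rw [hl]
      -- The unsmoothed velocity is handled by three errors of size θ/6: two smoothing errors and
      -- one variation in time.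
      obtain ⟨n, hn⟩ : ∃ n : ℕ, C * kernConst * (1 / ((n : ℝ) + 1)) < θ / 6 := by
        have hz : Filter.Tendsto (fun n : ℕ => C * kernConst * (1 / ((n : ℝ) + 1))) Filter.atTop
            (nhds 0) := by
          simpa using tendsto_one_div_add_atTop_nhds_zero_nat.const_mul (C * kernConst)
        exact (hz.eventually (gt_mem_nhds (by positivity))).exists
      obtain ⟨δ, hδ, H⟩ := hpos n (θ / 6) (by positivity)
      refine ⟨δ, hδ, fun s hs t ht hst x => ?_⟩
      have h1 := H s hs t ht hst x
      have hn0 : 0 < 1 / ((n : ℝ) + 1) := by positivity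
      have h2 := (h.bdd t).norm_smoothVelocity_sub_le hn0 x
      have h3 := (h.bdd s).norm_smoothVelocity_sub_le hn0 x
      rw [norm_sub_rev] at h2
      have h4 := norm_sub_le_norm_sub_add_norm_sub (smoothVelocity 0 (ω t) x)
        (smoothVelocity (1 / ((n : ℝ) + 1)) (ω t) x) (smoothVelocity 0 (ω s) x)
      have h5 := norm_sub_le_norm_sub_add_norm_sub (smoothVelocity (1 / ((n : ℝ) + 1)) (ω t) x)
        (smoothVelocity (1 / ((n : ℝ) + 1)) (ω s) x) (smoothVelocity 0 (ω s) x)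
      linarith
    · rw [level_of_pos (not_le.1 he)]
      exact hpos _ _ (half_pos hθ)
  choose W hWc hWS hWt using fun e => exists_continuous_extension hS0 hScl (hunif e)
  have hne : ∀ t, (nhdsWithin (max t 0) S).NeBot := fun t =>
    mem_closure_iff_nhdsWithin_neBot.1 (hScl (le_max_right t 0))
  have hWx : ∀ e t x, Filter.Tendsto (fun s => smoothVelocity (level e) (ω s) x)
      (nhdsWithin (max t 0) S) (nhds (W e t x)) := fun e t x =>
    ((continuous_eval_const x).tendsto _).comp (hWt e t)
  refine ⟨fun e t x => W e t x, fun e => ?_, fun e t x => ?_, fun e he t x => ?_,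
    fun e he t x y => ?_, ?_⟩
  · exact ((hWc e).comp continuous_fst).eval continuous_snd
  · have := hne t
    exact le_of_tendsto (hWx e t x).norm (.of_forall fun s =>
      (h.bdd s).norm_smoothVelocity_le _ x)
  · have := hne t
    refine le_of_tendsto ((hWx e t x).sub (hWx 0 t x)).norm (.of_forall fun s => ?_)
    rw [level_zero]
    refine ((h.bdd s).norm_smoothVelocity_sub_le ?_ x).trans
      (mul_le_mul_of_nonneg_left (level_le he) hCk)
    rw [level_of_pos he]; positivity
  · have := hne t
    refine le_of_tendsto ((hWx e t x).sub (hWx e t y)).norm (.of_forall fun s => ?_)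
    have hl0 : 0 < level e := by rw [level_of_pos he.1]; positivity
    refine ((h.bdd s).lipschitz_smoothVelocity hl0 (level_mem e).2 x y).trans ?_
    refine mul_le_mul_of_nonneg_right ?_ (norm_nonneg _)
    have := mul_le_mul_of_nonneg_left (log_level he) hCk
    linarith
  · filter_upwards [hSae] with t ht x
    have hW : W 0 t x = smoothVelocity (level 0) (ω t) x := by rw [hWS 0 t ht]; rfl
    rw [hW, level_zero, smoothVelocity_zero]

/-- The frame moving with the vortex. -/
theorem exists_driven (h : WeakVorticity C ω₀ z ω) {z₀ : Plane}
    (hz : ∀ t, 0 ≤ t → z t = z₀ + ∫ s in (0 : ℝ)..t, biotSavart (ω s) (z s)) :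
    ∃ (A : ℝ) (U : ℝ → ℝ → Plane → Plane) (ζ ζ' : ℝ → Plane),
      Driven A C U ζ ζ' ω ∧ ∀ t, 0 ≤ t → ζ t = z t := by
  obtain ⟨V, hVc, hVb, hVa, hVl, hVe⟩ := h.exists_velocity
  have hCk : 0 ≤ C * kernConst := mul_nonneg (h.bdd 0).nonneg kernConst_nonneg
  set ζ' : ℝ → Plane := fun t => V 0 t (z t) with hζ'
  have hζc : Continuous ζ' := (hVc 0).comp (continuous_id.prodMk h.cont)
  -- The given path is constrained only for t ≥ 0; this curve is differentiable on the whole line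
  -- and coincides with it there.
  set ζ : ℝ → Plane := fun t => z₀ + ∫ s in (0 : ℝ)..t, ζ' s with hζ
  have hζz : ∀ t, 0 ≤ t → ζ t = z t := by
    intro t ht
    rw [hz t ht, hζ]
    dsimp only
    rw [intervalIntegral.integral_of_le ht, intervalIntegral.integral_of_le ht]
    congr 1
    refine integral_congr_ae (ae_restrict_of_ae_restrict_of_subset
      (fun s hs => le_of_lt hs.1 : Ioc 0 t ⊆ Ici 0) ?_)
    filter_upwards [hVe] with s hs
    exact hs _
  -- Subtracting the velocity at the vortex makes the relative field vanish at the origin, as the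
  -- lower bound on distances to the vortex requires.
  refine ⟨4 * (C * kernConst), fun e t y => V e t (y + z t) - V e t (z t), ζ, ζ',
    ⟨⟨⟨⟨fun e he => ?_, fun e he t y => ?_, fun e he t y => ?_, fun e he t x y => ?_⟩,
      fun e he t => by simp⟩, hζc, fun t => ?_, fun t => ?_⟩, h.meas, h.bdd, ?_⟩, hζz⟩
  · exact ((hVc e).comp (continuous_fst.prodMk (continuous_snd.add
      (h.cont.comp continuous_fst)))).sub
      ((hVc e).comp (continuous_fst.prodMk (h.cont.comp continuous_fst)))
  · have := norm_sub_le (V e t (y + z t)) (V e t (z t))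
    linarith [hVb e t (y + z t), hVb e t (z t)]
  · rw [sub_sub_sub_comm]
    have := norm_sub_le (V e t (y + z t) - V 0 t (y + z t)) (V e t (z t) - V 0 t (z t))
    have h1 := hVa e he.1 t (y + z t)
    have h2 := hVa e he.1 t (z t)
    have h3 := mul_nonneg hCk he.1.le
    linarith
  · rw [sub_sub_sub_cancel_right]
    have := hVl e he t (x + z t) (y + z t)
    rw [add_sub_add_right_eq_sub] at this
    rwa [← mul_assoc 4 C]
  · exact (hVb 0 t (z t)).trans (by linarith)
  · exact (intervalIntegral.integral_hasDerivAt_right (hζc.intervalIntegrable _ _)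
      hζc.aestronglyMeasurable.stronglyMeasurableAtFilter hζc.continuousAt).const_add z₀
  · filter_upwards [hVe, ae_restrict_mem measurableSet_Ici] with t ht ht0 x
    rw [← ht x, hζz t ht0, sub_add_cancel]
    simp only [hζ', add_sub_cancel]

end WeakVorticity

end VortexWave


namespace VortexWave

/-! ### Representatives -/

theorem biotSavart_congr {f g : Plane → ℝ} (h : f =ᵐ[volume] g) : biotSavart f = biotSavart g := by
  ext1 x
  refine integral_congr_ae ?_
  filter_upwards [h] with y hy
  rw [hy]

theorem BoundedL1.mono {C C' : ℝ} {f : Plane → ℝ} (h : BoundedL1 C f) (hC : C ≤ C') :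
    BoundedL1 C' f :=
  ⟨h.integrable, fun x => (h.abs_le x).trans hC, h.integral_le.trans hC⟩

theorem ae_ae_eq_of_ae_eq {ω ω' : ℝ → Plane → ℝ}
    (h : Function.uncurry ω' =ᵐ[spaceTime] Function.uncurry ω) :
    ∀ᵐ t ∂(volume.restrict (Ici (0 : ℝ))), ω' t =ᵐ[volume] ω t :=
  Measure.ae_ae_of_ae_prod h

/-- Values are truncated at the essential bound C, and the function is set to 0 at the times when
the L¹ bound fails; both changes affect a null set only. -/
theorem exists_boundedL1_rep {ω : ℝ → Plane → ℝ} (h : MemLinfL1Linf ω) :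
    ∃ (C : ℝ) (ω' : ℝ → Plane → ℝ), Measurable (Function.uncurry ω') ∧
      (∀ t, BoundedL1 C (ω' t)) ∧ Function.uncurry ω' =ᵐ[spaceTime] Function.uncurry ω := by
  obtain ⟨hm, C, hC⟩ := h
  set f : ℝ × Plane → ℝ := hm.mk _ with hf
  have hfm : Measurable f := hm.stronglyMeasurable_mk.measurable
  have hfe : Function.uncurry ω =ᵐ[spaceTime] f := hm.ae_eq_mk
  set f₁ : ℝ × Plane → ℝ := fun p => max (-C) (min C (f p)) with hf₁
  have hf₁m : Measurable f₁ := measurable_const.max (measurable_const.min hfm)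
  have hf₁C : ∀ p, |f₁ p| ≤ C := fun p => by
    rw [abs_le]
    exact ⟨le_max_left _ _, max_le (by linarith [C.coe_nonneg]) (min_le_left _ _)⟩
  have hI : Measurable fun t => ∫⁻ x, ‖f₁ (t, x)‖ₑ :=
    hf₁m.enorm.lintegral_prod_right'
  set T : Set ℝ := {t | ∫⁻ x, ‖f₁ (t, x)‖ₑ ≤ C} with hT
  have hTm : MeasurableSet T := measurableSet_le hI measurable_const
  have hω' : Measurable ((T ×ˢ univ).indicator f₁) := hf₁m.indicator (hTm.prod .univ)
  refine ⟨C, fun t x => (T ×ˢ univ).indicator f₁ (t, x), hω', fun t => ?_, ?_⟩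
  · by_cases ht : t ∈ T
    · have e : (fun x => (T ×ˢ (univ : Set Plane)).indicator f₁ (t, x)) =
          fun x => f₁ (t, x) := by
        ext x
        exact indicator_of_mem (mk_mem_prod ht (mem_univ x)) f₁
      change BoundedL1 C fun x => (T ×ˢ univ).indicator f₁ (t, x)
      rw [e]
      have hmt : Measurable fun x => f₁ (t, x) := hf₁m.comp measurable_prodMk_left
      refine ⟨⟨hmt.aestronglyMeasurable, ht.trans_lt ENNReal.coe_lt_top⟩, fun x => hf₁C _, ?_⟩
      have h1 := integral_norm_eq_lintegral_enorm (μ := volume) hmt.aestronglyMeasurable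
      simp_rw [Real.norm_eq_abs] at h1
      rw [h1]
      exact ENNReal.toReal_le_of_le_ofReal C.coe_nonneg (by
        rw [ENNReal.ofReal_coe_nnreal]; exact ht)
    · have e : (fun x => (T ×ˢ (univ : Set Plane)).indicator f₁ (t, x)) = fun _ => 0 := by
        ext x
        exact indicator_of_notMem (fun hm => ht hm.1) f₁
      change BoundedL1 C fun x => (T ×ˢ univ).indicator f₁ (t, x)
      rw [e]
      exact ⟨by simp, by simp, by simp⟩
  · have h1 : ∀ᵐ t ∂(volume.restrict (Ici (0 : ℝ))), ∀ᵐ x,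
        (T ×ˢ univ).indicator f₁ (t, x) = f (t, x) := by
      filter_upwards [Measure.ae_ae_of_ae_prod hfe, hC] with t ht htC
      have hb : ∀ᵐ x, ‖ω t x‖ₑ ≤ C := by
        have := htC.2
        rw [eLpNorm_exponent_top] at this
        filter_upwards [ae_le_eLpNormEssSup (f := ω t) (μ := volume)] with x hx
        exact hx.trans this
      have heq : ∀ᵐ x, f₁ (t, x) = f (t, x) := by
        filter_upwards [ht, hb] with x hx hxb
        have h2 : |f (t, x)| ≤ C := by
          rw [← hx]
          have h3 : ‖ω t x‖₊ ≤ C := by exact_mod_cast hxb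
          exact_mod_cast h3
        rw [abs_le] at h2
        simp only [hf₁]
        rw [min_eq_right h2.2, max_eq_right h2.1]
      have htT : t ∈ T := by
        have := htC.1
        rw [eLpNorm_one_eq_lintegral_enorm] at this
        refine le_trans (le_of_eq (lintegral_congr_ae ?_)) this
        filter_upwards [heq, ht] with x h1 h2
        rw [h1, ← h2]
        rfl
      filter_upwards [heq] with x hx
      rw [indicator_of_mem (mk_mem_prod htT (mem_univ x)), hx]
    have h2 : ∀ᵐ p ∂spaceTime, (T ×ˢ univ).indicator f₁ p = f p :=
      (Measure.ae_prod_iff_ae_ae (measurableSet_eq_fun hω' hfm)).2 h1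
    filter_upwards [h2, hfe] with p h3 h4
    rw [h4, ← h3]
    rfl

/-- The datum is viewed as a vorticity constant in time, and the representative is read at one good
time. -/
theorem exists_boundedL1_rep_datum {ω₀ : Plane → ℝ} (h : MemL1Linf ω₀) :
    ∃ (C : ℝ) (f : Plane → ℝ), Measurable f ∧ BoundedL1 C f ∧ f =ᵐ[volume] ω₀ := by
  have hmem : MemLinfL1Linf fun _ => ω₀ := by
    refine ⟨h.1.1.comp_snd, (max (eLpNorm ω₀ 1 volume) (eLpNorm ω₀ ∞ volume)).toNNReal,
      .of_forall fun t => ?_⟩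
    rw [ENNReal.coe_toNNReal (max_lt h.1.2 h.2.2).ne]
    exact ⟨le_max_left _ _, le_max_right _ _⟩
  obtain ⟨C, ω', hm, hb, he⟩ := exists_boundedL1_rep hmem
  have hne : (ae (volume.restrict (Ici (0 : ℝ)))).NeBot := by
    rw [ae_neBot]
    simp
  obtain ⟨t, ht⟩ := (ae_ae_eq_of_ae_eq he).exists
  exact ⟨C, ω' t, hm.comp measurable_prodMk_left, hb t, ht⟩

theorem fderiv_uncurry_apply {ψ : ℝ → Plane → ℝ} (hψ : ContDiff ℝ (⊤ : ℕ∞) (Function.uncurry ψ))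
    (t : ℝ) (x w : Plane) :
    deriv (fun s => ψ s x) t + fderiv ℝ (ψ t) x w =
      fderiv ℝ (Function.uncurry ψ) (t, x) (1, w) := by
  have hd := (hψ.differentiable (by simp) (t, x)).hasFDerivAt
  have h1 : deriv (fun s => ψ s x) t = fderiv ℝ (Function.uncurry ψ) (t, x) (1, 0) :=
    (hd.comp_hasDerivAt (f := fun s => (s, x)) t
      ((hasDerivAt_id t).prodMk (hasDerivAt_const t x))).deriv
  have h2 : fderiv ℝ (ψ t) x w = fderiv ℝ (Function.uncurry ψ) (t, x) (0, w) := by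
    have h3 : HasFDerivAt (ψ t) _ x := hd.comp x (hasFDerivAt_prodMk_right t x)
    rw [h3.fderiv]
    simp
  rw [h1, h2, ← map_add]
  simp

theorem IsEulerian.exists_weakVorticity {ω₀ : Plane → ℝ} (hω₀ : MemL1Linf ω₀) {z₀ : Plane}
    {ω : ℝ → Plane → ℝ} {z : ℝ → Plane} (h : IsEulerian ω₀ z₀ ω z) :
    ∃ (C : ℝ) (f₀ : Plane → ℝ) (f : ℝ → Plane → ℝ), f₀ =ᵐ[volume] ω₀ ∧
      Function.uncurry f =ᵐ[spaceTime] Function.uncurry ω ∧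
      WeakVorticity C f₀ (fun t => z (max t 0)) f ∧
      ∀ t, 0 ≤ t → z (max t 0) = z₀ + ∫ s in (0 : ℝ)..t, biotSavart (f s) (z (max s 0)) := by
  obtain ⟨C₀, f₀, hm₀, hb₀, he₀⟩ := exists_boundedL1_rep_datum hω₀
  obtain ⟨C₁, f, hm, hb, he⟩ := exists_boundedL1_rep h.mem
  have hae := ae_ae_eq_of_ae_eq he
  refine ⟨max C₀ C₁, f₀, f, he₀, he, ⟨hm, fun t => (hb t).mono (le_max_right _ _), hm₀,
    hb₀.mono (le_max_left _ _), ?_, fun ψ hψ hψc => ?_⟩, fun t ht => ?_⟩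
  · exact h.continuousOn_z.comp_continuous (by fun_prop) fun t => le_max_right t 0
  · have hw := h.weak (fun t x => ψ (t, x)) hψ hψc
    have e0 : ∫ x, f₀ x * ψ (0, x) = ∫ x, ω₀ x * ψ (0, x) := by
      refine integral_congr_ae ?_
      filter_upwards [he₀] with x hx
      rw [hx]
    rw [e0, hw]
    refine integral_congr_ae ?_
    filter_upwards [hae, ae_restrict_mem measurableSet_Ici] with t ht ht0
    refine integral_congr_ae ?_
    filter_upwards [ht] with x hx
    rw [hx, fderiv_uncurry_apply (ψ := fun t x => ψ (t, x)) hψ, biotSavart_congr ht, max_eq_left ht0]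
    rfl
  · rw [max_eq_left ht, h.point_vortex t ht, intervalIntegral.integral_of_le ht,
      intervalIntegral.integral_of_le ht]
    congr 1
    refine integral_congr_ae (ae_restrict_of_ae_restrict_of_subset
      (fun s hs => le_of_lt hs.1 : Ioc 0 t ⊆ Ici 0) ?_)
    filter_upwards [hae, ae_restrict_mem measurableSet_Ici] with s hs hs0
    rw [max_eq_left hs0, biotSavart_congr hs]
    rfl

end VortexWave


namespace VortexWave

/-! ### From Eulerian to Lagrangian solutions -/

theorem contDiff_one_of_hasDerivAt {γ γ' : ℝ → Plane} (h : ∀ t, HasDerivAt γ (γ' t) t)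
    (hc : Continuous γ') : ContDiff ℝ 1 γ := by
  rw [contDiff_one_iff_deriv]
  refine ⟨fun t => (h t).differentiableAt, ?_⟩
  rwa [show deriv γ = γ' from funext fun t => (h t).deriv]

theorem continuousAt_kernel {x : Plane} (hx : x ≠ 0) : ContinuousAt kernel x := by
  unfold kernel
  refine ContinuousAt.smul (ContinuousAt.div (f := fun _ => (1 : ℝ))
    (g := fun x : Plane => 2 * Real.pi * ‖x‖ ^ 2) continuousAt_const (by fun_prop) ?_)
    continuous_perp.continuousAt
  have := norm_pos_iff.2 hx
  positivity

/-- The smoothing scale is e = |x − y|, as for `RegField.logLip`. -/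
theorem BoundedL1.norm_biotSavart_sub_le {C : ℝ} {f : Plane → ℝ} (h : BoundedL1 C f)
    (x y : Plane) :
    ‖biotSavart f x - biotSavart f y‖ ≤ 6 * (C * kernConst) * modulus ‖x - y‖ := by
  have hCk : 0 ≤ C * kernConst := mul_nonneg h.nonneg kernConst_nonneg
  rw [← smoothVelocity_zero]
  rcases eq_or_ne x y with rfl | hxy
  · simp [modulus]
  have hr : 0 < ‖x - y‖ := norm_pos_iff.2 (sub_ne_zero.2 hxy)
  unfold modulus
  split_ifs with h1
  · have e1 := h.norm_smoothVelocity_sub_le hr x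
    have e2 := h.norm_smoothVelocity_sub_le hr y
    have e3 := h.lipschitz_smoothVelocity hr h1.le x y
    rw [norm_sub_rev] at e1
    have e4 := norm_sub_le_norm_sub_add_norm_sub (smoothVelocity 0 f x)
      (smoothVelocity ‖x - y‖ f x) (smoothVelocity 0 f y)
    have e5 := norm_sub_le_norm_sub_add_norm_sub (smoothVelocity ‖x - y‖ f x)
      (smoothVelocity ‖x - y‖ f y) (smoothVelocity 0 f y)
    rw [one_div, Real.log_inv] at e3
    have e6 := Real.log_nonpos hr.le h1.le
    have e7 : 0 ≤ C * kernConst * ‖x - y‖ * -Real.log ‖x - y‖ :=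
      mul_nonneg (mul_nonneg hCk hr.le) (by linarith)
    nlinarith [mul_nonneg hCk hr.le]
  · have := norm_sub_le (smoothVelocity 0 f x) (smoothVelocity 0 f y)
    linarith [h.norm_smoothVelocity_le 0 x, h.norm_smoothVelocity_le 0 y]

theorem BoundedL1.eLpNorm_le {C : ℝ} {f : Plane → ℝ} (h : BoundedL1 C f) :
    eLpNorm f 1 volume ≤ ENNReal.ofReal C ∧ eLpNorm f ∞ volume ≤ ENNReal.ofReal C := by
  constructor
  · rw [eLpNorm_one_eq_lintegral_enorm, ← ofReal_integral_norm_eq_lintegral_enorm h.integrable]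
    exact ENNReal.ofReal_le_ofReal h.integral_le
  · rw [eLpNorm_exponent_top]
    exact eLpNormEssSup_le_of_ae_bound (.of_forall h.abs_le)

theorem memLinfL1Linf_of_boundedL1 {C : ℝ} {ω : ℝ → Plane → ℝ}
    (hm : Measurable (Function.uncurry ω)) (h : ∀ t, 0 ≤ t → BoundedL1 C (ω t)) :
    MemLinfL1Linf ω :=
  ⟨hm.aestronglyMeasurable, C.toNNReal, (ae_restrict_iff' measurableSet_Ici).2
    (.of_forall fun t ht => (h t ht).eLpNorm_le)⟩

theorem WeakVorticity.weakTransport {A C : ℝ} {U : ℝ → ℝ → Plane → Plane} {ζ ζ' z : ℝ → Plane}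
    {ω : ℝ → Plane → ℝ} {ω₀ : Plane → ℝ} (h : WeakVorticity C ω₀ z ω) (d : Driven A C U ζ ζ' ω)
    (hζ : ∀ t, 0 ≤ t → ζ t = z t) : WeakTransport C (fullDrift U ζ ζ') ω₀ ω where
  meas := h.meas
  meas₀ := h.meas₀
  bdd t := (h.bdd t).abs_le
  bdd₀ := h.bdd₀.abs_le
  weak ψ hψ hψc := by
    rw [h.weak ψ hψ hψc]
    refine integral_congr_ae ?_
    filter_upwards [d.fullDrift_eq, ae_restrict_mem measurableSet_Ici] with t ht ht0
    simp_rw [ht, hζ t ht0]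

namespace Frame

variable {A : ℝ} {U : ℝ → ℝ → Plane → Plane} {ζ ζ' : ℝ → Plane}

theorem fullFlow_ne (h : Frame A U ζ ζ') (s t : ℝ) {x : Plane} (hx : x ≠ ζ s) :
    fullFlow U ζ s t x ≠ ζ t := fun h0 => by
  refine h.field.flow_ne_zero s t (sub_ne_zero.2 hx) ?_
  rw [fullFlow] at h0
  exact add_eq_left.1 h0

theorem hasDerivAt_fullFlow (h : Frame A U ζ ζ') (s t : ℝ) {x : Plane} (hx : x ≠ ζ s) :
    HasDerivAt (fun t => fullFlow U ζ s t x) (fullDrift U ζ ζ' t (fullFlow U ζ s t x)) t := by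
  have h1 := (h.field.flow_isSol s (sub_ne_zero.2 hx) t).2
  have h2 := (h.hasDerivAt t).add h1
  refine h2.congr_deriv ?_
  rw [fullDrift, fullFlow, add_sub_cancel_left]

theorem continuous_fullFlow_right (h : Frame A U ζ ζ') (s : ℝ) {x : Plane} (hx : x ≠ ζ s) :
    Continuous fun t => fullFlow U ζ s t x :=
  continuous_iff_continuousAt.2 fun t => (h.hasDerivAt_fullFlow s t hx).continuousAt

theorem contDiff_fullFlow (h : Frame A U ζ ζ') (s : ℝ) {x : Plane} (hx : x ≠ ζ s) :
    ContDiff ℝ 1 fun t => fullFlow U ζ s t x := by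
  refine contDiff_one_of_hasDerivAt (fun t => h.hasDerivAt_fullFlow s t hx) ?_
  have hc := h.continuous_fullFlow_right s hx
  have hd : Continuous fun t => fullFlow U ζ s t x - ζ t := hc.sub h.continuous
  refine h.continuous_deriv.add (((h.field.reg.cont 0 (by simp)).comp
    (continuous_id.prodMk hd)).add (continuous_iff_continuousAt.2 fun t => ?_))
  exact (continuousAt_kernel (sub_ne_zero.2 (h.fullFlow_ne s t hx))).comp
    (f := fun t => fullFlow U ζ s t x - ζ t) hd.continuousAt

theorem continuousOn_fullFlow_apply (h : Frame A U ζ ζ') (s t : ℝ) :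
    ContinuousOn (fullFlow U ζ s t) {ζ s}ᶜ := by
  have h1 : ContinuousOn (fun x : Plane => vortexFlow U s t (x - ζ s)) {ζ s}ᶜ :=
    h.field.continuousOn_flow.comp (f := fun x : Plane => ((s, t, x - ζ s) : ℝ × ℝ × Plane))
      (by fun_prop) fun x hx => sub_ne_zero.2 hx
  exact continuousOn_const.add h1

/-- The flow as a homeomorphism of the plane deprived of the position of the vortex. -/
noncomputable def fullHomeomorph (h : Frame A U ζ ζ') (s t : ℝ) :
    ({ζ s}ᶜ : Set Plane) ≃ₜ ({ζ t}ᶜ : Set Plane) where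
  toFun x := ⟨fullFlow U ζ s t x, h.fullFlow_ne s t x.2⟩
  invFun x := ⟨fullFlow U ζ t s x, h.fullFlow_ne t s x.2⟩
  left_inv x := Subtype.ext ((h.fullFlow_comp s t s x).trans (h.fullFlow_self s x))
  right_inv x := Subtype.ext ((h.fullFlow_comp t s t x).trans (h.fullFlow_self t x))
  continuous_toFun := (h.continuousOn_fullFlow_apply s t).domRestrict.subtype_mk _
  continuous_invFun := (h.continuousOn_fullFlow_apply t s).domRestrict.subtype_mk _

theorem fullFlow_unique (h : Frame A U ζ ζ') {u v s : ℝ} {γ : ℝ → Plane}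
    (hne : ∀ t ∈ Icc u v, γ t ≠ ζ t)
    (hγ : ∀ t ∈ Icc u v, HasDerivWithinAt γ (fullDrift U ζ ζ' t (γ t)) (Icc u v) t)
    (hs : s ∈ Icc u v) {t : ℝ} (ht : t ∈ Icc u v) : γ t = fullFlow U ζ s t (γ s) := by
  have hsol : IsSolOn {0}ᶜ (vortexDrift U) (Icc u v) fun t => γ t - ζ t := fun r hr =>
    ⟨sub_ne_zero.2 (hne r hr), ((hγ r hr).sub (h.hasDerivAt r).hasDerivWithinAt).congr_deriv
      (by rw [fullDrift, add_sub_cancel_left])⟩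
  have := h.field.flow_unique hsol hs ht
  rw [fullFlow, ← this, add_sub_cancel]

end Frame

/-- A velocity field which agrees for nonnegative times with that of a frame moving with `z`. -/
structure FollowsFrame (A : ℝ) (U : ℝ → ℝ → Plane → Plane) (ζ ζ' : ℝ → Plane) (z : ℝ → Plane)
    (v : ℝ → Plane → Plane) : Prop where
  frame : Frame A U ζ ζ'
  pos : ∀ t, 0 ≤ t → ζ t = z t
  vel : ∀ t, 0 ≤ t → ∀ x, v t x = ζ' t + U 0 t (x - ζ t)

namespace FollowsFrame

variable {A : ℝ} {U : ℝ → ℝ → Plane → Plane} {ζ ζ' z : ℝ → Plane} {v : ℝ → Plane → Plane}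

theorem fullDrift_eq (h : FollowsFrame A U ζ ζ' z v) {t : ℝ} (ht : 0 ≤ t) (x : Plane) :
    fullDrift U ζ ζ' t x = v t x + kernel (x - z t) := by
  rw [h.vel t ht, fullDrift, vortexDrift, add_assoc, ← h.pos t ht]

theorem continuousOn (h : FollowsFrame A U ζ ζ' z v) :
    ContinuousOn (Function.uncurry v) (Ici 0 ×ˢ univ) := by
  have hc : Continuous fun p : ℝ × Plane => ζ' p.1 + U 0 p.1 (p.2 - ζ p.1) :=
    (h.frame.continuous_deriv.comp continuous_fst).add ((h.frame.field.reg.cont 0 (by simp)).comp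
      (continuous_fst.prodMk (continuous_snd.sub (h.frame.continuous.comp continuous_fst))))
  exact hc.continuousOn.congr fun p hp => h.vel p.1 hp.1 p.2

theorem contDiffOn_vortex (h : FollowsFrame A U ζ ζ' z v) : ContDiffOn ℝ 1 z (Ici 0) :=
  (contDiff_one_of_hasDerivAt h.frame.hasDerivAt h.frame.continuous_deriv).contDiffOn.congr
    fun t ht => (h.pos t ht).symm

theorem hasDerivWithinAt_vortex (h : FollowsFrame A U ζ ζ' z v) {t : ℝ} (ht : 0 ≤ t) :
    HasDerivWithinAt z (v t (z t)) (Ici 0) t := by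
  refine (((h.frame.hasDerivAt t).hasDerivWithinAt).congr (fun s hs => (h.pos s hs).symm)
    (h.pos t ht).symm).congr_deriv ?_
  rw [h.vel t ht, h.pos t ht, sub_self, h.frame.field.zero 0 (by simp), add_zero]

theorem hasDerivWithinAt_flow (h : FollowsFrame A U ζ ζ' z v) {x : Plane} (hx : x ≠ ζ 0) {t : ℝ}
    (ht : 0 ≤ t) : HasDerivWithinAt (fun s => fullFlow U ζ 0 s x)
      (v t (fullFlow U ζ 0 t x) + kernel (fullFlow U ζ 0 t x - z t)) (Ici 0) t := by
  rw [← h.fullDrift_eq ht]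
  exact (h.frame.hasDerivAt_fullFlow 0 t hx).hasDerivWithinAt

theorem trajectory_eq (h : FollowsFrame A U ζ ζ' z v) {x : Plane} {T : ℝ} {γ : ℝ → Plane}
    (hγ : IsTrajectory v z x T γ) {t : ℝ} (ht : t ∈ Ico 0 T) : γ t = fullFlow U ζ 0 t x := by
  have hsub : Icc 0 t ⊆ Ico 0 T := fun s hs => ⟨hs.1, hs.2.trans_lt ht.2⟩
  rw [← hγ.start]
  refine h.frame.fullFlow_unique (u := 0) (v := t) (fun s hs => ?_) (fun s hs => ?_)
    ⟨le_rfl, ht.1⟩ ⟨ht.1, le_rfl⟩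
  · rw [h.pos s hs.1]; exact hγ.avoid s (hsub hs)
  · rw [h.fullDrift_eq hs.1]; exact (hγ.hasDeriv s (hsub hs)).mono hsub

end FollowsFrame

theorem IsLagrangian.isTrajectory {ω₀ : Plane → ℝ} {z₀ : Plane} {ω : ℝ → Plane → ℝ}
    {z : ℝ → Plane} {φ : ℝ → Plane → Plane} (h : IsLagrangian ω₀ z₀ ω z φ) {x : Plane}
    (hx : x ≠ z₀) (T : ℝ) : IsTrajectory (velocity ω) z x T fun t => φ t x where
  start := h.flow_zero x hx
  avoid t ht := by
    obtain ⟨e, he⟩ := h.homeomorph t ht.1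
    rw [← he ⟨x, hx⟩]
    exact (e ⟨x, hx⟩).2
  hasDeriv t ht := (h.deriv_flow x hx t ht.1).mono fun _ hs => hs.1

/-- Representatives of one vorticity give the same velocity at almost every time; continuity removes
the exception. This makes the flow independent of the representative. -/
theorem eqOn_velocity_of_ae_eq {ω ω' : ℝ → Plane → ℝ}
    (h : Function.uncurry ω' =ᵐ[spaceTime] Function.uncurry ω)
    (hc : ContinuousOn (Function.uncurry (velocity ω)) (Ici 0 ×ˢ univ))
    (hc' : ContinuousOn (Function.uncurry (velocity ω')) (Ici 0 ×ˢ univ)) {t : ℝ} (ht : 0 ≤ t)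
    (x : Plane) : velocity ω' t x = velocity ω t x := by
  have hx : ∀ {w : ℝ → Plane → ℝ}, ContinuousOn (Function.uncurry (velocity w)) (Ici 0 ×ˢ univ) →
      ContinuousOn (fun t => velocity w t x) (Ici 0) := fun hw =>
    hw.comp (f := fun t : ℝ => (t, x)) (by fun_prop) fun t ht => ⟨ht, mem_univ _⟩
  have key : EqOn (fun t => velocity ω' t x) (fun t => velocity ω t x) (Ici 0) := by
    refine Measure.eqOn_of_ae_eq (μ := volume) ?_ (hx hc') (hx hc)
      (by rw [interior_Ici, closure_Ioi])
    filter_upwards [ae_ae_eq_of_ae_eq h] with s hs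
    exact congr_fun (biotSavart_congr hs) x
  exact key ht

/-- The flow attached to an Eulerian solution. -/
theorem IsEulerian.exists_followsFrame {ω₀ : Plane → ℝ} (hω₀ : MemL1Linf ω₀) {z₀ : Plane}
    {ω : ℝ → Plane → ℝ} {z : ℝ → Plane} (h : IsEulerian ω₀ z₀ ω z) :
    ∃ (A C : ℝ) (U : ℝ → ℝ → Plane → Plane) (ζ ζ' : ℝ → Plane) (ω' : ℝ → Plane → ℝ),
      Function.uncurry ω' =ᵐ[spaceTime] Function.uncurry ω ∧
      FollowsFrame A U ζ ζ' z (velocity ω') ∧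
      (∀ t, 0 ≤ t → BoundedL1 C (ω' t)) ∧
      IsLagrangian ω₀ z₀ ω' z (fullFlow U ζ 0) := by
  obtain ⟨C, f₀, f, hf₀, hf, hw, hz⟩ := h.exists_weakVorticity hω₀
  obtain ⟨A, U, ζ, ζ', hd, hζ⟩ := hw.exists_driven hz
  have hζz : ∀ t, 0 ≤ t → ζ t = z t := fun t ht => by rw [hζ t ht, max_eq_left ht]
  have hwt := hw.weakTransport hd hζ
  have hm := hd.frame.measurable_transported hw.meas₀
  have hb : ∀ t, 0 ≤ t → BoundedL1 C (transported U ζ f₀ t) := fun t ht =>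
    hd.boundedL1_transported hw.bdd₀ ht
  have hF : FollowsFrame A U ζ ζ' z (velocity (transported U ζ f₀)) :=
    ⟨hd.frame, hζz, fun t ht x => hd.biotSavart_transported hw.bdd₀ hwt ht x⟩
  have hz0 : ζ 0 = z₀ := by
    rw [hζz 0 le_rfl, h.point_vortex 0 le_rfl, intervalIntegral.integral_same, add_zero]
  have hae : Function.uncurry (transported U ζ f₀) =ᵐ[spaceTime] Function.uncurry f := by
    refine (Measure.ae_prod_iff_ae_ae (measurableSet_eq_fun hm hw.meas)).2 ?_
    filter_upwards [hd.ae_eq_transported hwt] with t ht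
    filter_upwards [ht] with x hx
    exact hx.symm
  -- The chosen representative is the datum transported by the flow; its velocity is the frame
  -- velocity at every t ≥ 0, not merely almost every.
  refine ⟨A, C, U, ζ, ζ', transported U ζ f₀, hae.trans hf, hF, hb, ?_⟩
  refine ⟨memLinfL1Linf_of_boundedL1 hm hb, hF.continuousOn, hF.contDiffOn_vortex,
    fun t ht => hF.hasDerivWithinAt_vortex ht, (hζz 0 le_rfl).symm.trans hz0, fun x hx => ?_,
    fun x hx t ht => ?_, fun x _ => hd.frame.fullFlow_self 0 x, fun t ht => ?_, fun t ht => ?_,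
    fun t ht => ?_⟩
  · rw [← hz0] at hx
    exact (hd.frame.contDiff_fullFlow 0 hx).contDiffOn
  · rw [← hz0] at hx
    exact hF.hasDerivWithinAt_flow hx ht
  · filter_upwards [hf₀] with x hx
    rw [transported, hd.frame.fullFlow_comp, hd.frame.fullFlow_self, hx]
  · rw [← hz0, ← hζz t ht]
    exact ⟨hd.frame.fullHomeomorph 0 t, fun x => rfl⟩
  · have hpre : fullFlow U ζ 0 t ⁻¹' {ζ t}ᶜ = {ζ 0}ᶜ := by
      ext x
      simp only [mem_preimage, mem_compl_iff, mem_singleton_iff]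
      refine not_congr ⟨fun hx => ?_, fun hx => ?_⟩
      · by_contra hne
        exact hd.frame.fullFlow_ne 0 t hne hx
      · rw [hx, fullFlow, sub_self, vortexFlow_zero, add_zero]
    have := (hd.measurePreserving_fullFlow ht).restrict_preimage
      (measurableSet_singleton (ζ t)).compl
    rwa [hpre, hz0, hζz t ht] at this

end VortexWave


namespace VortexWave

/-! ### From Lagrangian to Eulerian solutions -/

theorem MemLinfL1Linf.congr {ω ω' : ℝ → Plane → ℝ} (h : MemLinfL1Linf ω')
    (he : Function.uncurry ω' =ᵐ[spaceTime] Function.uncurry ω) : MemLinfL1Linf ω := by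
  obtain ⟨hm, C, hC⟩ := h
  refine ⟨hm.congr he, C, ?_⟩
  filter_upwards [hC, ae_ae_eq_of_ae_eq he] with t ht hte
  rwa [← eLpNorm_congr_ae hte, ← eLpNorm_congr_ae hte]

namespace IsLagrangian

variable {ω₀ : Plane → ℝ} {z₀ : Plane} {ω : ℝ → Plane → ℝ} {z : ℝ → Plane}
  {φ : ℝ → Plane → Plane}

theorem continuousOn_z (h : IsLagrangian ω₀ z₀ ω z φ) : ContinuousOn z (Ici 0) :=
  h.contDiffOn_z.continuousOn

theorem flow_ne (h : IsLagrangian ω₀ z₀ ω z φ) {x : Plane} (hx : x ≠ z₀) {t : ℝ} (ht : 0 ≤ t) :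
    φ t x ≠ z t :=
  (h.isTrajectory hx (t + 1)).avoid t ⟨ht, by linarith⟩

theorem eq_add_integral (h : IsLagrangian ω₀ z₀ ω z φ) {t : ℝ} (ht : 0 ≤ t) :
    z t = z₀ + ∫ s in (0 : ℝ)..t, velocity ω s (z s) := by
  have hc : ContinuousOn (fun s => velocity ω s (z s)) (Ici 0) :=
    h.continuousOn_velocity.comp (f := fun s => (s, z s)) (continuousOn_id.prodMk h.continuousOn_z)
      fun s hs => ⟨hs, mem_univ _⟩
  rw [intervalIntegral.integral_eq_sub_of_hasDeriv_right_of_le ht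
    (h.continuousOn_z.mono Icc_subset_Ici_self)
    (fun s hs => (h.deriv_z s hs.1.le).mono (Ioi_subset_Ici hs.1.le)), h.z_zero, add_sub_cancel]
  refine (hc.mono ?_).intervalIntegrable
  rw [uIcc_of_le ht]
  exact Icc_subset_Ici_self

/-- The flow, extended to negative times and to the initial position of the vortex. -/
noncomputable def extendedFlow (z₀ : Plane) (φ : ℝ → Plane → Plane) (t : ℝ) (x : Plane) : Plane :=
  ({z₀}ᶜ : Set Plane).indicator (φ (max t 0)) x

theorem extendedFlow_eq {t : ℝ} (ht : 0 ≤ t) {x : Plane} (hx : x ≠ z₀) :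
    extendedFlow z₀ φ t x = φ t x := by
  rw [extendedFlow, max_eq_left ht]
  exact indicator_of_mem (s := ({z₀}ᶜ : Set Plane)) hx _

/-- Carathéodory: continuous in time for fixed x, measurable in x for fixed time. -/
theorem measurable_extendedFlow (h : IsLagrangian ω₀ z₀ ω z φ) :
    Measurable (Function.uncurry (extendedFlow z₀ φ)) := by
  refine measurable_uncurry_of_continuous_of_measurable (fun x => ?_) fun t => ?_
  · rcases eq_or_ne x z₀ with rfl | hx
    · simp only [extendedFlow]
      simp [continuous_const]
    · have h1 : Continuous fun t : ℝ => φ (max t 0) x :=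
        (h.contDiffOn_flow x hx).continuousOn.comp_continuous (by fun_prop)
          fun t => le_max_right t 0
      refine h1.congr fun t => ?_
      exact (indicator_of_mem (s := ({z₀}ᶜ : Set Plane)) hx _).symm
  · exact (h.measurePreserving _ (le_max_right t 0)).measurable.indicator
      (measurableSet_singleton z₀).compl

theorem measurePreserving_extendedFlow (h : IsLagrangian ω₀ z₀ ω z φ) {t : ℝ} (ht : 0 ≤ t) :
    MeasurePreserving (extendedFlow z₀ φ t) := by
  have hfull : ∀ a : Plane, (volume : Measure Plane).restrict {a}ᶜ = volume := fun a =>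
    Measure.restrict_eq_self_of_ae_mem (by simp [ae_iff])
  have h1 := h.measurePreserving t ht
  rw [hfull, hfull] at h1
  refine ⟨h.measurable_extendedFlow.comp measurable_prodMk_left, ?_⟩
  refine (Measure.map_congr ?_).trans h1.map_eq
  have hne : ∀ᵐ x : Plane, x ≠ z₀ := by simp [ae_iff]
  filter_upwards [hne] with x hx
  exact extendedFlow_eq ht hx

theorem measurePreserving_prod (h : IsLagrangian ω₀ z₀ ω z φ) :
    MeasurePreserving (fun p : ℝ × Plane => (p.1, extendedFlow z₀ φ p.1 p.2)) spaceTime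
      spaceTime :=
  (MeasurePreserving.id _).skew_product h.measurable_extendedFlow
    ((ae_restrict_iff' measurableSet_Ici).2
      (.of_forall fun _ ht => (h.measurePreserving_extendedFlow ht).map_eq))

/-- The integrand is d/dt ψ(t, φ_t(x)), continuous on [0, ∞) because the trajectory avoids the
vortex, and ψ vanishes for large times. -/
theorem integral_deriv_along_flow (h : IsLagrangian ω₀ z₀ ω z φ) {ψ : ℝ × Plane → ℝ}
    (hψ : ContDiff ℝ (⊤ : ℕ∞) ψ) (hψc : HasCompactSupport ψ) {x : Plane} (hx : x ≠ z₀) :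
    ∫ t in Ici (0 : ℝ), fderiv ℝ ψ (t, φ t x)
      (1, velocity ω t (φ t x) + kernel (φ t x - z t)) = -ψ (0, x) := by
  set w : ℝ → ℝ := fun t => fderiv ℝ ψ (t, φ t x)
    (1, velocity ω t (φ t x) + kernel (φ t x - z t)) with hw
  have hφc : ContinuousOn (fun t => φ t x) (Ici 0) := (h.contDiffOn_flow x hx).continuousOn
  have hvc : ContinuousOn (fun t => velocity ω t (φ t x)) (Ici 0) :=
    h.continuousOn_velocity.comp (f := fun s => (s, φ s x)) (continuousOn_id.prodMk hφc)
      fun s hs => ⟨hs, mem_univ _⟩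
  have hkc : ContinuousOn (fun t => kernel (φ t x - z t)) (Ici 0) := fun t ht =>
    (continuousAt_kernel (sub_ne_zero.2 (h.flow_ne hx ht))).comp_continuousWithinAt
      (f := fun t => φ t x - z t) ((hφc.sub h.continuousOn_z) t ht)
  have hwc : ContinuousOn w (Ici 0) :=
    ((hψ.continuous_fderiv (by simp)).comp_continuousOn (continuousOn_id.prodMk hφc)).clm_apply
      (continuousOn_const.prodMk (hvc.add hkc))
  obtain ⟨M, hM0, hM⟩ : ∃ M : ℝ, 0 ≤ M ∧ ∀ t, M < t → ∀ y, ψ (t, y) = 0 ∧ fderiv ℝ ψ (t, y) = 0 := by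
    obtain ⟨M, hM⟩ := hψc.isCompact.isBounded.subset_closedBall 0
    refine ⟨max M 0, le_max_right _ _, fun t ht y => ?_⟩
    have h1 : (t, y) ∉ tsupport ψ := fun hm => by
      have h2 := hM hm
      rw [mem_closedBall_zero_iff] at h2
      have h3 := (norm_fst_le (t, y)).trans h2
      rw [Real.norm_eq_abs] at h3
      linarith [le_abs_self t, le_max_left M 0]
    exact ⟨image_eq_zero_of_notMem_tsupport h1,
      image_eq_zero_of_notMem_tsupport fun hm => h1 (tsupport_fderiv_subset ℝ hm)⟩
  have hder : ∀ t ∈ Ici (0 : ℝ), HasDerivWithinAt (fun t => ψ (t, φ t x)) (w t) (Ici 0) t :=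
    fun t ht => ((hψ.differentiable (by simp) (t, φ t x)).hasFDerivAt).comp_hasDerivWithinAt t
      ((hasDerivWithinAt_id t _).prodMk (h.deriv_flow x hx t ht))
  have hwint : IntegrableOn w (Ioi 0) := by
    have h1 : IntegrableOn w (Icc 0 M) := (hwc.mono Icc_subset_Ici_self).integrableOn_Icc
    have h2 : IntegrableOn w (Ioi M) := by
      refine (integrableOn_zero (ε' := ℝ)).congr_fun (fun t ht => ?_) measurableSet_Ioi
      simp only [hw, (hM t ht _).2, zero_apply]
    refine (h1.union h2).mono_set fun t ht => ?_
    rcases le_or_gt t M with h3 | h3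
    · exact Or.inl ⟨le_of_lt ht, h3⟩
    · exact Or.inr h3
  rw [integral_Ici_eq_integral_Ioi, integral_Ioi_of_hasDerivAt_of_tendsto
    (f := fun t => ψ (t, φ t x)) (m := 0) ((hder 0 self_mem_Ici).continuousWithinAt)
    (fun t ht => (hder t (mem_Ioi.1 ht).le).hasDerivAt (Ici_mem_nhds ht)) hwint, h.flow_zero x hx,
    zero_sub]
  refine tendsto_const_nhds.congr' ?_
  filter_upwards [Filter.eventually_gt_atTop M] with t ht
  exact (hM t ht _).1.symm

/-- The map (t, x) ↦ (t, φ_t(x)) preserves space-time measure and carries ω to the datum, so after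
Fubini the time integral is taken along each trajectory. A measurable bounded representative is used
to justify Fubini. -/
theorem integral_transport (h : IsLagrangian ω₀ z₀ ω z φ) {C : ℝ} {f₀ : Plane → ℝ}
    {f : ℝ → Plane → ℝ} (hf₀m : Measurable f₀) (hf₀ : f₀ =ᵐ[volume] ω₀)
    (hfm : Measurable (Function.uncurry f)) (hfb : ∀ t, BoundedL1 C (f t))
    (hf : Function.uncurry f =ᵐ[spaceTime] Function.uncurry ω) {ψ : ℝ × Plane → ℝ}
    (hψ : ContDiff ℝ (⊤ : ℕ∞) ψ) (hψc : HasCompactSupport ψ) :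
    -∫ x, ω₀ x * ψ (0, x) = ∫ t in Ici (0 : ℝ), ∫ x, f t x *
      fderiv ℝ ψ (t, x) (1, biotSavart (f t) x + kernel (x - z t)) := by
  set u : ℝ × Plane → Plane := fun p => biotSavart (f p.1) p.2 + kernel (p.2 - z (max p.1 0))
    with hu
  have hzc : Continuous fun t => z (max t 0) :=
    h.continuousOn_z.comp_continuous (by fun_prop) fun t => le_max_right t 0
  have hum : Measurable u := (measurable_biotSavart hfm).add (measurable_kernel.comp
    (measurable_snd.sub (hzc.measurable.comp measurable_fst)))
  set w : ℝ × Plane → ℝ := fun p => fderiv ℝ ψ p (1, u p) with hw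
  have hwm : Measurable w := measurable_fderiv_apply hψ measurable_id (measurable_const.prodMk hum)
  set H : ℝ × Plane → ℝ := fun p => f p.1 p.2 * w p with hH
  have hHm : Measurable H := hfm.mul hwm
  have hfae := ae_ae_eq_of_ae_eq hf
  obtain ⟨D, hD⟩ := (hψ.continuous_fderiv (by simp)).bounded_above_of_compact_support
    (hψc.fderiv ℝ)
  have hD0 : 0 ≤ D := (norm_nonneg _).trans (hD 0)
  obtain ⟨M, hM⟩ : ∃ M : ℝ, ∀ t, M < t → ∀ y, fderiv ℝ ψ (t, y) = 0 := by
    obtain ⟨M, hM⟩ := hψc.isCompact.isBounded.subset_closedBall 0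
    refine ⟨M, fun t ht y => ?_⟩
    refine image_eq_zero_of_notMem_tsupport fun hm => ?_
    have h2 := hM (tsupport_fderiv_subset ℝ hm)
    rw [mem_closedBall_zero_iff] at h2
    have h3 := (norm_fst_le (t, y)).trans h2
    rw [Real.norm_eq_abs] at h3
    linarith [le_abs_self t]
  set B := C + (C * (C * kernConst) + C * kernConst) with hB
  have hbound : ∀ t, Integrable (fun x => |f t x| + |f t x| * ‖u (t, x)‖) ∧
      ∫ x, (|f t x| + |f t x| * ‖u (t, x)‖) ≤ B := fun t => by
    have h1 := (hfb t).integral_mul_norm_velocity_le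
      ((measurable_biotSavart hfm).comp (measurable_prodMk_left (x := t))) (z (max t 0))
    refine ⟨(hfb t).integrable.abs.add h1.1, ?_⟩
    rw [integral_add (hfb t).integrable.abs h1.1]
    exact add_le_add (hfb t).integral_le h1.2
  have hHle : ∀ t x, ‖H (t, x)‖ ≤ D * (|f t x| + |f t x| * ‖u (t, x)‖) := fun t x => by
    have h1 : ‖((1 : ℝ), u (t, x))‖ ≤ 1 + ‖u (t, x)‖ := by
      rw [Prod.norm_def]
      refine max_le ?_ ?_
      · simp
      · simp
    rw [hH, norm_mul, ← mul_one_add, mul_left_comm]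
    refine mul_le_mul_of_nonneg_left (((fderiv ℝ ψ (t, x)).le_opNorm _).trans ?_) (abs_nonneg _)
    exact mul_le_mul (hD _) h1 (norm_nonneg _) hD0
  -- The spatial L¹ norm is bounded uniformly in time, singular kernel included, and is zero after
  -- the time support of ψ.
  have hHi : Integrable H spaceTime := by
    rw [spaceTime, integrable_prod_iff hHm.aestronglyMeasurable]
    refine ⟨.of_forall fun t => ((hbound t).1.const_mul D).mono'
      (hHm.comp measurable_prodMk_left).aestronglyMeasurable (.of_forall (hHle t)), ?_⟩
    have hN : Measurable fun t => ∫ x, ‖H (t, x)‖ :=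
      hHm.norm.stronglyMeasurable.integral_prod_right'.measurable
    have hNle : ∀ t, ‖∫ x, ‖H (t, x)‖‖ ≤ D * B := fun t => by
      rw [Real.norm_of_nonneg (integral_nonneg fun x => norm_nonneg _)]
      refine (integral_mono_of_nonneg (.of_forall fun x => norm_nonneg _)
        ((hbound t).1.const_mul D) (.of_forall (hHle t))).trans ?_
      rw [integral_const_mul]
      exact mul_le_mul_of_nonneg_left (hbound t).2 hD0
    have h1 : IntegrableOn (fun t => ∫ x, ‖H (t, x)‖) (Icc 0 M) :=
      Measure.integrableOn_of_bounded (M := D * B) isCompact_Icc.measure_lt_top.ne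
        hN.aestronglyMeasurable (.of_forall hNle)
    have h2 : IntegrableOn (fun t => ∫ x, ‖H (t, x)‖) (Ioi M) := by
      refine (integrableOn_zero (ε' := ℝ)).congr_fun (fun t ht => ?_) measurableSet_Ioi
      simp [hH, hw, hM t ht]
    refine (h1.union h2).mono_set fun t ht => ?_
    rcases le_or_gt t M with h3 | h3
    · exact Or.inl ⟨ht, h3⟩
    · exact Or.inr h3
  have hT := h.measurePreserving_prod
  set T : ℝ × Plane → ℝ × Plane := fun p => (p.1, extendedFlow z₀ φ p.1 p.2) with hTdef
  have hcomp : ∀ᵐ p ∂spaceTime, H (T p) = f₀ p.2 * w (T p) := by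
    have h1 : ∀ᵐ p ∂spaceTime, f p.1 (extendedFlow z₀ φ p.1 p.2) = f₀ p.2 := by
      refine (Measure.ae_prod_iff_ae_ae (measurableSet_eq_fun (hfm.comp hT.measurable)
        (hf₀m.comp measurable_snd))).2 ?_
      filter_upwards [hfae, ae_restrict_mem measurableSet_Ici] with t ht ht0
      have hne : ∀ᵐ x : Plane, x ≠ z₀ := by simp [ae_iff]
      filter_upwards [(h.measurePreserving_extendedFlow ht0).quasiMeasurePreserving.ae ht,
        h.transported t ht0, hf₀, hne] with x h1 h2 h3 h4
      dsimp only [Function.comp]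
      change f t (extendedFlow z₀ φ t x) = f₀ x
      rw [h1, extendedFlow_eq ht0 h4, h2, h3]
    filter_upwards [h1] with p hp
    simp only [hH, hTdef]
    rw [hp]
  have hI1 : ∫ t in Ici (0 : ℝ), ∫ x, f t x *
      fderiv ℝ ψ (t, x) (1, biotSavart (f t) x + kernel (x - z t)) = ∫ p, H p ∂spaceTime := by
    rw [spaceTime, integral_prod _ hHi]
    refine integral_congr_ae ?_
    filter_upwards [ae_restrict_mem measurableSet_Ici] with t ht
    simp only [hH, hw, hu, max_eq_left (mem_Ici.1 ht)]
  have hI2 : ∫ p, H p ∂spaceTime = ∫ p, f₀ p.2 * w (T p) ∂spaceTime := by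
    rw [← hT.map_eq, integral_map hT.measurable.aemeasurable hHm.aestronglyMeasurable, hT.map_eq]
    exact integral_congr_ae hcomp
  have hJi : Integrable (fun p => f₀ p.2 * w (T p)) spaceTime :=
    (hT.integrable_comp_of_integrable hHi).congr hcomp
  have hI3 : ∫ p, f₀ p.2 * w (T p) ∂spaceTime = ∫ x, f₀ x * -ψ (0, x) := by
    rw [spaceTime, integral_prod_symm _ hJi]
    have hne : ∀ᵐ x : Plane, x ≠ z₀ := by simp [ae_iff]
    refine integral_congr_ae ?_
    filter_upwards [hne] with x hx
    rw [integral_const_mul, ← h.integral_deriv_along_flow hψ hψc hx]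
    congr 1
    refine integral_congr_ae ?_
    filter_upwards [hfae, ae_restrict_mem measurableSet_Ici] with t ht ht0
    simp only [hTdef, hw, hu]
    rw [extendedFlow_eq ht0 hx, biotSavart_congr ht, max_eq_left ht0]
    rfl
  rw [hI1, hI2, hI3, ← integral_neg]
  refine integral_congr_ae ?_
  filter_upwards [hf₀] with x hx
  rw [hx, mul_neg]

theorem isEulerian (h : IsLagrangian ω₀ z₀ ω z φ) (hω₀ : MemL1Linf ω₀) {ω' : ℝ → Plane → ℝ}
    (he : Function.uncurry ω =ᵐ[spaceTime] Function.uncurry ω') : IsEulerian ω₀ z₀ ω' z := by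
  obtain ⟨C₀, f₀, hm₀, -, he₀⟩ := exists_boundedL1_rep_datum hω₀
  obtain ⟨C, f, hm, hb, hf⟩ := exists_boundedL1_rep h.mem
  have hae := ae_ae_eq_of_ae_eq he
  refine ⟨h.mem.congr he, h.continuousOn_z, fun ψ hψ hψc => ?_, fun t ht => ?_⟩
  · have key := h.integral_transport hm₀ he₀ hm hb hf hψ hψc
    refine key.trans (integral_congr_ae ?_)
    filter_upwards [ae_ae_eq_of_ae_eq (hf.trans he)] with t ht
    refine integral_congr_ae ?_
    filter_upwards [ht] with x hx
    rw [fderiv_uncurry_apply hψ, hx, biotSavart_congr ht]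
    rfl
  · rw [h.eq_add_integral ht, intervalIntegral.integral_of_le ht,
      intervalIntegral.integral_of_le ht]
    congr 1
    refine integral_congr_ae (ae_restrict_of_ae_restrict_of_subset
      (fun s hs => le_of_lt hs.1 : Ioc 0 t ⊆ Ici 0) ?_)
    filter_upwards [hae] with s hs
    exact congr_fun (biotSavart_congr hs) _

end IsLagrangian

end VortexWave

theorem mainTheorem3 (ω₀ : VortexWave.Plane → ℝ) (hω₀ : VortexWave.MemL1Linf ω₀)
    (z₀ : VortexWave.Plane) (ω : ℝ → VortexWave.Plane → ℝ) (z : ℝ → VortexWave.Plane) :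
    (VortexWave.IsEulerian ω₀ z₀ ω z →
      ∃ ω' : ℝ → VortexWave.Plane → ℝ,
        Function.uncurry ω' =ᵐ[VortexWave.spaceTime] Function.uncurry ω ∧
        -- regularity of the velocity field
        (ContinuousOn (Function.uncurry (VortexWave.velocity ω')) (Ici 0 ×ˢ univ) ∧
          (∃ M : ℝ, ∀ t : ℝ, 0 ≤ t → ∀ x, ‖VortexWave.velocity ω' t x‖ ≤ M) ∧
          (∃ C : ℝ, ∀ t : ℝ, 0 ≤ t → ∀ x y,
            ‖VortexWave.velocity ω' t x - VortexWave.velocity ω' t y‖ ≤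
              C * VortexWave.modulus ‖x - y‖)) ∧
        -- motion of the point vortex
        (ContDiffOn ℝ 1 z (Ici 0) ∧
          ∀ t : ℝ, 0 ≤ t →
            HasDerivWithinAt z (VortexWave.velocity ω' t (z t)) (Ici 0) t) ∧
        -- existence and uniqueness of the flow
        ∃ φ : ℝ → VortexWave.Plane → VortexWave.Plane,
          VortexWave.IsLagrangian ω₀ z₀ ω' z φ ∧
          (∀ x, x ≠ z₀ → ∀ (T : ℝ) (γ : ℝ → VortexWave.Plane),
            VortexWave.IsTrajectory (VortexWave.velocity ω') z x T γ →
              ∀ t ∈ Ico 0 T, γ t = φ t x) ∧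
          (∀ (ω'' : ℝ → VortexWave.Plane → ℝ) (φ' : ℝ → VortexWave.Plane → VortexWave.Plane),
            Function.uncurry ω'' =ᵐ[VortexWave.spaceTime] Function.uncurry ω →
            VortexWave.IsLagrangian ω₀ z₀ ω'' z φ' →
              ∀ t : ℝ, 0 ≤ t → ∀ x, x ≠ z₀ → φ' t x = φ t x)) ∧
    -- equivalence of the two formulations
    (VortexWave.IsEulerian ω₀ z₀ ω z ↔
      ∃ (ω' : ℝ → VortexWave.Plane → ℝ) (φ : ℝ → VortexWave.Plane → VortexWave.Plane),
        Function.uncurry ω' =ᵐ[VortexWave.spaceTime] Function.uncurry ω ∧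
        VortexWave.IsLagrangian ω₀ z₀ ω' z φ) := by
  refine ⟨fun h => ?_, fun h => ?_, fun ⟨ω', φ, he, hL⟩ => hL.isEulerian hω₀ he⟩
  · obtain ⟨A, C, U, ζ, ζ', ω', he, hF, hb, hL⟩ := h.exists_followsFrame hω₀
    refine ⟨ω', he, ⟨hF.continuousOn, ⟨C * VortexWave.kernConst, fun t ht x => ?_⟩,
      ⟨6 * (C * VortexWave.kernConst), fun t ht x y => (hb t ht).norm_biotSavart_sub_le x y⟩⟩,
      ⟨hF.contDiffOn_vortex, fun t ht => hF.hasDerivWithinAt_vortex ht⟩, _, hL,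
      fun x _ T γ hγ t ht => hF.trajectory_eq hγ ht, fun ω'' φ' he'' hL' t ht x hx => ?_⟩
    · have := (hb t ht).norm_smoothVelocity_le 0 x
      rwa [VortexWave.smoothVelocity_zero] at this
    -- Another flow, possibly attached to another representative, has trajectories of the same
    -- velocity field, so uniqueness of trajectories applies.
    · have hv : ∀ s, 0 ≤ s → ∀ y, VortexWave.velocity ω'' s y = VortexWave.velocity ω' s y :=
        fun s hs y => VortexWave.eqOn_velocity_of_ae_eq (he''.trans he.symm) hF.continuousOn
          hL'.continuousOn_velocity hs y
      have hγ := hL'.isTrajectory hx (t + 1)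
      exact hF.trajectory_eq ⟨hγ.start, hγ.avoid, fun s hs => by
        rw [← hv s hs.1]; exact hγ.hasDeriv s hs⟩ ⟨ht, by linarith⟩
  · obtain ⟨A, C, U, ζ, ζ', ω', he, -, -, hL⟩ := h.exists_followsFrame hω₀
    exact ⟨ω', _, he, hL⟩
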